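/- **Conventions.** A subgroup $\Gamma'$ of finite index of a lattice $\Gamma\subset\mathbb R^3$ is a sublattice of $\Gamma$. $OC(\Gamma)$ is the set of $R\in O(3)$ for which $\Gamma\cap R\Gamma$ has finite index in $\Gamma$ and in $R\Gamma$, and $SOC(\Gamma)=OC(\Gamma)\cap SO(3)$. For $R\in OC(\Gamma)$ put $\Gamma(R)=\Gamma\cap R\Gamma$ (a coincidence site lattice, CSL) and $\Sigma_\Gamma(R)=[\Gamma:\Gamma(R)]$. For a multilattice $L=\bigcup_k(x_k+\Gamma)$ (finite union), $R\in O(3)$ is a linear coincidence isometry of $L$ if $L(R)=L\cap RL$ contains a set $x_k+\ell+\Gamma'$ for some $k$, some $\ell\in\Gamma$ and some sublattice $\Gamma'$ of $\Gamma$; then $L(R)$ is called a coincidence site multilattice (CSML), and its index $\Sigma_L(R)$ is the density of points of $L$ divided by that of $L(R)$. A primitive quaternion is $q=(q_0,q_1,q_2,q_3)\in\mathbb Z^4$ with relatively prime components, and $|q|^2=q_0^2+q_1^2+q_2^2+q_3^2$. Identifying $\mathbb R^3$ with the imaginary quaternions, $R_q(x)=qxq^{-1}$ and $T_q(x)=-qxq^{-1}$.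 $\mathbb J$ is the ring of Hurwitz quaternions (all four components in $\mathbb Z$, or all four in $\frac12+\mathbb Z$), and $\zeta_{\mathbb J}(s)=\sum_I[\mathbb J:I]^{-s}$ $(\operatorname{Re}s>1)$, the sum over all nonzero right ideals $I$ of $\mathbb J$. **Theorem.** Let $$\Gamma=2\mathbb Z^3\cup[(1,1,0)+2\mathbb Z^3]\cup[(0,1,1)+2\mathbb Z^3]\cup[(1,0,1)+2\mathbb Z^3]$$ be the f.c.c. lattice, $x=\frac12(1,1,1)$, and let $D_3^+=\Gamma\cup(x+\Gamma)$ be the diamond packing. The set of linear coincidence isometries of $D_3^+$ is a group, namely $OC(\Gamma)$. Moreover $SOC(\Gamma)=\{R_q: q\text{ primitive}\}$ and $OC(\Gamma)\setminus SOC(\Gamma)=\{T_q: q\text{ primitive}\}$, and for every primitive $q$ the following hold. For $R=R_q$: 1. if $|q|^2\equiv2\pmod 4$, then $D_3^+(R)=\Gamma(R)$ and $\Sigma_{D_3^+}(R)=2\Sigma_\Gamma(R)=|q|^2$; 2. if $|q|^2$ is odd or $|q|^2\equiv0\pmod4$, then $(Rx-x+R\Gamma)\cap\Gamma\ne\varnothing$,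 and $D_3^+(R)=\Gamma(R)\cup[(x+\ell)+\Gamma(R)]$ for every $\ell\in(Rx-x+R\Gamma)\cap\Gamma$; further, $\Sigma_{D_3^+}(R)=\Sigma_\Gamma(R)$, which equals $|q|^2$ if $|q|^2$ is odd and $\frac14|q|^2$ if $|q|^2\equiv0\pmod4$. For $T=T_q$: 1. if $|q|^2$ is odd or $|q|^2\equiv0\pmod4$, then $D_3^+(T)=\Gamma(T)$, and $\Sigma_{D_3^+}(T)=2\Sigma_\Gamma(T)$, which equals $2|q|^2$ if $|q|^2$ is odd and $\frac12|q|^2$ if $|q|^2\equiv0\pmod4$; 2. if $|q|^2\equiv2\pmod4$, then $(Tx-x+T\Gamma)\cap\Gamma\ne\varnothing$, and $D_3^+(T)=\Gamma(T)\cup[(x+\ell)+\Gamma(T)]$ for every $\ell\in(Tx-x+T\Gamma)\cap\Gamma$; further, $\Sigma_{D_3^+}(T)=\Sigma_\Gamma(T)=\frac12|q|^2$. Let $f(m)$ be the number of CSMLs of $D_3^+$ of index $m$. For every $N$ there are only finitely many CSMLs of index at most $N$. The function $f$ is multiplicative ($f(1)=1$ and $f(mn)=f(m)f(n)$ for coprime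 $m,n$), and for every prime $p$ and integer $r\ge1$, $$f(p^r)=\begin{cases}1,&p^r=2,\\0,&p=2\text{ and }r>1,\\(p+1)p^{r-1},&\text{otherwise.}\end{cases}$$ Let $\Phi_{\mathbb Z^3}(s)=\sum_{m\ge1}f_{\mathbb Z^3}(m)m^{-s}$, where $f_{\mathbb Z^3}(m)$ is the number of CSLs of $\mathbb Z^3$ of index $m$. For $\operatorname{Re}s>2$ all the Dirichlet series involved converge absolutely, and $$\sum_{m=1}^\infty\frac{f(m)}{m^s}=(1+2^{-s})\,\Phi_{\mathbb Z^3}(s)=\frac{\zeta_{\mathbb J}(s/2)}{\zeta(2s)},\qquad \zeta_{\mathbb J}(s/2)=(1-2^{1-s})\zeta(s)\zeta(s-1);$$ the series begins $$1+\tfrac1{2^s}+\tfrac4{3^s}+\tfrac6{5^s}+\tfrac4{6^s}+\tfrac8{7^s}+\tfrac{12}{9^s}+\tfrac6{10^s}+\tfrac{12}{11^s}+\tfrac{14}{13^s}+\tfrac8{14^s}+\tfrac{24}{15^s}+\tfrac{18}{17^s}+\cdots.$$ Finally, the number of CSMLs of $D_3^+$ of index at most $N$ is asymptotically $\dfrac{15N^2}{4\pi^2}$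 as $N\to\infty$. -/

import Mathlib

open scoped Quaternion Pointwise Topology
open MeasureTheory Filter

noncomputable section

/-! ### Lattices, multilattices and their coincidence isometries in `ℝ^d` -/

/-- Euclidean space `ℝ^d`. -/
abbrev Space (d : ℕ) := EuclideanSpace ℝ (Fin d)

/-- The orthogonal group `O(d)`, acting on `ℝ^d`. -/
abbrev Orth (d : ℕ) := Space d ≃ₗᵢ[ℝ] Space d

/-- `R` is a rotation: `R ∈ SO(d)`. -/
def IsRotation {d : ℕ} (R : Orth d) : Prop :=
  LinearMap.det (R.toLinearEquiv : Space d →ₗ[ℝ] Space d) = 1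

/-- The image `RΓ` of a lattice under an orthogonal transformation. -/
def imageLattice {d : ℕ} (R : Orth d) (Γ : AddSubgroup (Space d)) : AddSubgroup (Space d) :=
  Γ.map (R.toLinearEquiv : Space d →ₗ[ℝ] Space d).toAddMonoidHom

/-- `OC(Γ)`: all `R ∈ O(d)` such that `Γ` and `RΓ` are commensurate, that is, `Γ ∩ RΓ` has finite
index in both. -/
def latticeOC {d : ℕ} (Γ : AddSubgroup (Space d)) : Set (Orth d) :=
  {R | AddSubgroup.Commensurable Γ (imageLattice R Γ)}

/-- `SOC(Γ) = OC(Γ) ∩ SO(d)`. -/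
def latticeSOC {d : ℕ} (Γ : AddSubgroup (Space d)) : Set (Orth d) :=
  {R | R ∈ latticeOC Γ ∧ IsRotation R}

/-- The coincidence site lattice `Γ(R) = Γ ∩ RΓ`. -/
def csl {d : ℕ} (Γ : AddSubgroup (Space d)) (R : Orth d) : AddSubgroup (Space d) :=
  Γ ⊓ imageLattice R Γ

/-- The coincidence index `Σ_Γ(R) = [Γ : Γ(R)]`. -/
def latticeIndex {d : ℕ} (Γ : AddSubgroup (Space d)) (R : Orth d) : ℕ :=
  (csl Γ R).relIndex Γ

/-- The number of coincidence site lattices of `Γ` of index `m`. -/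
def cslCount {d : ℕ} (Γ : AddSubgroup (Space d)) (m : ℕ) : ℕ :=
  {A : AddSubgroup (Space d) | ∃ R ∈ latticeOC Γ, A = csl Γ R ∧ latticeIndex Γ R = m}.ncard

/-- The multilattice `⋃ₖ (xₖ + Γ)`. -/
def multilattice {d n : ℕ} (Γ : AddSubgroup (Space d)) (x : Fin n → Space d) : Set (Space d) :=
  ⋃ k, x k +ᵥ (Γ : Set (Space d))

/-- `L(R) = L ∩ RL`. -/
def coincidenceSet {d : ℕ} (L : Set (Space d)) (R : Orth d) : Set (Space d) :=
  L ∩ R '' L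

/-- The linear coincidence isometries of the multilattice `L = ⋃ₖ (xₖ + Γ)`: those `R ∈ O(d)` for
which `L ∩ RL` includes a cosublattice `xₖ + (ℓ + Γ')` of some `xₖ + Γ`, where `ℓ ∈ Γ` and `Γ'` is
a subgroup of finite index of `Γ`. -/
def multilatticeOC {d n : ℕ} (Γ : AddSubgroup (Space d)) (x : Fin n → Space d) : Set (Orth d) :=
  {R | ∃ k, ∃ ℓ ∈ Γ, ∃ Γ' : AddSubgroup (Space d), Γ' ≤ Γ ∧ Γ'.relIndex Γ ≠ 0 ∧
    (x k + ℓ) +ᵥ (Γ' : Set (Space d)) ⊆ coincidenceSet (multilattice Γ x) R}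

/-- The locally finite point set `A ⊆ ℝ^d` has density `δ`: the number of its points in the ball of
radius `r` about the origin, divided by the volume of the ball, tends to `δ` as `r → ∞`. -/
def HasPointDensity {d : ℕ} (A : Set (Space d)) (δ : ℝ) : Prop :=
  (∀ r : ℝ, (A ∩ Metric.closedBall 0 r).Finite) ∧
  Tendsto (fun r : ℝ => ((A ∩ Metric.closedBall 0 r).ncard : ℝ) /
    (volume (Metric.closedBall (0 : Space d) r)).toReal) atTop (𝓝 δ)

/-- `Σ_L(R) = σ`: the densities of `L` and of `L(R)` exist and are positive, and their ratio
is `σ`. -/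
def HasCoincidenceIndex {d : ℕ} (L : Set (Space d)) (R : Orth d) (σ : ℝ) : Prop :=
  ∃ δ δ' : ℝ, 0 < δ ∧ 0 < δ' ∧ HasPointDensity L δ ∧
    HasPointDensity (coincidenceSet L R) δ' ∧ σ = δ / δ'

/-- The set of coincidence site multilattices (CSMLs) of `⋃ₖ (xₖ + Γ)` of index `m`. -/
def csmlsOfIndex {d n : ℕ} (Γ : AddSubgroup (Space d)) (x : Fin n → Space d) (m : ℕ) :
    Set (Set (Space d)) :=
  {A | ∃ R ∈ multilatticeOC Γ x, A = coincidenceSet (multilattice Γ x) R ∧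
    HasCoincidenceIndex (multilattice Γ x) R m}

/-- The set of CSMLs of `⋃ₖ (xₖ + Γ)` whose (a priori real) index is at most `N`. -/
def csmlsOfIndexLE {d n : ℕ} (Γ : AddSubgroup (Space d)) (x : Fin n → Space d) (N : ℕ) :
    Set (Set (Space d)) :=
  {A | ∃ R ∈ multilatticeOC Γ x, A = coincidenceSet (multilattice Γ x) R ∧
    ∃ σ : ℝ, HasCoincidenceIndex (multilattice Γ x) R σ ∧ σ ≤ N}

/-! ### The cubic lattices and the diamond packing -/

/-- The primitive cubic lattice `ℤ³`. -/
def cubicLattice : AddSubgroup (Space 3) where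
  carrier := {v | ∃ a b c : ℤ, v = !₂[(a : ℝ), (b : ℝ), (c : ℝ)]}
  zero_mem' := ⟨0, 0, 0, by ext i; fin_cases i <;> simp⟩
  add_mem' := by
    rintro _ _ ⟨a, b, c, rfl⟩ ⟨a', b', c', rfl⟩
    exact ⟨a + a', b + b', c + c', by ext i; fin_cases i <;> simp⟩
  neg_mem' := by
    rintro _ ⟨a, b, c, rfl⟩
    exact ⟨-a, -b, -c, by ext i; fin_cases i <;> simp⟩

/-- The set `2ℤ³`. -/
def evenVectors : Set (Space 3) := (2 : ℝ) • (cubicLattice : Set (Space 3))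

/-- `2ℤ³ ∪ [(1,1,0) + 2ℤ³] ∪ [(0,1,1) + 2ℤ³] ∪ [(1,0,1) + 2ℤ³]`. -/
def fccSet : Set (Space 3) :=
  evenVectors ∪ (!₂[(1 : ℝ), 1, 0] +ᵥ evenVectors) ∪ (!₂[(0 : ℝ), 1, 1] +ᵥ evenVectors) ∪
    (!₂[(1 : ℝ), 0, 1] +ᵥ evenVectors)

theorem mem_evenVectors (v : Space 3) :
    v ∈ evenVectors ↔ ∃ a b c : ℤ, v = !₂[2 * (a : ℝ), 2 * (b : ℝ), 2 * (c : ℝ)] := by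
  constructor
  · rintro ⟨_, ⟨a, b, c, rfl⟩, rfl⟩
    exact ⟨a, b, c, by ext i; fin_cases i <;> simp⟩
  · rintro ⟨a, b, c, rfl⟩
    exact ⟨!₂[(a : ℝ), (b : ℝ), (c : ℝ)], ⟨a, b, c, rfl⟩, by ext i; fin_cases i <;> simp⟩

theorem mem_vadd_evenVectors (x y z : ℝ) (v : Space 3) :
    v ∈ !₂[x, y, z] +ᵥ evenVectors ↔
      ∃ a b c : ℤ, v = !₂[x + 2 * (a : ℝ), y + 2 * (b : ℝ), z + 2 * (c : ℝ)] := by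
  rw [Set.mem_vadd_set]
  constructor
  · rintro ⟨w, hw, rfl⟩
    obtain ⟨a, b, c, rfl⟩ := (mem_evenVectors w).1 hw
    exact ⟨a, b, c, by ext i; fin_cases i <;> simp⟩
  · rintro ⟨a, b, c, rfl⟩
    exact ⟨_, (mem_evenVectors _).2 ⟨a, b, c, rfl⟩, by ext i; fin_cases i <;> simp⟩

theorem mem_fccSet (v : Space 3) :
    v ∈ fccSet ↔ ∃ a b c : ℤ, Even (a + b + c) ∧ v = !₂[(a : ℝ), (b : ℝ), (c : ℝ)] := by
  simp only [fccSet, Set.mem_union, mem_vadd_evenVectors, mem_evenVectors]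
  constructor
  · rintro (((⟨a, b, c, rfl⟩ | ⟨a, b, c, rfl⟩) | ⟨a, b, c, rfl⟩) | ⟨a, b, c, rfl⟩)
    · exact ⟨2 * a, 2 * b, 2 * c, by grind, by ext i; fin_cases i <;> simp⟩
    · exact ⟨1 + 2 * a, 1 + 2 * b, 2 * c, by grind, by ext i; fin_cases i <;> simp⟩
    · exact ⟨2 * a, 1 + 2 * b, 1 + 2 * c, by grind, by ext i; fin_cases i <;> simp⟩
    · exact ⟨1 + 2 * a, 2 * b, 1 + 2 * c, by grind, by ext i; fin_cases i <;> simp⟩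
  · rintro ⟨a, b, c, h, rfl⟩
    rcases Int.even_or_odd' a with ⟨a, rfl | rfl⟩ <;>
    rcases Int.even_or_odd' b with ⟨b, rfl | rfl⟩ <;>
    rcases Int.even_or_odd' c with ⟨c, rfl | rfl⟩ <;>
    first
      | (exfalso; grind)
      | (refine Or.inl (Or.inl (Or.inl ⟨a, b, c, ?_⟩)); ext i; fin_cases i <;> simp; done)
      | (refine Or.inl (Or.inl (Or.inr ⟨a, b, c, ?_⟩)); ext i; fin_cases i <;> simp [add_comm]; done)
      | (refine Or.inl (Or.inr ⟨a, b, c, ?_⟩); ext i; fin_cases i <;> simp [add_comm]; done)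
      | (refine Or.inr ⟨a, b, c, ?_⟩; ext i; fin_cases i <;> simp [add_comm])

/-- The face-centered cubic lattice. -/
def fccLattice : AddSubgroup (Space 3) where
  carrier := fccSet
  zero_mem' := (mem_fccSet _).2 ⟨0, 0, 0, by simp, by ext i; fin_cases i <;> simp⟩
  add_mem' := by
    intro v w hv hw
    obtain ⟨a, b, c, h, rfl⟩ := (mem_fccSet v).1 hv
    obtain ⟨a', b', c', h', rfl⟩ := (mem_fccSet w).1 hw
    exact (mem_fccSet _).2 ⟨a + a', b + b', c + c', by grind, by ext i; fin_cases i <;> simp⟩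
  neg_mem' := by
    intro v hv
    obtain ⟨a, b, c, h, rfl⟩ := (mem_fccSet v).1 hv
    exact (mem_fccSet _).2 ⟨-a, -b, -c, by grind, by ext i; fin_cases i <;> simp⟩

/-- `x = ½(1,1,1)`. -/
def diamondShift : Space 3 := (1 / 2 : ℝ) • !₂[(1 : ℝ), 1, 1]

/-- The translations `0` and `x` generating the diamond packing from the f.c.c. lattice. -/
def diamondShifts : Fin 2 → Space 3 := ![0, diamondShift]

/-- The diamond packing `D₃⁺`. -/
def diamond : Set (Space 3) := multilattice fccLattice diamondShifts

theorem diamond_eq : diamond =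
    (fccLattice : Set (Space 3)) ∪ (diamondShift +ᵥ (fccLattice : Set (Space 3))) := by
  ext v
  simp [diamond, multilattice, diamondShifts, Fin.exists_fin_two]

/-! ### Quaternions and Cayley's parametrization -/

/-- The quaternion `(a, b, c, d) = a + b i + c j + d k`. -/
def quat (a b c d : ℝ) : ℍ[ℝ] := ⟨a, b, c, d⟩

theorem quat_re (a b c d : ℝ) : (quat a b c d).re = a := rfl
theorem quat_imI (a b c d : ℝ) : (quat a b c d).imI = b := rfl
theorem quat_imJ (a b c d : ℝ) : (quat a b c d).imJ = c := rfl
theorem quat_imK (a b c d : ℝ) : (quat a b c d).imK = d := rfl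

attribute [local simp] quat_re quat_imI quat_imJ quat_imK

/-- `ℝ³` identified with the imaginary space of `ℍ`. -/
def toQuat (v : Space 3) : ℍ[ℝ] := quat 0 (v 0) (v 1) (v 2)

/-- The imaginary part of a quaternion, as a vector of `ℝ³`. -/
def imVec (q : ℍ[ℝ]) : Space 3 := !₂[q.imI, q.imJ, q.imK]

theorem imVec_toQuat (v : Space 3) : imVec (toQuat v) = v := by
  ext i; fin_cases i <;> rfl

theorem toQuat_imVec (q : ℍ[ℝ]) (h : q.re = 0) : toQuat (imVec q) = q := by
  ext <;> simp [toQuat, imVec, h]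

theorem re_conj (q : ℍ[ℝ]) (v : Space 3) : (q * toQuat v * q⁻¹).re = 0 := by
  simp only [toQuat, Quaternion.inv_def, mul_smul_comm, Quaternion.re_smul]
  simp
  ring_nf
  simp

theorem normSq_toQuat (v : Space 3) : Quaternion.normSq (toQuat v) = ‖v‖ ^ 2 := by
  simp [Quaternion.normSq_def', toQuat, EuclideanSpace.norm_sq_eq, Fin.sum_univ_three]

/-- The rotation `x ↦ q x q⁻¹` of `ℝ³ ≅ Im ℍ`. -/
def quatRotation (q : ℍ[ℝ]) (hq : q ≠ 0) : Orth 3 where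
  toFun v := imVec (q * toQuat v * q⁻¹)
  map_add' v w := by
    have : toQuat (v + w) = toQuat v + toQuat w := by ext <;> simp [toQuat]
    rw [this, mul_add, add_mul]
    ext i; fin_cases i <;> simp [imVec]
  map_smul' c v := by
    have : toQuat (c • v) = c • toQuat v := by ext <;> simp [toQuat]
    rw [this, mul_smul_comm, smul_mul_assoc]
    ext i; fin_cases i <;> simp [imVec]
  invFun v := imVec (q⁻¹ * toQuat v * q)
  left_inv v := by
    beta_reduce
    rw [toQuat_imVec _ (re_conj q v)]
    have : q⁻¹ * (q * toQuat v * q⁻¹) * q = toQuat v := by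
      simp only [mul_assoc, inv_mul_cancel₀ hq, mul_one]
      rw [← mul_assoc, inv_mul_cancel₀ hq, one_mul]
    rw [this, imVec_toQuat]
  right_inv v := by
    have h : (q⁻¹ * toQuat v * q).re = 0 := by
      have := re_conj q⁻¹ v
      rwa [inv_inv] at this
    beta_reduce
    rw [toQuat_imVec _ h]
    have : q * (q⁻¹ * toQuat v * q) * q⁻¹ = toQuat v := by
      simp only [mul_assoc, mul_inv_cancel₀ hq, mul_one]
      rw [← mul_assoc, mul_inv_cancel₀ hq, one_mul]
    rw [this, imVec_toQuat]
  norm_map' v := by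
    have h : ‖imVec (q * toQuat v * q⁻¹)‖ ^ 2 = ‖v‖ ^ 2 := by
      rw [← normSq_toQuat, toQuat_imVec _ (re_conj q v), map_mul, map_mul, map_inv₀,
        mul_comm, ← mul_assoc, inv_mul_cancel₀ (by simpa using hq), one_mul, normSq_toQuat]
    exact (sq_eq_sq₀ (norm_nonneg _) (norm_nonneg _)).1 h

/-- A primitive quaternion: integer components without a common divisor. -/
def IsPrimitive (q : ℍ[ℤ]) : Prop :=
  ∀ a : ℤ, a ∣ q.re → a ∣ q.imI → a ∣ q.imJ → a ∣ q.imK → IsUnit a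

/-- The inclusion of the Lipschitz quaternions into `ℍ`. -/
def lipschitzToReal (q : ℍ[ℤ]) : ℍ[ℝ] := quat q.re q.imI q.imJ q.imK

theorem IsPrimitive.ne_zero {q : ℍ[ℤ]} (hq : IsPrimitive q) : lipschitzToReal q ≠ 0 := by
  intro h
  have h0 : q.re = 0 := by simpa [lipschitzToReal] using congrArg (fun p : ℍ[ℝ] => p.re) h
  have h1 : q.imI = 0 := by simpa [lipschitzToReal] using congrArg (fun p : ℍ[ℝ] => p.imI) h
  have h2 : q.imJ = 0 := by simpa [lipschitzToReal] using congrArg (fun p : ℍ[ℝ] => p.imJ) h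
  have h3 : q.imK = 0 := by simpa [lipschitzToReal] using congrArg (fun p : ℍ[ℝ] => p.imK) h
  have := hq 0 (by simp [h0]) (by simp [h1]) (by simp [h2]) (by simp [h3])
  simp at this

/-- `R_q : x ↦ q x q⁻¹` for a primitive quaternion `q`. -/
def rotR (q : ℍ[ℤ]) (hq : IsPrimitive q) : Orth 3 :=
  quatRotation (lipschitzToReal q) hq.ne_zero

/-- `T_q : x ↦ -q x q⁻¹` for a primitive quaternion `q`. -/
def rotT (q : ℍ[ℤ]) (hq : IsPrimitive q) : Orth 3 :=
  (rotR q hq).trans (LinearIsometryEquiv.neg ℝ)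

/-! ### Hurwitz quaternions and their zeta function -/

/-- The ring `𝕁` of Hurwitz quaternions: `ℍ`-elements whose components are all integers or all
half-integers. -/
def hurwitzRing : Subring ℍ[ℝ] where
  carrier := {q | (∃ a b c d : ℤ, q = quat a b c d) ∨
    ∃ a b c d : ℤ, q = quat (1 / 2 + a) (1 / 2 + b) (1 / 2 + c) (1 / 2 + d)}
  zero_mem' := Or.inl ⟨0, 0, 0, 0, by ext <;> simp⟩
  one_mem' := Or.inl ⟨1, 0, 0, 0, by ext <;> simp⟩
  add_mem' := by
    rintro _ _ (⟨a, b, c, d, rfl⟩ | ⟨a, b, c, d, rfl⟩) (⟨e, f, g, h, rfl⟩ | ⟨e, f, g, h, rfl⟩)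
    · exact Or.inl ⟨a + e, b + f, c + g, d + h, by ext <;> simp⟩
    · exact Or.inr ⟨a + e, b + f, c + g, d + h, by ext <;> simp <;> ring⟩
    · exact Or.inr ⟨a + e, b + f, c + g, d + h, by ext <;> simp <;> ring⟩
    · exact Or.inl ⟨1 + a + e, 1 + b + f, 1 + c + g, 1 + d + h, by ext <;> simp <;> ring⟩
  neg_mem' := by
    rintro _ (⟨a, b, c, d, rfl⟩ | ⟨a, b, c, d, rfl⟩)
    · exact Or.inl ⟨-a, -b, -c, -d, by ext <;> simp⟩
    · exact Or.inr ⟨-a - 1, -b - 1, -c - 1, -d - 1, by ext <;> simp <;> ring⟩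
  mul_mem' := by
    rintro _ _ (⟨a, b, c, d, rfl⟩ | ⟨a, b, c, d, rfl⟩) (⟨e, f, g, h, rfl⟩ | ⟨e, f, g, h, rfl⟩)
    · exact Or.inl ⟨a * e - b * f - c * g - d * h, a * f + b * e + c * h - d * g,
        a * g - b * h + c * e + d * f, a * h + b * g - c * f + d * e, by ext <;> simp⟩
    · rcases Int.even_or_odd' (a + b + c + d) with ⟨k, hk | hk⟩
      · left
        refine ⟨a * e - b * f - c * g - d * h + (k - b - c - d),
          a * f + b * e + c * h - d * g + (k - d),
          a * g - b * h + c * e + d * f + (k - b),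
          a * h + b * g - c * f + d * e + (k - c), ?_⟩
        have hk' : (a : ℝ) = 2 * k - b - c - d := by
          have : a = 2 * k - b - c - d := by linarith
          exact_mod_cast this
        ext <;> simp [hk'] <;> ring
      · right
        refine ⟨a * e - b * f - c * g - d * h + (k - b - c - d),
          a * f + b * e + c * h - d * g + (k - d),
          a * g - b * h + c * e + d * f + (k - b),
          a * h + b * g - c * f + d * e + (k - c), ?_⟩
        have hk' : (a : ℝ) = 2 * k + 1 - b - c - d := by
          have : a = 2 * k + 1 - b - c - d := by linarith
          exact_mod_cast this
        ext <;> simp [hk'] <;> ring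
    · rcases Int.even_or_odd' (e + f + g + h) with ⟨k, hk | hk⟩
      · left
        refine ⟨a * e - b * f - c * g - d * h + (k - f - g - h),
          a * f + b * e + c * h - d * g + (k - g),
          a * g - b * h + c * e + d * f + (k - h),
          a * h + b * g - c * f + d * e + (k - f), ?_⟩
        have hk' : (e : ℝ) = 2 * k - f - g - h := by
          have : e = 2 * k - f - g - h := by linarith
          exact_mod_cast this
        ext <;> simp [hk'] <;> ring
      · right
        refine ⟨a * e - b * f - c * g - d * h + (k - f - g - h),
          a * f + b * e + c * h - d * g + (k - g),
          a * g - b * h + c * e + d * f + (k - h),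
          a * h + b * g - c * f + d * e + (k - f), ?_⟩
        have hk' : (e : ℝ) = 2 * k + 1 - f - g - h := by
          have : e = 2 * k + 1 - f - g - h := by linarith
          exact_mod_cast this
        ext <;> simp [hk'] <;> ring
    · rcases Int.even_or_odd' (a + b + c + d + e + f + g + h) with ⟨k, hk | hk⟩
      · right
        refine ⟨a * e - b * f - c * g - d * h - 1 + (k - b - c - d - f - g - h),
          a * f + b * e + c * h - d * g + (k - d - g),
          a * g - b * h + c * e + d * f + (k - b - h),
          a * h + b * g - c * f + d * e + (k - c - f), ?_⟩
        have hk' : (a : ℝ) = 2 * k - b - c - d - e - f - g - h := by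
          have : a = 2 * k - b - c - d - e - f - g - h := by linarith
          exact_mod_cast this
        ext <;> simp [hk'] <;> ring
      · left
        refine ⟨a * e - b * f - c * g - d * h + (k - b - c - d - f - g - h),
          a * f + b * e + c * h - d * g + (k - d - g + 1),
          a * g - b * h + c * e + d * f + (k - b - h + 1),
          a * h + b * g - c * f + d * e + (k - c - f + 1), ?_⟩
        have hk' : (a : ℝ) = 2 * k + 1 - b - c - d - e - f - g - h := by
          have : a = 2 * k + 1 - b - c - d - e - f - g - h := by linarith
          exact_mod_cast this
        ext <;> simp [hk'] <;> ring

/-- The number of right ideals of index `m` of `𝕁` (for `m ≥ 1` these are nonzero, because `𝕁` is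
infinite). Right ideals are the submodules over the opposite ring. -/
def rightIdealCount (m : ℕ) : ℕ :=
  {I : Submodule (hurwitzRing)ᵐᵒᵖ hurwitzRing | I.toAddSubgroup.index = m}.ncard

/-- The zeta function of `𝕁`, `ζ_𝕁(s) = ∑ [𝕁 : I]^(-s)`, the sum over all nonzero right ideals `I`;
it converges for `Re s > 1`. -/
def zetaJ (s : ℂ) : ℂ := LSeries (fun m => (rightIdealCount m : ℂ)) s

/-- The number `f(m)` of CSMLs of the diamond packing of index `m`. -/
def diamondCount (m : ℕ) : ℕ := (csmlsOfIndex fccLattice diamondShifts m).ncard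

/-- `(Rx - x + RΓ) ∩ Γ` for the f.c.c. lattice `Γ` and `x = ½(1,1,1)`. -/
def shiftVectors (R : Orth 3) : Set (Space 3) :=
  ((R diamondShift - diamondShift) +ᵥ (imageLattice R fccLattice : Set (Space 3))) ∩
    (fccLattice : Set (Space 3))

/-- `D₃⁺(R) = Γ(R)` and `Σ_{D₃⁺}(R) = 2 Σ_Γ(R) = N`. -/
def HasSingleCSML (R : Orth 3) (N : ℝ) : Prop :=
  coincidenceSet diamond R = (csl fccLattice R : Set (Space 3)) ∧
  HasCoincidenceIndex diamond R (2 * (latticeIndex fccLattice R : ℝ)) ∧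
  2 * (latticeIndex fccLattice R : ℝ) = N

/-- `D₃⁺(R) = Γ(R) ∪ [(x + ℓ) + Γ(R)]` for every `ℓ ∈ (Rx - x + RΓ) ∩ Γ`, this set of `ℓ` being
nonempty, and `Σ_{D₃⁺}(R) = Σ_Γ(R) = N`. -/
def HasDoubleCSML (R : Orth 3) (N : ℝ) : Prop :=
  (shiftVectors R).Nonempty ∧
  (∀ ℓ ∈ shiftVectors R, coincidenceSet diamond R =
    (csl fccLattice R : Set (Space 3)) ∪
      ((diamondShift + ℓ) +ᵥ (csl fccLattice R : Set (Space 3)))) ∧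
  HasCoincidenceIndex diamond R (latticeIndex fccLattice R : ℝ) ∧
  (latticeIndex fccLattice R : ℝ) = N

end

noncomputable section

attribute [local simp] quat_re quat_imI quat_imJ quat_imK

/-! ### Arithmetic of the Hurwitz ring -/

namespace Hurwitz

/-! Every coincidence isometry is reduced to a primitive Hurwitz quaternion of odd norm together
with a sign. An isometry R commensurating `Γ` with its image is rational. The quaternions R(i), R(j)
satisfy the same relations as i, j, so averaging over the quaternion group yields an intertwiner,
and clearing denominators makes R equal to `R_q` or `T_q` with q primitive (`IsRational.exists_eq`).
The same argument applies to isometries of the diamond packing (`multilatticeOC_eq`). Inside `𝕁` one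
writes q = p s with s = 1, 1 + i or 2, according as |q|² is odd, 2 mod 4 or 0 mod 4; then p has odd
norm and no integer divisor greater than 1. The rotation by s preserves the lattices, but 1 + i
sends x to -x modulo `Γ`. Hence R has the same image lattices as `R_p` and sends x to ±`R_p` x
modulo `R_p Γ`, and passing from R to -R flips the sign (`RepresentedBy`).

Let n = |p|². A vector v of the lattice lies in its image exactly when v p ∈ p𝕁. Since n is odd,
`𝕁/n𝕁` is the ring of 2 × 2 matrices over ℤ/n (`exists_reduction`), and p becomes a matrix whose
columns span a line generated by a unimodular vector w. The condition says that w is an eigenvector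
of the matrix of v, which is one linear equation over ℤ/n. So the index is n (`latticeIndex_rot`),
and the CSL determines w, hence the right ideal p𝕁 (`rightIdeal_eq_of_csl_eq`).

For the packing, the decisive fact is that x has order 4 modulo `Γ`. Multiplication by n carries
`R_p Γ` into `Γ` and satisfies n `R_p` x ≡ n x. Thus the mixed coset intersections are empty. The
remaining one, x + `Γ` with ±`R_p` x + `R_p Γ`, contains n² `R_p` x for the sign + because n² ≡ 1
mod 4, and is empty for the sign - because 2n is not divisible by 4. Comparing densities gives the
indices n and 2n.

Counting therefore means counting primitive right ideals of odd norm n, once for index n and once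
for index 2n. `𝕁` is a right principal ideal ring, and right ideals of index n² correspond, through
column spaces modulo n, to subgroups of ℤ² of index n; there are σ(n) of them. Splitting off integer
contents and inverting identifies the number of primitive ones, and f becomes the Dirichlet
convolution of the squarefree indicator with n ↦ n on odd n (`diamondCount_eq`). Multiplicativity,
the values at prime powers and the Dirichlet series follow, and the asymptotics come from dominated
convergence with constant ζ(2)/(4ζ(4)). -/

theorem mem_of_coords (t b c d : ℤ) :
    quat (t / 2) (t / 2 + b) (t / 2 + c) (t / 2 + d) ∈ hurwitzRing := by
  rcases Int.even_or_odd' t with ⟨k, rfl | rfl⟩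
  · exact Or.inl ⟨k, k + b, k + c, k + d, by ext <;> simp⟩
  · exact Or.inr ⟨k, k + b, k + c, k + d, by ext <;> simp <;> ring⟩

/-- The Hurwitz quaternion `t ω + b i + c j + d k`, where `ω = (1 + i + j + k) / 2`. -/
def ofCoords (t b c d : ℤ) : hurwitzRing :=
  ⟨quat (t / 2) (t / 2 + b) (t / 2 + c) (t / 2 + d), mem_of_coords t b c d⟩

theorem coe_ofCoords (t b c d : ℤ) :
    (ofCoords t b c d : ℍ[ℝ]) = quat (t / 2) (t / 2 + b) (t / 2 + c) (t / 2 + d) := rfl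

theorem exists_ofCoords (q : hurwitzRing) : ∃ t b c d, q = ofCoords t b c d := by
  obtain ⟨q, ⟨a, b, c, d, rfl⟩ | ⟨a, b, c, d, rfl⟩⟩ := q
  · exact ⟨2 * a, b - a, c - a, d - a, Subtype.ext (by ext <;> simp [ofCoords])⟩
  · exact ⟨1 + 2 * a, b - a, c - a, d - a, Subtype.ext (by ext <;> simp [ofCoords] <;> ring)⟩

theorem ofCoords_inj {t b c d t' b' c' d' : ℤ} :
    ofCoords t b c d = ofCoords t' b' c' d' ↔ t = t' ∧ b = b' ∧ c = c' ∧ d = d' := by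
  constructor
  · intro h
    have h' := congrArg (fun x : hurwitzRing => (x : ℍ[ℝ])) h
    have h0 := congrArg (fun x : ℍ[ℝ] => x.re) h'
    have h1 := congrArg (fun x : ℍ[ℝ] => x.imI) h'
    have h2 := congrArg (fun x : ℍ[ℝ] => x.imJ) h'
    have h3 := congrArg (fun x : ℍ[ℝ] => x.imK) h'
    simp only [coe_ofCoords, quat_re, quat_imI, quat_imJ, quat_imK] at h0 h1 h2 h3
    have e0 : (t : ℝ) = t' := by linarith
    rw [e0] at h1 h2 h3
    exact ⟨by exact_mod_cast e0, by exact_mod_cast add_left_cancel h1,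
      by exact_mod_cast add_left_cancel h2, by exact_mod_cast add_left_cancel h3⟩
  · rintro ⟨rfl, rfl, rfl, rfl⟩; rfl

theorem ofCoords_add (t b c d t' b' c' d' : ℤ) :
    ofCoords t b c d + ofCoords t' b' c' d' = ofCoords (t + t') (b + b') (c + c') (d + d') := by
  apply Subtype.ext
  ext <;> simp [coe_ofCoords] <;> ring

theorem ofCoords_mul (t b c d t' b' c' d' : ℤ) :
    ofCoords t b c d * ofCoords t' b' c' d' = ofCoords
      (-(t * t') - t * (b' + c' + d') - t' * (b + c + d) - 2 * (b * b' + c * c' + d * d'))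
      (t * t' + t * (b' + d') + t' * (b + c) + c * d' - d * c' + b * b' + c * c' + d * d')
      (t * t' + t * (c' + b') + t' * (c + d) + d * b' - b * d' + b * b' + c * c' + d * d')
      (t * t' + t * (d' + c') + t' * (d + b) + b * c' - c * b' + b * b' + c * c' + d * d') := by
  apply Subtype.ext
  ext <;> simp [coe_ofCoords] <;> ring

theorem natCast_mul_ofCoords (n : ℕ) (t b c d : ℤ) :
    (n : hurwitzRing) * ofCoords t b c d = ofCoords (n * t) (n * b) (n * c) (n * d) := by
  apply Subtype.ext
  rw [← nsmul_eq_mul]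
  ext <;> simp [coe_ofCoords] <;> ring

/-- The conjugate of a Hurwitz quaternion. -/
def conj (q : hurwitzRing) : hurwitzRing :=
  ⟨star (q : ℍ[ℝ]), by
    obtain ⟨t, b, c, d, rfl⟩ := exists_ofCoords q
    convert mem_of_coords t (-t - b) (-t - c) (-t - d) using 1
    ext <;> simp [coe_ofCoords] <;> ring⟩

@[simp] theorem coe_conj (q : hurwitzRing) : (conj q : ℍ[ℝ]) = star (q : ℍ[ℝ]) := rfl

theorem conj_mul (p q : hurwitzRing) : conj (p * q) = conj q * conj p :=
  Subtype.ext (by simp)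

theorem exists_normSq (q : hurwitzRing) : ∃ n : ℕ, Quaternion.normSq (q : ℍ[ℝ]) = n := by
  obtain ⟨t, b, c, d, rfl⟩ := exists_ofCoords q
  have h : Quaternion.normSq (ofCoords t b c d : ℍ[ℝ]) =
      ((t ^ 2 + t * (b + c + d) + b ^ 2 + c ^ 2 + d ^ 2 : ℤ) : ℝ) := by
    simp [Quaternion.normSq_def', coe_ofCoords]; ring
  have h0 : 0 ≤ t ^ 2 + t * (b + c + d) + b ^ 2 + c ^ 2 + d ^ 2 := by
    have := Quaternion.normSq_nonneg (a := (ofCoords t b c d : ℍ[ℝ]))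
    rw [h] at this
    exact_mod_cast this
  obtain ⟨n, hn⟩ := Int.eq_ofNat_of_zero_le h0
  exact ⟨n, by rw [h, hn]; simp⟩

/-- The norm `|q|²` of a Hurwitz quaternion. -/
def nrm (q : hurwitzRing) : ℕ := (exists_normSq q).choose

theorem normSq_coe (q : hurwitzRing) : Quaternion.normSq (q : ℍ[ℝ]) = nrm q :=
  (exists_normSq q).choose_spec

theorem nrm_ofCoords (t b c d : ℤ) :
    (nrm (ofCoords t b c d) : ℤ) = t ^ 2 + t * (b + c + d) + b ^ 2 + c ^ 2 + d ^ 2 := by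
  have h : ((nrm (ofCoords t b c d) : ℤ) : ℝ) =
      ((t ^ 2 + t * (b + c + d) + b ^ 2 + c ^ 2 + d ^ 2 : ℤ) : ℝ) := by
    rw [Int.cast_natCast, ← normSq_coe]
    simp [Quaternion.normSq_def', coe_ofCoords]; ring
  exact_mod_cast h

theorem nrm_mul (p q : hurwitzRing) : nrm (p * q) = nrm p * nrm q := by
  have : (nrm (p * q) : ℝ) = nrm p * nrm q := by
    rw [← normSq_coe, ← normSq_coe, ← normSq_coe]; simp
  exact_mod_cast this

theorem nrm_natCast (n : ℕ) : nrm (n : hurwitzRing) = n ^ 2 := by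
  have : (nrm (n : hurwitzRing) : ℝ) = n ^ 2 := by
    rw [← normSq_coe]; simp [Quaternion.normSq_natCast]
  exact_mod_cast this

theorem nrm_one : nrm 1 = 1 := by simpa using nrm_natCast 1

theorem nrm_eq_zero {q : hurwitzRing} : nrm q = 0 ↔ q = 0 := by
  have := normSq_coe q
  constructor
  · intro h
    rw [h, Nat.cast_zero, Quaternion.normSq_eq_zero] at this
    exact Subtype.ext this
  · rintro rfl
    simpa using this.symm

theorem nrm_conj (q : hurwitzRing) : nrm (conj q) = nrm q := by
  have : (nrm (conj q) : ℝ) = nrm q := by rw [← normSq_coe, ← normSq_coe]; simp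
  exact_mod_cast this

theorem mul_conj (q : hurwitzRing) : q * conj q = (nrm q : hurwitzRing) := by
  apply Subtype.ext
  rw [Subring.coe_mul, coe_conj, Quaternion.self_mul_star, normSq_coe]
  exact Quaternion.coe_natCast _

theorem conj_mul_self (q : hurwitzRing) : conj q * q = (nrm q : hurwitzRing) := by
  apply Subtype.ext
  rw [Subring.coe_mul, coe_conj, Quaternion.star_mul_self, normSq_coe]
  exact Quaternion.coe_natCast _


theorem natCast_ne_zero {n : ℕ} (hn : n ≠ 0) : (n : hurwitzRing) ≠ 0 := by
  intro h
  have := nrm_natCast n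
  rw [nrm_eq_zero.2 h] at this
  exact hn (by simpa using this.symm)

/-- `1 + i`. -/
def onePlusI : hurwitzRing := ofCoords 2 0 (-1) (-1)

theorem coe_onePlusI : (onePlusI : ℍ[ℝ]) = quat 1 1 0 0 := by
  ext <;> simp [onePlusI, coe_ofCoords]

theorem nrm_onePlusI : nrm onePlusI = 2 := by
  have := nrm_ofCoords 2 0 (-1) (-1)
  norm_num at this
  exact_mod_cast this

theorem onePlusI_ne_zero : onePlusI ≠ 0 := fun h => by
  have := nrm_eq_zero.2 h
  rw [nrm_onePlusI] at this
  exact two_ne_zero this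

/-- Modulo 2, with s = b + c + d, the norm is t + ts + s, which vanishes only at t = s = 0. -/
theorem even_coords {t b c d : ℤ} (h : Even (nrm (ofCoords t b c d))) :
    Even t ∧ Even (b + c + d) := by
  rw [← Int.even_coe_nat, nrm_ofCoords] at h
  rcases Int.even_or_odd t with ht | ht
  · refine ⟨ht, ?_⟩
    simp [Int.even_add, parity_simps, ht] at h ⊢
    tauto
  · exfalso
    have ht' : ¬ Even t := by simpa using ht
    simp [parity_simps, ht'] at h
    tauto

/-- Together with `exists_onePlusI_mul`: the elements of even norm form the two-sided ideal
generated by 1 + i. This is why 1 + i normalizes `𝕁`. -/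
theorem exists_mul_onePlusI {q : hurwitzRing} (h : Even (nrm q)) : ∃ p, q = p * onePlusI := by
  obtain ⟨t, b, c, d, rfl⟩ := exists_ofCoords q
  obtain ⟨⟨u, rfl⟩, ⟨v, hv⟩⟩ := even_coords h
  obtain rfl : d = v + v - b - c := by linarith
  -- The coordinates of q(1 - i)/2, integral by the two parity conditions.
  refine ⟨ofCoords (u + u + b) (-u) (c - v - u) (v - b), ?_⟩
  rw [onePlusI, ofCoords_mul, ofCoords_inj]
  refine ⟨?_, ?_, ?_, ?_⟩ <;> ring

theorem exists_onePlusI_mul {q : hurwitzRing} (h : Even (nrm q)) : ∃ p, q = onePlusI * p := by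
  obtain ⟨t, b, c, d, rfl⟩ := exists_ofCoords q
  obtain ⟨⟨u, rfl⟩, ⟨v, hv⟩⟩ := even_coords h
  obtain rfl : d = v + v - b - c := by linarith
  refine ⟨ofCoords (u + u + b) (-u) (v - b) (v - b - c - u), ?_⟩
  rw [onePlusI, ofCoords_mul, ofCoords_inj]
  refine ⟨?_, ?_, ?_, ?_⟩ <;> ring


/-! ### Euclidean division and the index of a principal right ideal. -/

/-- The distance from a quaternion to the nearest Hurwitz quaternion is less than `1`. -/
theorem exists_normSq_sub_lt_one (z : ℍ[ℝ]) :
    ∃ y : hurwitzRing, Quaternion.normSq (z - (y : ℍ[ℝ])) < 1 := by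
  have key : ∀ x : ℝ, (x - round x) ^ 2 ≤ 1 / 4 ∧
      ((x - round x) ^ 2 = 1 / 4 → ∃ k : ℤ, x = 1 / 2 + k) := by
    intro x
    have h := abs_sub_round x
    have h2 := abs_le.1 h
    refine ⟨by nlinarith, fun h3 => ?_⟩
    have h4 : (x - round x - 1 / 2) * (x - round x + 1 / 2) = 0 := by linarith
    rcases mul_eq_zero.1 h4 with h5 | h5
    · exact ⟨round x, by linarith⟩
    · exact ⟨round x - 1, by push_cast; linarith⟩
  obtain ⟨a1, a2⟩ := key z.re
  obtain ⟨b1, b2⟩ := key z.imI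
  obtain ⟨c1, c2⟩ := key z.imJ
  obtain ⟨d1, d2⟩ := key z.imK
  let y : hurwitzRing := ⟨quat (round z.re) (round z.imI) (round z.imJ) (round z.imK),
    Or.inl ⟨_, _, _, _, rfl⟩⟩
  have hy : Quaternion.normSq (z - (y : ℍ[ℝ])) = (z.re - round z.re) ^ 2 + (z.imI - round z.imI) ^ 2 +
      (z.imJ - round z.imJ) ^ 2 + (z.imK - round z.imK) ^ 2 := by
    simp [Quaternion.normSq_def', y]
  -- Four squared rounding errors of at most 1/4 add up to at most 1. Equality makes all components
  -- half-integers, and then z itself is Hurwitz.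
  by_cases hlt : Quaternion.normSq (z - (y : ℍ[ℝ])) < 1
  · exact ⟨y, hlt⟩
  · rw [hy] at hlt
    obtain ⟨a, ha⟩ := a2 (by linarith)
    obtain ⟨b, hb⟩ := b2 (by linarith)
    obtain ⟨c, hc⟩ := c2 (by linarith)
    obtain ⟨d, hd⟩ := d2 (by linarith)
    refine ⟨⟨z, Or.inr ⟨a, b, c, d, ?_⟩⟩, by simp⟩
    ext <;> simp [ha, hb, hc, hd]

/-- Left multiplication by `q`, as an endomorphism of the right module `𝕁`. -/
def leftMul (q : hurwitzRing) : hurwitzRing →ₗ[hurwitzRingᵐᵒᵖ] hurwitzRing where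
  toFun x := q * x
  map_add' := mul_add q
  map_smul' r x := by simp [mul_assoc]

@[simp] theorem leftMul_apply (q x : hurwitzRing) : leftMul q x = q * x := rfl

/-- The right ideal `q𝕁`. -/
def rightIdeal (q : hurwitzRing) : Submodule hurwitzRingᵐᵒᵖ hurwitzRing :=
  LinearMap.range (leftMul q)

theorem mem_rightIdeal {q x : hurwitzRing} : x ∈ rightIdeal q ↔ ∃ y, x = q * y := by
  simp [rightIdeal, eq_comm]

theorem self_mem_rightIdeal (q : hurwitzRing) : q ∈ rightIdeal q :=
  mem_rightIdeal.2 ⟨1, by simp⟩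

theorem rightIdeal_mul (p q : hurwitzRing) :
    rightIdeal (p * q) = (rightIdeal q).map (leftMul p) := by
  ext x
  simp only [Submodule.mem_map, mem_rightIdeal, leftMul_apply]
  constructor
  · rintro ⟨y, rfl⟩
    exact ⟨q * y, ⟨y, rfl⟩, by rw [mul_assoc]⟩
  · rintro ⟨_, ⟨y, rfl⟩, rfl⟩
    exact ⟨y, by rw [mul_assoc]⟩

theorem mul_mem_right {I : Submodule hurwitzRingᵐᵒᵖ hurwitzRing} {x : hurwitzRing} (hx : x ∈ I)
    (y : hurwitzRing) : x * y ∈ I := by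
  simpa using I.smul_mem (MulOpposite.op y) hx

theorem leftMul_injective {q : hurwitzRing} (hq : q ≠ 0) : Function.Injective (leftMul q) :=
  fun _ _ h => mul_left_cancel₀ hq h

/-- Every right ideal of the Hurwitz ring is principal. -/
theorem exists_eq_rightIdeal (I : Submodule hurwitzRingᵐᵒᵖ hurwitzRing) :
    ∃ q, I = rightIdeal q := by
  by_cases hI : ∃ x ∈ I, x ≠ 0
  · classical
    have hex : ∃ n, ∃ x ∈ I, x ≠ 0 ∧ nrm x = n := by
      obtain ⟨x, hx, h0⟩ := hI
      exact ⟨_, x, hx, h0, rfl⟩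
    obtain ⟨q, hqI, hq0, hqn⟩ := Nat.find_spec hex
    refine ⟨q, le_antisymm (fun x hx => ?_) (fun x hx => ?_)⟩
    -- Division with remainder by a nonzero element q of minimal norm: the remainder x - q y has
    -- smaller norm, hence vanishes.
    · obtain ⟨y, hy⟩ := exists_normSq_sub_lt_one ((q : ℍ[ℝ])⁻¹ * x)
      have hq0' : (q : ℍ[ℝ]) ≠ 0 := fun h => hq0 (Subtype.ext h)
      have hlt : nrm (x - q * y) < nrm q := by
        have h1 : ((x - q * y : hurwitzRing) : ℍ[ℝ]) = q * ((q : ℍ[ℝ])⁻¹ * x - y) := by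
          rw [mul_sub, ← mul_assoc, mul_inv_cancel₀ hq0', one_mul]; rfl
        have h2 : (nrm (x - q * y) : ℝ) < nrm q := by
          rw [← normSq_coe, h1, map_mul, normSq_coe]
          have : (0 : ℝ) < nrm q := by
            exact_mod_cast Nat.pos_of_ne_zero (fun h => hq0 (nrm_eq_zero.1 h))
          nlinarith
        exact_mod_cast h2
      have hmem : x - q * y ∈ I := I.sub_mem hx (mul_mem_right hqI y)
      by_cases h0 : x - q * y = 0
      · exact mem_rightIdeal.2 ⟨y, sub_eq_zero.1 h0⟩
      · exact absurd ⟨_, hmem, h0, rfl⟩ (Nat.find_min hex (hqn ▸ hlt))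
    · obtain ⟨y, rfl⟩ := mem_rightIdeal.1 hx
      exact mul_mem_right hqI y
  · push Not at hI
    refine ⟨0, le_antisymm (fun x hx => ?_) (fun x hx => ?_)⟩
    · rw [hI x hx]; exact zero_mem _
    · obtain ⟨y, rfl⟩ := mem_rightIdeal.1 hx
      simp

/-- The coordinates of a Hurwitz quaternion with respect to `ω, i, j, k`. -/
def coordsEquiv : (Fin 4 → ℤ) ≃ₗ[ℤ] hurwitzRing :=
  LinearEquiv.ofBijective
    { toFun := fun v => ofCoords (v 0) (v 1) (v 2) (v 3)
      map_add' := fun v w => by simp [ofCoords_add]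
      map_smul' := fun n v => by
        apply Subtype.ext
        ext <;> simp [coe_ofCoords] <;> ring } (by
    constructor
    · intro v w h
      obtain ⟨h0, h1, h2, h3⟩ := ofCoords_inj.1 h
      ext i
      fin_cases i <;> assumption
    · intro q
      obtain ⟨t, b, c, d, rfl⟩ := exists_ofCoords q
      exact ⟨![t, b, c, d], rfl⟩)

theorem coordsEquiv_apply (v : Fin 4 → ℤ) :
    coordsEquiv v = ofCoords (v 0) (v 1) (v 2) (v 3) := rfl

theorem coordsEquiv_symm_ofCoords (t b c d : ℤ) :
    coordsEquiv.symm (ofCoords t b c d) = ![t, b, c, d] :=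
  coordsEquiv.symm_apply_eq.2 rfl

instance : Module.Free ℤ hurwitzRing := Module.Free.of_equiv coordsEquiv

instance : Module.Finite ℤ hurwitzRing := Module.Finite.equiv coordsEquiv

/-- Over ℝ, left multiplication by q is a rotation of ℝ⁴ scaled by |q|, which explains the value
|q|⁴; here it is read off from an explicit matrix. -/
theorem det_leftMul (q : hurwitzRing) :
    LinearMap.det (LinearMap.mulLeft ℤ q) = (nrm q : ℤ) ^ 2 := by
  obtain ⟨t, b, c, d, rfl⟩ := exists_ofCoords q
  let bs : Module.Basis (Fin 4) ℤ hurwitzRing := Module.Basis.ofEquivFun coordsEquiv.symm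
  have hb : ∀ i, bs i = coordsEquiv (Pi.single i 1) := fun i => by
    simp [bs, Module.Basis.coe_ofEquivFun]
  -- The columns are the coordinates of qω, qi, qj, qk.
  have hM : LinearMap.toMatrix bs bs (LinearMap.mulLeft ℤ (ofCoords t b c d)) =
      !![-t - (b + c + d), -t - 2 * b, -t - 2 * c, -t - 2 * d;
         t + (b + c), t + b, -d + c, t + c + d;
         t + (c + d), t + d + b, t + c, -b + d;
         t + (d + b), -c + b, t + b + c, t + d] := by
    ext i j
    rw [LinearMap.toMatrix_apply, hb]
    simp only [bs, Module.Basis.ofEquivFun_repr_apply, coordsEquiv_apply, LinearMap.mulLeft_apply,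
      ofCoords_mul, coordsEquiv_symm_ofCoords]
    fin_cases i <;> fin_cases j <;> simp
  rw [← LinearMap.det_toMatrix bs, hM, nrm_ofCoords, Matrix.det_succ_row_zero]
  simp [Fin.sum_univ_succ, Matrix.det_fin_three, Matrix.submatrix, Fin.succAbove]
  ring

/-- The index of the image of an injective endomorphism of a free ℤ-module is the absolute value of
its determinant. -/
theorem index_rightIdeal (q : hurwitzRing) (hq : q ≠ 0) :
    (rightIdeal q).toAddSubgroup.index = nrm q ^ 2 := by
  let e : hurwitzRing ≃+ (rightIdeal q).toAddSubgroup.toIntSubmodule :=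
    AddEquiv.ofBijective
      (⟨⟨fun x => ⟨q * x, mem_rightIdeal.2 ⟨x, rfl⟩⟩, Subtype.ext (mul_zero q)⟩,
        fun x y => Subtype.ext (mul_add q x y)⟩ :
        hurwitzRing →+ (rightIdeal q).toAddSubgroup.toIntSubmodule) (by
      constructor
      · intro x y h
        exact mul_left_cancel₀ hq (congrArg Subtype.val h)
      · rintro ⟨x, hx⟩
        obtain ⟨y, rfl⟩ := mem_rightIdeal.1 hx
        exact ⟨y, rfl⟩)
  have h := Submodule.natAbs_det_equiv (rightIdeal q).toAddSubgroup.toIntSubmodule e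
  have h2 : ((rightIdeal q).toAddSubgroup.toIntSubmodule.subtype ∘ₗ
      AddMonoidHom.toIntLinearMap (e : hurwitzRing →+ _)) = LinearMap.mulLeft ℤ q := by
    exact LinearMap.ext fun x => rfl
  rw [h2, det_leftMul] at h
  have h3 : (rightIdeal q).toAddSubgroup.index = Nat.card
    (hurwitzRing ⧸ (rightIdeal q).toAddSubgroup.toIntSubmodule) := rfl
  rw [h3, ← h]
  simp [Int.natAbs_pow]

end Hurwitz
end

noncomputable section

attribute [local simp] quat_re quat_imI quat_imJ quat_imK

/-! ### Reduction of the Hurwitz ring modulo an odd number -/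

namespace Hurwitz

/-- Dirichlet's theorem supplies a prime p ≡ -1 mod n with p ≡ 1 mod 4. Such a prime is a sum of two
squares, and reducing this modulo n gives the claim without any local analysis. -/
theorem exists_sq_add_sq_eq_neg_one {n : ℕ} (hn : Odd n) :
    ∃ a b : ZMod n, a ^ 2 + b ^ 2 = -1 := by
  have hcop : Nat.Coprime n 4 := by
    have : Nat.Coprime n 2 := Nat.coprime_two_right.2 hn
    simpa using this.pow_right 2
  have hn0 : n ≠ 0 := fun h => by simp [h] at hn
  obtain ⟨k, hk1, hk2⟩ := Nat.chineseRemainder hcop (n - 1) 1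
  have hkn : Nat.Coprime k n := by
    have h1 : Nat.Coprime (n - 1) n := by
      have := Nat.coprime_self_sub_left (m := 1) (n := n) (by omega)
      simpa using this
    exact (Nat.ModEq.gcd_eq hk1).trans h1
  have hk4 : Nat.Coprime k 4 := (Nat.ModEq.gcd_eq hk2).trans (by norm_num)
  have : NeZero (n * 4) := ⟨by positivity⟩
  obtain ⟨p, -, hp, hpk⟩ := Nat.forall_exists_prime_gt_and_modEq 0 (by positivity : n * 4 ≠ 0)
    (hkn.mul_right hk4)
  have hp4 : p % 4 = 1 := ((hpk.of_mul_left n).trans hk2)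
  have : Fact p.Prime := ⟨hp⟩
  obtain ⟨a, b, hab⟩ := Nat.Prime.sq_add_sq (p := p) (by omega)
  refine ⟨a, b, ?_⟩
  have h1 : ((p : ℕ) : ZMod n) = ((n - 1 : ℕ) : ZMod n) :=
    (ZMod.natCast_eq_natCast_iff _ _ _).2 ((hpk.of_mul_right 4).trans hk1)
  rw [← hab, Nat.cast_sub (by omega)] at h1
  simpa using h1

theorem one_eq_ofCoords : (1 : hurwitzRing) = ofCoords 2 (-1) (-1) (-1) := by
  apply Subtype.ext
  ext <;> simp [coe_ofCoords]

theorem conj_ofCoords (t b c d : ℤ) :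
    conj (ofCoords t b c d) = ofCoords t (-t - b) (-t - c) (-t - d) := by
  apply Subtype.ext
  ext <;> simp [coe_ofCoords] <;> ring

/-- The image of `t ω + b i + c j + d k` under `i ↦ (0, -1; 1, 0)`, `j ↦ (A, B; B, -A)`, multiplied
by `2`. -/
def splitMatrix {S : Type*} [CommRing S] (A B : S) (t b c d : S) : Matrix (Fin 2) (Fin 2) S :=
  !![t + A * (t + 2 * c) - B * (t + 2 * d), -(t + 2 * b) + B * (t + 2 * c) + A * (t + 2 * d);
    (t + 2 * b) + B * (t + 2 * c) + A * (t + 2 * d), t - A * (t + 2 * c) + B * (t + 2 * d)]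

/-- The factor 2 appears because `splitMatrix` is twice the representation, which involves 1/2 at ω.
The third to sixth arguments on the right are those of `ofCoords_mul`. -/
theorem splitMatrix_mul {S : Type*} [CommRing S] {A B : S} (hAB : A ^ 2 + B ^ 2 = -1)
    (t b c d t' b' c' d' : S) :
    splitMatrix A B t b c d * splitMatrix A B t' b' c' d' = (2 : S) • splitMatrix A B
      (-(t * t') - t * (b' + c' + d') - t' * (b + c + d) - 2 * (b * b' + c * c' + d * d'))
      (t * t' + t * (b' + d') + t' * (b + c) + c * d' - d * c' + b * b' + c * c' + d * d')
      (t * t' + t * (c' + b') + t' * (c + d) + d * b' - b * d' + b * b' + c * c' + d * d')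
      (t * t' + t * (d' + c') + t' * (d + b) + b * c' - c * b' + b * b' + c * c' + d * d') := by
  rw [splitMatrix, splitMatrix, splitMatrix, Matrix.mul_fin_two]
  ext i j
  fin_cases i <;> fin_cases j <;>
    simp only [Fin.zero_eta, Fin.mk_one, Fin.isValue, Matrix.of_apply, Matrix.cons_val_zero,
      Matrix.cons_val_one, Matrix.cons_val_fin_one, Matrix.cons_val', Matrix.smul_apply,
      smul_eq_mul]
  · linear_combination ((t + 2 * c) * (t' + 2 * c') + (t + 2 * d) * (t' + 2 * d')) * hAB
  · linear_combination ((t + 2 * c) * (t' + 2 * d') - (t + 2 * d) * (t' + 2 * c')) * hAB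
  · linear_combination -((t + 2 * c) * (t' + 2 * d') - (t + 2 * d) * (t' + 2 * c')) * hAB
  · linear_combination ((t + 2 * c) * (t' + 2 * c') + (t + 2 * d) * (t' + 2 * d')) * hAB

/-- Once 2 is invertible, the images of 1, i, j, k form a basis of the 2 × 2 matrices. -/
theorem exists_splitMatrix_eq {S : Type*} [CommRing S] {A B h : S} (hAB : A ^ 2 + B ^ 2 = -1)
    (hh : h * 2 = 1) (M : Matrix (Fin 2) (Fin 2) S) :
    ∃ t b c d, h • splitMatrix A B t b c d = M := by
  have key : ∀ c₀ c₁ c₂ c₃ : S, h • splitMatrix A B (2 * c₀) (c₁ - c₀) (c₂ - c₀) (c₃ - c₀) =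
      !![c₀ + A * c₂ - B * c₃, -c₁ + B * c₂ + A * c₃; c₁ + B * c₂ + A * c₃,
        c₀ - A * c₂ + B * c₃] := by
    intro c₀ c₁ c₂ c₃
    ext i j
    fin_cases i <;> fin_cases j <;> simp [splitMatrix]
    · linear_combination (c₀ + A * c₂ - B * c₃) * hh
    · linear_combination (-c₁ + B * c₂ + A * c₃) * hh
    · linear_combination (c₁ + B * c₂ + A * c₃) * hh
    · linear_combination (c₀ - A * c₂ + B * c₃) * hh
  -- The trace and the skew part of M give c₀ and c₁. The other two solve A c₂ - B c₃ = (M₀₀ -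
  -- M₁₁)/2 and B c₂ + A c₃ = (M₀₁ + M₁₀)/2, a system of determinant A² + B² = -1.
  refine ⟨_, _, _, _, (key (h * (M 0 0 + M 1 1)) (h * (M 1 0 - M 0 1))
    (-(A * (h * (M 0 0 - M 1 1)) + B * (h * (M 0 1 + M 1 0))))
    (-(A * (h * (M 0 1 + M 1 0)) - B * (h * (M 0 0 - M 1 1))))).trans ?_⟩
  ext i j
  fin_cases i <;> fin_cases j <;> simp
  · linear_combination M 0 0 * hh - h * (M 0 0 - M 1 1) * hAB
  · linear_combination M 0 1 * hh - h * (M 0 1 + M 1 0) * hAB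
  · linear_combination M 1 0 * hh - h * (M 0 1 + M 1 0) * hAB
  · linear_combination M 1 1 * hh + h * (M 0 0 - M 1 1) * hAB

theorem eq_zero_of_splitMatrix_eq_zero {S : Type*} [CommRing S] {A B h : S}
    (hAB : A ^ 2 + B ^ 2 = -1) (hh : h * 2 = 1) {t b c d : S}
    (hz : splitMatrix A B t b c d = 0) : t = 0 ∧ b = 0 ∧ c = 0 ∧ d = 0 := by
  have e00 := congrFun (congrFun hz 0) 0
  have e01 := congrFun (congrFun hz 0) 1
  have e10 := congrFun (congrFun hz 1) 0
  have e11 := congrFun (congrFun hz 1) 1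
  simp only [splitMatrix, Matrix.of_apply, Matrix.cons_val_zero, Matrix.cons_val_one,
    Matrix.cons_val_fin_one, Matrix.cons_val', Matrix.zero_apply] at e00 e01 e10 e11
  have cancel : ∀ x : S, 2 * x = 0 → x = 0 := fun x hx => by
    linear_combination h * hx - x * hh
  have ht : t = 0 := cancel _ (by linear_combination e00 + e11)
  subst ht
  have hb : b = 0 := cancel _ (cancel _ (by linear_combination e10 - e01))
  subst hb
  refine ⟨rfl, rfl, cancel _ ?_, cancel _ ?_⟩
  · linear_combination -A * e00 - B * e01 + 2 * c * hAB
  · linear_combination B * e00 - A * e01 + 2 * d * hAB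

/-- Modulo an odd number `n`, the Hurwitz ring is the ring of `2 × 2` matrices over `ℤ/n`. -/
theorem exists_reduction {n : ℕ} (hn : Odd n) :
    ∃ φ : hurwitzRing →+* Matrix (Fin 2) (Fin 2) (ZMod n), Function.Surjective φ ∧
      (∀ x, φ x = 0 ↔ ∃ y, x = n * y) ∧ ∀ x, φ (conj x) = (φ x).adjugate := by
  obtain ⟨A, B, hAB⟩ := exists_sq_add_sq_eq_neg_one hn
  obtain ⟨h, hh⟩ : ∃ h : ZMod n, h * 2 = 1 := by
    have : IsUnit ((2 : ℕ) : ZMod n) := (ZMod.isUnit_iff_coprime 2 n).2 (Nat.coprime_two_left.2 hn)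
    obtain ⟨u, hu⟩ := this.exists_left_inv
    exact ⟨u, by simpa using hu⟩
  let φ₀ : hurwitzRing → Matrix (Fin 2) (Fin 2) (ZMod n) := fun x =>
    let v := coordsEquiv.symm x
    h • splitMatrix A B (v 0 : ZMod n) (v 1) (v 2) (v 3)
  have hφ₀ : ∀ t b c d, φ₀ (ofCoords t b c d) = h • splitMatrix A B (t : ZMod n) b c d :=
    fun t b c d => by simp [φ₀, coordsEquiv_symm_ofCoords]
  let φ : hurwitzRing →+* Matrix (Fin 2) (Fin 2) (ZMod n) :=
    { toFun := φ₀
      map_one' := by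
        rw [one_eq_ofCoords, hφ₀]
        ext i j
        fin_cases i <;> fin_cases j <;> simp [splitMatrix, hh]
      map_mul' := fun x y => by
        obtain ⟨t, b, c, d, rfl⟩ := exists_ofCoords x
        obtain ⟨t', b', c', d', rfl⟩ := exists_ofCoords y
        rw [ofCoords_mul, hφ₀, hφ₀, hφ₀, smul_mul_smul_comm, splitMatrix_mul hAB, smul_smul,
          mul_assoc, hh, mul_one]
        push_cast
        rfl
      map_zero' := by
        ext i j
        fin_cases i <;> fin_cases j <;> simp [φ₀, splitMatrix]
      map_add' := fun x y => by
        obtain ⟨t, b, c, d, rfl⟩ := exists_ofCoords x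
        obtain ⟨t', b', c', d', rfl⟩ := exists_ofCoords y
        rw [ofCoords_add, hφ₀, hφ₀, hφ₀]
        ext i j
        fin_cases i <;> fin_cases j <;> simp [splitMatrix] <;> ring }
  have hφ : ∀ t b c d, φ (ofCoords t b c d) = h • splitMatrix A B (t : ZMod n) b c d := hφ₀
  refine ⟨φ, ?_, ?_, ?_⟩
  · intro M
    obtain ⟨t, b, c, d, hM⟩ := exists_splitMatrix_eq hAB hh M
    obtain ⟨t, rfl⟩ := ZMod.intCast_surjective t
    obtain ⟨b, rfl⟩ := ZMod.intCast_surjective b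
    obtain ⟨c, rfl⟩ := ZMod.intCast_surjective c
    obtain ⟨d, rfl⟩ := ZMod.intCast_surjective d
    exact ⟨ofCoords t b c d, (hφ t b c d).trans hM⟩
  · intro x
    obtain ⟨t, b, c, d, rfl⟩ := exists_ofCoords x
    constructor
    · intro hz
      rw [hφ] at hz
      have hz' : splitMatrix A B (t : ZMod n) b c d = 0 := by
        have := congrArg (fun M => (2 : ZMod n) • M) hz
        simpa only [smul_smul, mul_comm 2 h, hh, one_smul, smul_zero] using this
      obtain ⟨ht, hb, hc, hd⟩ := eq_zero_of_splitMatrix_eq_zero hAB hh hz'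
      rw [ZMod.intCast_zmod_eq_zero_iff_dvd] at ht hb hc hd
      obtain ⟨t, rfl⟩ := ht
      obtain ⟨b, rfl⟩ := hb
      obtain ⟨c, rfl⟩ := hc
      obtain ⟨d, rfl⟩ := hd
      exact ⟨ofCoords t b c d, (natCast_mul_ofCoords n t b c d).symm⟩
    · rintro ⟨y, hy⟩
      rw [hy, map_mul, map_natCast]
      ext i j
      simp
  · intro x
    obtain ⟨t, b, c, d, rfl⟩ := exists_ofCoords x
    rw [conj_ofCoords, hφ, hφ, Matrix.adjugate_fin_two]
    ext i j
    fin_cases i <;> fin_cases j <;> simp [splitMatrix] <;> ring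

end Hurwitz
end

noncomputable section

/-! ### Subgroups of `ℤ²` of given index -/

namespace Hurwitz

theorem eq_zmultiples_index (H : AddSubgroup ℤ) : H = AddSubgroup.zmultiples (H.index : ℤ) := by
  obtain ⟨a, ha⟩ := Int.subgroup_cyclic H
  rw [← AddSubgroup.zmultiples_eq_closure] at ha
  subst ha
  rw [Int.index_zmultiples]
  ext x
  simp [Int.mem_zmultiples_iff]

/-- The index is multiplicative along W ≤ W + (A × 0) ≤ A × B. The first step has the index of W ∩ A
in A, the second that of the projection of W in B. -/
theorem index_eq_index_comap_mul_index_map {A B : Type*} [AddCommGroup A] [AddCommGroup B]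
    (W : AddSubgroup (A × B)) :
    W.index = (W.comap (AddMonoidHom.inl A B)).index * (W.map (AddMonoidHom.snd A B)).index := by
  rw [AddSubgroup.index_comap, AddSubgroup.index_map,
    (AddMonoidHom.range_eq_top (f := AddMonoidHom.snd A B)).2 Prod.snd_surjective, AddSubgroup.index_top, mul_one]
  have hker : (AddMonoidHom.snd A B).ker = (AddMonoidHom.inl A B).range := by
    ext ⟨x, y⟩
    simp [AddSubgroup.mem_prod, eq_comm]
  rw [hker, ← AddSubgroup.relIndex_sup_right, sup_comm, AddSubgroup.relIndex_mul_index le_sup_left]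

/-- The subgroup of `ℤ²` spanned by `(a, 0)` and `(b, d)`. -/
def hermiteSubgroup (a d b : ℤ) : AddSubgroup (ℤ × ℤ) where
  carrier := {p | ∃ x k : ℤ, p = (a * x + b * k, d * k)}
  zero_mem' := ⟨0, 0, by ext <;> simp⟩
  add_mem' := by
    rintro _ _ ⟨x, k, rfl⟩ ⟨x', k', rfl⟩
    exact ⟨x + x', k + k', by ext <;> (simp; ring)⟩
  neg_mem' := by
    rintro _ ⟨x, k, rfl⟩
    exact ⟨-x, -k, by ext <;> simp; ring⟩

theorem mem_hermiteSubgroup {a d b : ℤ} {p : ℤ × ℤ} :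
    p ∈ hermiteSubgroup a d b ↔ ∃ x k : ℤ, p = (a * x + b * k, d * k) := Iff.rfl

theorem comap_inl_hermiteSubgroup {a d b : ℤ} (hd : d ≠ 0) :
    (hermiteSubgroup a d b).comap (AddMonoidHom.inl ℤ ℤ) = AddSubgroup.zmultiples a := by
  ext y
  simp only [AddSubgroup.mem_comap, AddMonoidHom.inl_apply, mem_hermiteSubgroup,
    Int.mem_zmultiples_iff, Prod.mk.injEq]
  constructor
  · rintro ⟨x, k, h1, h2⟩
    have : k = 0 := by
      rcases mul_eq_zero.1 h2.symm with h | h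
      · exact absurd h hd
      · exact h
    exact ⟨x, by rw [h1, this]; ring⟩
  · rintro ⟨x, rfl⟩
    exact ⟨x, 0, by simp, by simp⟩

theorem map_snd_hermiteSubgroup {a d b : ℤ} :
    (hermiteSubgroup a d b).map (AddMonoidHom.snd ℤ ℤ) = AddSubgroup.zmultiples d := by
  ext y
  simp only [AddSubgroup.mem_map, mem_hermiteSubgroup, Int.mem_zmultiples_iff]
  constructor
  · rintro ⟨_, ⟨x, k, rfl⟩, rfl⟩
    exact ⟨k, rfl⟩
  · rintro ⟨k, rfl⟩
    exact ⟨_, ⟨0, k, rfl⟩, rfl⟩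

/-- Hermite normal form: a is the index of the intersection with the first axis, d = n / a that of
the projection to the second, and b is a residue modulo a. Hence each divisor a of n accounts for a
subgroups, and the total is σ(n). -/
theorem subgroups_index_eq_image {n : ℕ} (hn : n ≠ 0) :
    {W : AddSubgroup (ℤ × ℤ) | W.index = n} =
      (fun p : (_ : ℕ) × ℕ => hermiteSubgroup p.1 (n / p.1 : ℕ) p.2) ''
        (n.divisors.sigma fun a => Finset.range a : Finset ((_ : ℕ) × ℕ)) := by
  ext W
  simp only [Set.mem_ofPred_eq, Set.mem_image, Finset.mem_coe, Finset.mem_sigma, Finset.mem_range,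
    Nat.mem_divisors]
  constructor
  · intro hW
    have hmul := index_eq_index_comap_mul_index_map W
    obtain ⟨a, ha⟩ : ∃ a, a = (W.comap (AddMonoidHom.inl ℤ ℤ)).index := ⟨_, rfl⟩
    obtain ⟨d, hd⟩ : ∃ d, d = (W.map (AddMonoidHom.snd ℤ ℤ)).index := ⟨_, rfl⟩
    have hA := eq_zmultiples_index (W.comap (AddMonoidHom.inl ℤ ℤ))
    have hD := eq_zmultiples_index (W.map (AddMonoidHom.snd ℤ ℤ))
    rw [hW, ← ha, ← hd] at hmul
    rw [← ha] at hA
    rw [← hd] at hD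
    have ha0 : a ≠ 0 := fun h => hn (by simp [hmul, h])
    have hdiv : n / a = d := by rw [hmul]; exact Nat.mul_div_cancel_left _ (Nat.pos_of_ne_zero ha0)
    have hA' : ∀ x : ℤ, (x, (0 : ℤ)) ∈ W ↔ (a : ℤ) ∣ x := fun x => by
      rw [← Int.mem_zmultiples_iff, ← hA]; rfl
    have hD' : ∀ y : ℤ, (∃ x, (x, y) ∈ W) ↔ (d : ℤ) ∣ y := fun y => by
      rw [← Int.mem_zmultiples_iff, ← hD]; simp
    obtain ⟨x, hx⟩ := (hD' d).2 dvd_rfl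
    have ha0' : (0 : ℤ) < a := by exact_mod_cast Nat.pos_of_ne_zero ha0
    have hb : ((x % a).toNat : ℤ) = x % a := Int.toNat_of_nonneg (Int.emod_nonneg _ ha0'.ne')
    have hbW : (((x % a).toNat : ℤ), (d : ℤ)) ∈ W := by
      have h1 : (-(a * (x / a)), (0 : ℤ)) ∈ W := (hA' _).2 (by simp)
      have h2 := W.add_mem hx h1
      have h3 : x + -(a * (x / a)) = x % a := by
        have := Int.emod_add_mul_ediv x a
        linarith
      simpa [h3, hb] using h2
    refine ⟨⟨a, (x % a).toNat⟩, ⟨⟨⟨d, hmul⟩, hn⟩, ?_⟩, ?_⟩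
    · have := Int.emod_lt_of_pos x ha0'
      simp only
      omega
    · ext ⟨u, v⟩
      simp only [mem_hermiteSubgroup, hdiv, Prod.mk.injEq]
      constructor
      · rintro ⟨y, k, rfl, rfl⟩
        have h1 := W.add_mem ((hA' (a * y)).2 (dvd_mul_right _ _)) (W.zsmul_mem hbW k)
        simpa [mul_comm] using h1
      · intro huv
        obtain ⟨k, rfl⟩ := (hD' v).1 ⟨u, huv⟩
        have h1 := W.sub_mem huv (W.zsmul_mem hbW k)
        have h2 : (u - k * ((x % a).toNat : ℤ), (0 : ℤ)) ∈ W := by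
          simpa [mul_comm] using h1
        obtain ⟨y, hy⟩ := (hA' _).1 h2
        exact ⟨y, k, by linarith, rfl⟩
  · rintro ⟨⟨a, b⟩, ⟨⟨⟨d, rfl⟩, -⟩, hb⟩, rfl⟩
    have ha0 : a ≠ 0 := left_ne_zero_of_mul hn
    have hd0 : d ≠ 0 := right_ne_zero_of_mul hn
    rw [Nat.mul_div_cancel_left _ (Nat.pos_of_ne_zero ha0), index_eq_index_comap_mul_index_map,
      comap_inl_hermiteSubgroup (by exact_mod_cast hd0), map_snd_hermiteSubgroup]
    simp [Int.index_zmultiples]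

theorem hermiteSubgroup_injOn {n : ℕ} (hn : n ≠ 0) :
    Set.InjOn (fun p : (_ : ℕ) × ℕ => hermiteSubgroup p.1 (n / p.1 : ℕ) p.2)
      (n.divisors.sigma fun a => Finset.range a : Finset ((_ : ℕ) × ℕ)) := by
  rintro ⟨a, b⟩ h ⟨a', b'⟩ h' heq
  simp only [Finset.mem_coe, Finset.mem_sigma, Finset.mem_range, Nat.mem_divisors] at h h' heq
  obtain ⟨⟨ha, -⟩, hb⟩ := h
  obtain ⟨⟨ha', -⟩, hb'⟩ := h'
  have hd : ∀ {a : ℕ}, a ∣ n → ((n / a : ℕ) : ℤ) ≠ 0 := fun {a} ha => by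
    have : n / a ≠ 0 := (Nat.div_pos (Nat.le_of_dvd (Nat.pos_of_ne_zero hn) ha)
      (Nat.pos_of_dvd_of_pos ha (Nat.pos_of_ne_zero hn))).ne'
    exact_mod_cast this
  have h1 := congrArg (fun W => (W.comap (AddMonoidHom.inl ℤ ℤ)).index) heq
  simp only [comap_inl_hermiteSubgroup (hd ha), comap_inl_hermiteSubgroup (hd ha'),
    Int.index_zmultiples, Int.natAbs_natCast] at h1
  subst h1
  have h2 : ((b : ℤ), ((n / a : ℕ) : ℤ)) ∈ hermiteSubgroup a (n / a : ℕ) b' := by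
    rw [← heq]
    exact ⟨0, 1, by simp⟩
  obtain ⟨x, k, hxk⟩ := h2
  rw [Prod.mk.injEq] at hxk
  have hk : k = 1 := by
    have := hxk.2
    exact mul_left_cancel₀ (hd ha) (by linarith)
  have h3 : (b : ℤ) = a * x + b' := by rw [hxk.1, hk]; ring
  have h4 : b = b' := by
    have h5 : (b : ℤ) % a = b' % a := by rw [h3]; simp
    rw [Int.emod_eq_of_lt (by positivity) (by exact_mod_cast hb),
      Int.emod_eq_of_lt (by positivity) (by exact_mod_cast hb')] at h5
    exact_mod_cast h5
  rw [h4]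

theorem finite_subgroups_index {n : ℕ} (hn : n ≠ 0) :
    {W : AddSubgroup (ℤ × ℤ) | W.index = n}.Finite := by
  rw [subgroups_index_eq_image hn]
  exact (Finset.finite_toSet _).image _

theorem ncard_subgroups_index {n : ℕ} (hn : n ≠ 0) :
    {W : AddSubgroup (ℤ × ℤ) | W.index = n}.ncard = ∑ d ∈ n.divisors, d := by
  rw [subgroups_index_eq_image hn, (hermiteSubgroup_injOn hn).ncard_image,
    Set.ncard_coe_finset, Finset.card_sigma]
  simp

end Hurwitz
end

noncomputable section

/-! ### The number of right ideals of given index -/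

namespace Hurwitz

section

variable {n : ℕ} (φ : hurwitzRing →+* Matrix (Fin 2) (Fin 2) (ZMod n))

/-- The right ideal of all `x` for which the columns of `φ x` lie in `U`. -/
def columnIdeal (U : AddSubgroup (Fin 2 → ZMod n)) : Submodule hurwitzRingᵐᵒᵖ hurwitzRing where
  carrier := {x | ∀ j, (φ x).col j ∈ U}
  zero_mem' := fun j => by
    rw [map_zero]
    exact U.zero_mem
  add_mem' := fun {x y} hx hy j => by
    rw [map_add]
    exact U.add_mem (hx j) (hy j)
  smul_mem' := fun r x hx j => by
    have h : (φ (r • x)).col j =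
        (φ r.unop) 0 j • (φ x).col 0 + (φ r.unop) 1 j • (φ x).col 1 := by
      ext i
      simp [Matrix.mul_apply, Fin.sum_univ_two, mul_comm]
    rw [h]
    exact U.add_mem (ZMod.smul_mem (hx 0) _) (ZMod.smul_mem (hx 1) _)

variable {φ}

theorem mem_columnIdeal {U : AddSubgroup (Fin 2 → ZMod n)} {x : hurwitzRing} :
    x ∈ columnIdeal φ U ↔ ∀ j, (φ x).col j ∈ U := Iff.rfl

/-- The quotient is a product of two copies of (ℤ/n)²/U, one for each column. -/
theorem index_columnIdeal (hφ : Function.Surjective φ) (U : AddSubgroup (Fin 2 → ZMod n)) :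
    (columnIdeal φ U).toAddSubgroup.index = U.index ^ 2 := by
  let f : hurwitzRing →+ (Fin 2 → (Fin 2 → ZMod n) ⧸ U) :=
    { toFun := fun x j => QuotientAddGroup.mk ((φ x).col j)
      map_zero' := by
        ext j
        rw [map_zero]
        rfl
      map_add' := fun x y => by
        ext j
        rw [map_add]
        rfl }
  have hf : ∀ x j, f x j = QuotientAddGroup.mk ((φ x).col j) := fun x j => rfl
  have hker : (columnIdeal φ U).toAddSubgroup = f.ker := by
    ext x
    rw [AddMonoidHom.mem_ker, funext_iff]
    simp only [hf, Pi.zero_apply, QuotientAddGroup.eq_zero_iff]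
    rfl
  have hsurj : Function.Surjective f := by
    intro v
    choose w hw using fun j => QuotientAddGroup.mk_surjective (v j)
    obtain ⟨x, hx⟩ := hφ (Matrix.of fun i j => w j i)
    refine ⟨x, funext fun j => ?_⟩
    rw [hf, hx, ← hw]
    rfl
  rw [hker, AddSubgroup.index_ker, AddMonoidHom.range_eq_top.2 hsurj, AddSubgroup.card_top,
    Nat.card_fun, Nat.card_fin]
  rfl

theorem columnIdeal_injective (hφ : Function.Surjective φ) :
    Function.Injective (columnIdeal φ) := by
  have key : ∀ U U', columnIdeal φ U ≤ columnIdeal φ U' → U ≤ U' := by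
    intro U U' h v hv
    obtain ⟨x, hx⟩ := hφ (Matrix.of fun i _ => v i)
    have hcol : ∀ j, (φ x).col j = v := fun j => by rw [hx]; rfl
    have h1 : x ∈ columnIdeal φ U := fun j => by rwa [hcol]
    simpa [hcol] using h h1 0
  exact fun U U' h => le_antisymm (key _ _ h.le) (key _ _ h.ge)

/-- Morita equivalence: right multiplication by matrix units moves any column to any position and
kills the others, so a right ideal containing the kernel is determined by its first columns. -/
theorem exists_eq_columnIdeal (hφ : Function.Surjective φ)
    {I : Submodule hurwitzRingᵐᵒᵖ hurwitzRing} (hI : ∀ x, φ x = 0 → x ∈ I) :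
    ∃ U, I = columnIdeal φ U := by
  let f : hurwitzRing →+ (Fin 2 → ZMod n) :=
    { toFun := fun x => (φ x).col 0
      map_zero' := by
        rw [map_zero]
        rfl
      map_add' := fun x y => by
        rw [map_add]
        rfl }
  refine ⟨I.toAddSubgroup.map f, ?_⟩
  ext x
  simp only [mem_columnIdeal, AddSubgroup.mem_map]
  constructor
  · intro hx j
    obtain ⟨y, hy⟩ := hφ (Matrix.single j 0 1)
    refine ⟨x * y, mul_mem_right hx y, ?_⟩
    change (φ (x * y)).col 0 = _
    ext i
    rw [map_mul, hy]
    simp [Matrix.mul_apply, Matrix.single_apply]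
  · intro h
    obtain ⟨x₀, hx₀, h0⟩ := h 0
    obtain ⟨x₁, hx₁, h1⟩ := h 1
    change (φ x₀).col 0 = _ at h0
    change (φ x₁).col 0 = _ at h1
    obtain ⟨y₀, hy₀⟩ := hφ (Matrix.single 0 0 1)
    obtain ⟨y₁, hy₁⟩ := hφ (Matrix.single 0 1 1)
    have hz : φ (x - (x₀ * y₀ + x₁ * y₁)) = 0 := by
      rw [map_sub, map_add, map_mul, map_mul, hy₀, hy₁]
      ext i j
      have h0i := congrFun h0 i
      have h1i := congrFun h1 i
      simp only [Matrix.col_apply] at h0i h1i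
      fin_cases j <;> simp [Matrix.mul_apply, Matrix.single_apply, h0i, h1i]
    have := I.add_mem (hI _ hz) (I.add_mem (mul_mem_right hx₀ y₀) (mul_mem_right hx₁ y₁))
    simpa using this

end

theorem exists_eq_rightIdeal_of_index {I : Submodule hurwitzRingᵐᵒᵖ hurwitzRing} {m : ℕ}
    (hm : m ≠ 0) (hI : I.toAddSubgroup.index = m) :
    ∃ q, q ≠ 0 ∧ I = rightIdeal q ∧ nrm q ^ 2 = m := by
  obtain ⟨q, rfl⟩ := exists_eq_rightIdeal I
  have hq : q ≠ 0 := by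
    rintro rfl
    have h0 : (rightIdeal 0).toAddSubgroup = ⊥ := by
      ext x
      simp [mem_rightIdeal]
    have : Infinite hurwitzRing := coordsEquiv.toEquiv.infinite_iff.1 inferInstance
    rw [h0, AddSubgroup.index_bot, Nat.card_eq_zero_of_infinite] at hI
    exact hm hI.symm
  exact ⟨q, hq, rfl, by rw [← hI, index_rightIdeal q hq]⟩

theorem natCast_nrm_mul_mem_rightIdeal (q x : hurwitzRing) :
    (nrm q : hurwitzRing) * x ∈ rightIdeal q :=
  mem_rightIdeal.2 ⟨conj q * x, by rw [← mul_assoc, mul_conj]⟩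

/-- A right ideal of index n² is q𝕁 with |q|² = n, and n = q q̄ shows that it contains n𝕁, the
kernel of the reduction. So the correspondence with column spaces reaches all of them. -/
theorem bijOn_columnIdeal {n : ℕ} (hn : n ≠ 0)
    {φ : hurwitzRing →+* Matrix (Fin 2) (Fin 2) (ZMod n)}
    (hφ : Function.Surjective φ) (hker : ∀ x, φ x = 0 ↔ ∃ y, x = n * y) :
    Set.BijOn (columnIdeal φ) {U | U.index = n}
      {I : Submodule hurwitzRingᵐᵒᵖ hurwitzRing | I.toAddSubgroup.index = n ^ 2} := by
  refine ⟨fun U hU => ?_, (columnIdeal_injective hφ).injOn, fun I hI => ?_⟩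
  · have hU' : U.index = n := hU
    change (columnIdeal φ U).toAddSubgroup.index = n ^ 2
    rw [index_columnIdeal hφ, hU']
  · have hI' : I.toAddSubgroup.index = n ^ 2 := hI
    obtain ⟨q, hq, rfl, hqn⟩ := exists_eq_rightIdeal_of_index (pow_ne_zero 2 hn) hI'
    have hqn' : nrm q = n := Nat.pow_left_injective two_ne_zero hqn
    obtain ⟨U, hU⟩ := exists_eq_columnIdeal hφ (I := rightIdeal q) fun x hx => by
      obtain ⟨y, rfl⟩ := (hker x).1 hx
      rw [← hqn']
      exact natCast_nrm_mul_mem_rightIdeal q y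
    refine ⟨U, ?_, hU.symm⟩
    rw [hU, index_columnIdeal hφ] at hI'
    exact Nat.pow_left_injective two_ne_zero hI'

/-- A subgroup of ℤ² of index n contains nℤ². -/
theorem bijOn_comap_cast (n : ℕ) :
    ∃ c : ℤ × ℤ →+ (Fin 2 → ZMod n), Set.BijOn (AddSubgroup.comap c)
      {U | U.index = n} {W | W.index = n} := by
  let c : ℤ × ℤ →+ (Fin 2 → ZMod n) :=
    { toFun := fun p => ![(p.1 : ZMod n), (p.2 : ZMod n)]
      map_zero' := by simp
      map_add' := fun p q => by simp }
  have hc : ∀ p, c p = ![(p.1 : ZMod n), (p.2 : ZMod n)] := fun _ => rfl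
  have hsurj : Function.Surjective c := fun v => by
    obtain ⟨x, hx⟩ := ZMod.intCast_surjective (v 0)
    obtain ⟨y, hy⟩ := ZMod.intCast_surjective (v 1)
    refine ⟨(x, y), ?_⟩
    ext i
    fin_cases i <;> simp [hc, hx, hy]
  refine ⟨c, fun U hU => ?_, (AddSubgroup.comap_injective hsurj).injOn, fun W hW => ?_⟩
  · exact (AddSubgroup.index_comap_of_surjective _ hsurj).trans hU
  · have hker : c.ker ≤ W := fun p hp => by
      rw [AddMonoidHom.mem_ker, hc] at hp
      have h0 := congrFun hp 0
      have h1 := congrFun hp 1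
      simp only [Matrix.cons_val_zero, Matrix.cons_val_one, Matrix.cons_val_fin_one,
        Pi.zero_apply, ZMod.intCast_zmod_eq_zero_iff_dvd] at h0 h1
      obtain ⟨x, hx⟩ := h0
      obtain ⟨y, hy⟩ := h1
      have : p = n • (x, y) := by
        ext <;> simp [hx, hy]
      rw [this]
      have h2 := W.nsmul_index_mem (x, y)
      rwa [show W.index = n from hW] at h2
    have hcm : (W.map c).comap c = W := AddSubgroup.comap_map_eq_self hker
    refine ⟨W.map c, ?_, hcm⟩
    change (W.map c).index = n
    rw [← AddSubgroup.index_comap_of_surjective _ hsurj, hcm]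
    exact hW

theorem finite_rightIdeals_of_odd {n : ℕ} (hn : Odd n) :
    {I : Submodule hurwitzRingᵐᵒᵖ hurwitzRing | I.toAddSubgroup.index = n ^ 2}.Finite := by
  have hn0 : n ≠ 0 := fun h => by simp [h] at hn
  obtain ⟨φ, hφ, hker, -⟩ := exists_reduction hn
  obtain ⟨c, hc⟩ := bijOn_comap_cast n
  rw [← (bijOn_columnIdeal hn0 hφ hker).finite_iff_finite, hc.finite_iff_finite]
  exact finite_subgroups_index hn0

theorem rightIdealCount_sq_of_odd {n : ℕ} (hn : Odd n) :
    rightIdealCount (n ^ 2) = ∑ d ∈ n.divisors, d := by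
  have hn0 : n ≠ 0 := fun h => by simp [h] at hn
  obtain ⟨φ, hφ, hker, -⟩ := exists_reduction hn
  obtain ⟨c, hc⟩ := bijOn_comap_cast n
  have h1 := (bijOn_columnIdeal hn0 hφ hker).ncard_eq
  have h2 := hc.ncard_eq
  rw [rightIdealCount, ← h1, h2, ncard_subgroups_index hn0]

theorem rightIdealCount_eq_zero {m : ℕ} (hm : m ≠ 0) (h : ¬ IsSquare m) :
    rightIdealCount m = 0 := by
  have : {I : Submodule hurwitzRingᵐᵒᵖ hurwitzRing | I.toAddSubgroup.index = m} = ∅ := by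
    ext I
    simp only [Set.mem_ofPred_eq, Set.mem_empty_iff_false, iff_false]
    intro hI
    obtain ⟨q, -, -, hq⟩ := exists_eq_rightIdeal_of_index hm hI
    exact h ⟨nrm q, by rw [← hq, sq]⟩
  rw [rightIdealCount, this, Set.ncard_empty]

/-- Elements of even norm are left divisible by 1 + i, so I ↦ (1 + i)I is a bijection onto the
ideals of index (2n)². -/
theorem rightIdealCount_two_mul_sq {n : ℕ} (hn : n ≠ 0) :
    rightIdealCount ((2 * n) ^ 2) = rightIdealCount (n ^ 2) := by
  symm
  refine Set.BijOn.ncard_eq (f := fun I => I.map (leftMul onePlusI)) ⟨fun I hI => ?_, ?_, ?_⟩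
  · obtain ⟨q, hq, rfl, hqn⟩ := exists_eq_rightIdeal_of_index (pow_ne_zero 2 hn) hI
    have hqn' : nrm q = n := Nat.pow_left_injective two_ne_zero hqn
    change ((rightIdeal q).map (leftMul onePlusI)).toAddSubgroup.index = _
    rw [← rightIdeal_mul, index_rightIdeal _ (mul_ne_zero onePlusI_ne_zero hq), nrm_mul,
      nrm_onePlusI, hqn']
  · exact (Submodule.map_injective_of_injective (leftMul_injective onePlusI_ne_zero)).injOn
  · intro I hI
    obtain ⟨q, hq, rfl, hqn⟩ :=
      exists_eq_rightIdeal_of_index (pow_ne_zero 2 (mul_ne_zero two_ne_zero hn)) hI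
    have hqn' : nrm q = 2 * n := Nat.pow_left_injective two_ne_zero hqn
    obtain ⟨p, rfl⟩ := exists_onePlusI_mul (q := q) (by rw [hqn']; exact even_two_mul n)
    have hpn : nrm p = n := by
      rw [nrm_mul, nrm_onePlusI] at hqn'
      omega
    refine ⟨rightIdeal p, ?_, (rightIdeal_mul _ _).symm⟩
    change (rightIdeal p).toAddSubgroup.index = _
    rw [index_rightIdeal _ (right_ne_zero_of_mul hq), hpn]

end Hurwitz
end

noncomputable section

/-! ### Primitive Hurwitz quaternions -/

namespace Hurwitz

/-- A Hurwitz quaternion that is not divisible by any integer `c > 1`. -/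
def IsPrim (q : hurwitzRing) : Prop := ∀ (c : ℕ) (r : hurwitzRing), q = c * r → c = 1

theorem IsPrim.ne_zero {q : hurwitzRing} (hq : IsPrim q) : q ≠ 0 := by
  rintro rfl
  exact zero_ne_one (hq 0 0 (by simp))

theorem IsPrim.mul_right {q u : hurwitzRing} (hq : IsPrim q) (hu : nrm u = 1) :
    IsPrim (q * u) := by
  intro c r h
  refine hq c (r * conj u) ?_
  rw [← mul_assoc, ← h, mul_assoc, mul_conj, hu]
  simp

theorem exists_natCast_mul_isPrim {q : hurwitzRing} (hq : q ≠ 0) :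
    ∃ (c : ℕ) (r : hurwitzRing), q = c * r ∧ IsPrim r := by
  induction hn : nrm q using Nat.strong_induction_on generalizing q with
  | _ n ih =>
    by_cases hp : IsPrim q
    · exact ⟨1, q, by simp, hp⟩
    · simp only [IsPrim, not_forall] at hp
      obtain ⟨c, r, rfl, hc⟩ := hp
      have hr : r ≠ 0 := right_ne_zero_of_mul hq
      have hc0 : c ≠ 0 := fun h => left_ne_zero_of_mul hq (by simp [h])
      have hr' : 0 < nrm r := Nat.pos_of_ne_zero fun h => hr (nrm_eq_zero.1 h)
      have hlt : nrm r < n := by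
        rw [← hn, nrm_mul, nrm_natCast]
        have : 1 < c ^ 2 := Nat.one_lt_pow two_ne_zero (by omega)
        nlinarith
      obtain ⟨d, s, rfl, hs⟩ := ih _ hlt hr rfl
      exact ⟨c * d, s, by push_cast; rw [mul_assoc], hs⟩

/-- Uniqueness of the integer content: after division by the gcd, a x = b y with a, b coprime gives
b ∣ x by Bézout, so primitivity forces b = 1. -/
theorem eq_of_natCast_mul_eq {c d : ℕ} {q r : hurwitzRing} (hq : IsPrim q) (hr : IsPrim r)
    (h : (c : hurwitzRing) * q = d * r) : c = d := by
  by_cases hc : c = 0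
  · subst hc
    have : (d : hurwitzRing) = 0 := by
      rw [Nat.cast_zero, zero_mul] at h
      exact (mul_eq_zero.1 h.symm).resolve_right hr.ne_zero
    by_contra hd
    exact natCast_ne_zero (fun h => hd h.symm) this
  obtain ⟨g, c', d', hg, hcop, rfl, rfl⟩ := Nat.exists_coprime' (Nat.gcd_pos_of_pos_left d (Nat.pos_of_ne_zero hc))
  have key : ∀ {a b : ℕ} {x y : hurwitzRing}, Nat.Coprime a b → IsPrim x →
      (a : hurwitzRing) * x = b * y → b = 1 := by
    intro a b x y hab hx hxy
    have hbez := Nat.gcd_eq_gcd_ab a b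
    rw [hab.gcd_eq_one] at hbez
    refine hx b ((a.gcdA b : hurwitzRing) * y + (a.gcdB b : hurwitzRing) * x) ?_
    have hbez' : (1 : hurwitzRing) = a * (a.gcdA b : ℤ) + b * (a.gcdB b : ℤ) := by
      exact_mod_cast congrArg (fun z : ℤ => (z : hurwitzRing)) hbez
    calc x = 1 * x := (one_mul x).symm
      _ = (a.gcdA b : ℤ) * (a * x) + b * ((a.gcdB b : ℤ) * x) := by
        rw [hbez', add_mul, (Nat.cast_commute a _).eq, mul_assoc, mul_assoc]
      _ = _ := by
        rw [hxy, ← mul_assoc, ← (Nat.cast_commute b _).eq, mul_assoc, mul_add]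
  have h' : (c' : hurwitzRing) * q = d' * r := by
    refine mul_left_cancel₀ (natCast_ne_zero hg.ne') ?_
    rw [← mul_assoc, ← mul_assoc]
    push_cast at h
    rwa [(Nat.cast_commute g _).eq, (Nat.cast_commute g _).eq]
  rw [key hcop hq h', key hcop.symm hr h'.symm]

theorem exists_of_rightIdeal_eq {p q : hurwitzRing} (hq : q ≠ 0)
    (h : rightIdeal p = rightIdeal q) : ∃ u, nrm u = 1 ∧ p = q * u := by
  obtain ⟨u, hu⟩ := mem_rightIdeal.1 (h ▸ self_mem_rightIdeal p)
  obtain ⟨v, hv⟩ := mem_rightIdeal.1 (h ▸ self_mem_rightIdeal q)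
  refine ⟨u, ?_, hu⟩
  have h1 : q * (u * v) = q * 1 := by rw [← mul_assoc, ← hu, ← hv, mul_one]
  have h2 := congrArg nrm (mul_left_cancel₀ hq h1)
  rw [nrm_mul, nrm_one] at h2
  exact Nat.eq_one_of_mul_eq_one_right h2

/-- The right ideals generated by the primitive Hurwitz quaternions of norm `n`. -/
def primIdeals (n : ℕ) : Set (Submodule hurwitzRingᵐᵒᵖ hurwitzRing) :=
  {I | ∃ q, IsPrim q ∧ nrm q = n ∧ I = rightIdeal q}

theorem index_eq_iff_exists {I : Submodule hurwitzRingᵐᵒᵖ hurwitzRing} {n : ℕ} (hn : n ≠ 0) :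
    I.toAddSubgroup.index = n ^ 2 ↔ ∃ q, nrm q = n ∧ I = rightIdeal q := by
  constructor
  · intro h
    obtain ⟨q, -, h1, h2⟩ := exists_eq_rightIdeal_of_index (pow_ne_zero 2 hn) h
    exact ⟨q, Nat.pow_left_injective two_ne_zero h2, h1⟩
  · rintro ⟨q, rfl, rfl⟩
    exact index_rightIdeal q fun h => hn (nrm_eq_zero.2 h)

/-- A generator is its content c times a primitive quaternion. The union is indexed by x = c², which
divides the norm n. -/
theorem rightIdeals_eq_iUnion {n : ℕ} (hn : n ≠ 0) :
    {I : Submodule hurwitzRingᵐᵒᵖ hurwitzRing | I.toAddSubgroup.index = n ^ 2} =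
      ⋃ x ∈ n.divisors.filter IsSquare,
        (fun I => I.map (leftMul (Nat.sqrt x : hurwitzRing))) '' primIdeals (n / x) := by
  ext I
  simp only [Set.mem_ofPred_eq, index_eq_iff_exists hn, Set.mem_iUnion, Finset.mem_filter,
    Nat.mem_divisors, Set.mem_image, primIdeals, exists_prop]
  constructor
  · rintro ⟨q, rfl, rfl⟩
    obtain ⟨c, r, rfl, hr⟩ := exists_natCast_mul_isPrim fun h => hn (nrm_eq_zero.2 h)
    rw [nrm_mul, nrm_natCast] at hn ⊢
    refine ⟨c ^ 2, ⟨⟨dvd_mul_right _ _, hn⟩, ⟨c, sq c⟩⟩, _, ⟨r, hr, ?_, rfl⟩, ?_⟩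
    · rw [Nat.mul_div_cancel_left _ (Nat.pos_of_ne_zero (left_ne_zero_of_mul hn))]
    · rw [← rightIdeal_mul, Nat.sqrt_eq']
  · rintro ⟨_, ⟨⟨hx, -⟩, ⟨c, rfl⟩⟩, _, ⟨r, hr, hrn, rfl⟩, rfl⟩
    refine ⟨c * r, ?_, ?_⟩
    · rw [nrm_mul, nrm_natCast, hrn, sq, Nat.mul_div_cancel' hx]
    · rw [Nat.sqrt_eq, rightIdeal_mul]

theorem disjoint_image_primIdeals {n x y : ℕ} (hxs : IsSquare x) (hys : IsSquare y) (hx : x ≠ 0)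
    (hxy : x ≠ y) : Disjoint
      ((fun I => I.map (leftMul (Nat.sqrt x : hurwitzRing))) '' primIdeals (n / x))
      ((fun I => I.map (leftMul (Nat.sqrt y : hurwitzRing))) '' primIdeals (n / y)) := by
  obtain ⟨c, rfl⟩ := hxs
  obtain ⟨d, rfl⟩ := hys
  rw [Set.disjoint_left]
  rintro _ ⟨_, ⟨q, hq, -, rfl⟩, rfl⟩ ⟨_, ⟨r, hr, -, rfl⟩, h⟩
  simp only [Nat.sqrt_eq, ← rightIdeal_mul] at h
  have hc : c ≠ 0 := left_ne_zero_of_mul hx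
  obtain ⟨u, hu, h2⟩ := exists_of_rightIdeal_eq (mul_ne_zero (natCast_ne_zero hc) hq.ne_zero) h
  rw [mul_assoc] at h2
  exact hxy (by rw [eq_of_natCast_mul_eq hr (hq.mul_right hu) h2])

theorem finite_primIdeals_of_odd {n : ℕ} (hn : Odd n) : (primIdeals n).Finite := by
  refine (finite_rightIdeals_of_odd hn).subset ?_
  rintro _ ⟨q, hq, rfl, rfl⟩
  exact index_rightIdeal q hq.ne_zero

/-- Both sides count all right ideals of index n², on the left sorted by content. The relation
determines the primitive counts recursively. -/
theorem sum_ncard_primIdeals {n : ℕ} (hn : Odd n) :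
    ∑ x ∈ n.divisors.filter IsSquare, (primIdeals (n / x)).ncard = ∑ d ∈ n.divisors, d := by
  classical
  have hn0 : n ≠ 0 := fun h => by simp [h] at hn
  rw [← rightIdealCount_sq_of_odd hn, rightIdealCount, rightIdeals_eq_iUnion hn0]
  have hfin : ∀ x, x ∣ n → (primIdeals (n / x)).Finite := fun x hx =>
    finite_primIdeals_of_odd (Odd.of_dvd_nat hn (Nat.div_dvd_of_dvd hx))
  have hsq : ∀ x ∈ n.divisors.filter IsSquare, x ≠ 0 ∧ x ∣ n ∧ IsSquare x := by
    intro x hx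
    rw [Finset.mem_filter, Nat.mem_divisors] at hx
    exact ⟨fun h => hn0 (by simpa [h] using hx.1.1), hx.1.1, hx.2⟩
  have hU := (n.divisors.filter IsSquare).finite_toSet.ncard_biUnion
    (s := fun x => (fun I => I.map (leftMul (Nat.sqrt x : hurwitzRing))) '' primIdeals (n / x))
    (fun x hx => (hfin x (hsq x hx).2.1).image _)
    (fun x hx y hy hxy =>
      disjoint_image_primIdeals (hsq x hx).2.2 (hsq y hy).2.2 (hsq x hx).1 hxy)
  rw [finsum_mem_coe_finset] at hU
  simp only [Finset.mem_coe] at hU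
  rw [hU]
  refine Finset.sum_congr rfl fun x hx => ?_
  refine (Function.Injective.injOn ?_).ncard_image.symm
  refine Submodule.map_injective_of_injective (leftMul_injective (natCast_ne_zero ?_))
  obtain ⟨h0, -, c, rfl⟩ := hsq x hx
  rw [Nat.sqrt_eq]
  exact left_ne_zero_of_mul h0

end Hurwitz

/-! ### The arithmetic functions involved -/

section ArithmeticFunctions

open ArithmeticFunction

/-- The indicator function of the nonzero squares. -/
def squareIndicator : ArithmeticFunction ℕ :=
  ⟨fun n => if n ≠ 0 ∧ IsSquare n then 1 else 0, by simp⟩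

/-- The indicator function of the squarefree numbers. -/
def squarefreeIndicator : ArithmeticFunction ℕ :=
  ⟨fun n => if Squarefree n then 1 else 0, by simp⟩

theorem squareIndicator_apply (n : ℕ) :
    squareIndicator n = if n ≠ 0 ∧ IsSquare n then 1 else 0 := rfl

theorem squarefreeIndicator_apply (n : ℕ) :
    squarefreeIndicator n = if Squarefree n then 1 else 0 := rfl

/-- The product ab is a square t². A squarefree a dividing t² divides t, whence a ∣ b, and the
situation is symmetric. -/
theorem eq_of_sq_mul_eq_sq_mul {a b c d : ℕ} (ha : Squarefree a) (hb : Squarefree b)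
    (hc : c ≠ 0) (h : c ^ 2 * a = d ^ 2 * b) : a = b := by
  have key : ∀ {a b c d : ℕ}, Squarefree a → Squarefree b → c ≠ 0 →
      c ^ 2 * a = d ^ 2 * b → a ∣ b := by
    intro a b c d ha hb hc h
    have h1 : c ^ 2 * (a * b) = (d * b) ^ 2 := by
      rw [← mul_assoc, h]; ring
    have h2 : c ∣ d * b := (Nat.pow_dvd_pow_iff two_ne_zero).1 ⟨_, h1.symm⟩
    obtain ⟨t, ht⟩ := h2
    have h3 : a * b = t ^ 2 := by
      rw [ht, mul_pow] at h1
      exact Nat.eq_of_mul_eq_mul_left (by positivity) h1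
    obtain ⟨s, rfl⟩ : a ∣ t :=
      (ha.dvd_pow_iff_dvd two_ne_zero).1 ⟨b, h3.symm⟩
    refine ⟨s ^ 2, Nat.eq_of_mul_eq_mul_left (Nat.pos_of_ne_zero ha.ne_zero) ?_⟩
    rw [h3]; ring
  have hd : d ≠ 0 := by
    rintro rfl
    rw [zero_pow two_ne_zero, zero_mul] at h
    exact mul_ne_zero (pow_ne_zero 2 hc) ha.ne_zero h
  exact Nat.dvd_antisymm (key ha hb hc h) (key hb ha hd h.symm)

/-- Every n ≥ 1 is a square times a squarefree number in exactly one way. -/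
theorem squareIndicator_mul_squarefreeIndicator :
    squareIndicator * squarefreeIndicator = ArithmeticFunction.zeta := by
  ext n
  by_cases hn : n = 0
  · simp [hn]
  obtain ⟨a, b, hab, ha⟩ := Nat.sq_mul_squarefree n
  have hb : b ≠ 0 := fun h => hn (by simp [← hab, h])
  rw [mul_apply, zeta_apply_ne hn, Finset.sum_eq_single (b ^ 2, a)]
  · simp [squareIndicator_apply, squarefreeIndicator_apply, ha, hb, IsSquare.sq]
  · rintro ⟨x, y⟩ hxy hne
    rw [Nat.mem_divisorsAntidiagonal] at hxy
    simp only [squareIndicator_apply, squarefreeIndicator_apply, mul_ite, mul_one, mul_zero]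
    rw [ite_eq_right_iff]
    intro hy
    rw [ite_eq_right_iff]
    rintro ⟨hx0, c, rfl⟩
    exfalso
    have hc : c ≠ 0 := left_ne_zero_of_mul hx0
    have h1 : c ^ 2 * y = b ^ 2 * a := by rw [hab, ← hxy.1, sq]
    obtain rfl := eq_of_sq_mul_eq_sq_mul hy ha hc h1
    have h2 := Nat.eq_of_mul_eq_mul_right (Nat.pos_of_ne_zero hy.ne_zero) h1
    exact hne (by rw [← h2, sq])
  · intro h
    exact absurd (Nat.mem_divisorsAntidiagonal.2 ⟨hab, hn⟩) h

/-- Convolved with `squareIndicator`, both sides give σ(n). As this is known for odd n only,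
`squareIndicator` is cancelled by strong induction, isolating the divisor 1. -/
theorem primCount_eq {n : ℕ} (hn : Odd n) :
    (Hurwitz.primIdeals n).ncard = (squarefreeIndicator * ArithmeticFunction.id) n := by
  induction n using Nat.strong_induction_on with
  | _ n ih =>
    have hn0 : n ≠ 0 := fun h => by simp [h] at hn
    have h1 := Hurwitz.sum_ncard_primIdeals hn
    have h2 : (squareIndicator * (squarefreeIndicator * ArithmeticFunction.id)) n =
        ∑ d ∈ n.divisors, d := by
      rw [← mul_assoc, squareIndicator_mul_squarefreeIndicator, mul_comm, mul_zeta_apply]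
      simp
    rw [mul_apply, Nat.sum_divisorsAntidiagonal (fun x y => squareIndicator x *
      (squarefreeIndicator * ArithmeticFunction.id) y)] at h2
    have h3 : ∀ x ∈ n.divisors, squareIndicator x = if IsSquare x then 1 else 0 := fun x hx => by
      have : x ≠ 0 := fun h => by simp [h] at hx
      simp [squareIndicator_apply, this]
    rw [Finset.sum_congr rfl fun x hx => by rw [h3 x hx, ite_mul, one_mul, zero_mul],
      ← Finset.sum_filter, ← h1] at h2
    have h4 : (1 : ℕ) ∈ n.divisors.filter IsSquare := by simp [hn0]
    rw [← Finset.add_sum_erase _ _ h4, ← Finset.add_sum_erase _ _ h4, Nat.div_one] at h2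
    rw [Finset.sum_congr rfl fun x hx => ?_] at h2
    · exact (add_right_cancel h2).symm
    · simp only [Finset.mem_erase, Finset.mem_filter, Nat.mem_divisors] at hx
      exact (ih _ (Nat.div_lt_self (Nat.pos_of_ne_zero hn0)
        ((Nat.two_le_iff x).2 ⟨fun h => hn0 (by simpa [h] using hx.2.1.1), hx.1⟩))
        (Odd.of_dvd_nat hn (Nat.div_dvd_of_dvd hx.2.1.1))).symm

end ArithmeticFunctions

end

noncomputable section

/-! ### The idealizer of a primitive right ideal of odd norm -/

namespace Hurwitz

/-- Integers with no common prime factor with `n` give a unimodular combination of columns. -/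
theorem exists_unimodular_combination {n : ℕ} (hn : n ≠ 0) (a b c d : ℕ)
    (h : ∀ p, p.Prime → p ∣ n → ¬ (p ∣ a ∧ p ∣ b ∧ p ∣ c ∧ p ∣ d)) :
    ∃ t : ℕ, Nat.gcd (Nat.gcd (a + t * b) (c + t * d)) n = 1 := by
  classical
  -- For a prime p of n not dividing both a and c, p ∣ t keeps the first column intact modulo p. For
  -- the others t is a unit modulo p, and the second column survives.
  refine ⟨∏ p ∈ n.primeFactors.filter (fun p => ¬ (p ∣ a ∧ p ∣ c)), p, ?_⟩
  set t := ∏ p ∈ n.primeFactors.filter (fun p => ¬ (p ∣ a ∧ p ∣ c)), p with ht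
  by_contra hne
  obtain ⟨p, hp, hpd⟩ := Nat.exists_prime_and_dvd hne
  have hpn : p ∣ n := hpd.trans (Nat.gcd_dvd_right _ _)
  have hp1 : p ∣ a + t * b := (hpd.trans (Nat.gcd_dvd_left _ _)).trans (Nat.gcd_dvd_left _ _)
  have hp2 : p ∣ c + t * d := (hpd.trans (Nat.gcd_dvd_left _ _)).trans (Nat.gcd_dvd_right _ _)
  by_cases hac : p ∣ a ∧ p ∣ c
  · have hpt : ¬ p ∣ t := by
      intro hpt
      rw [ht, hp.prime.dvd_finsetProd_iff] at hpt
      obtain ⟨l, hl, hpl⟩ := hpt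
      rw [Finset.mem_filter, Nat.mem_primeFactors] at hl
      obtain rfl := (Nat.prime_dvd_prime_iff_eq hp hl.1.1).1 hpl
      exact hl.2 hac
    have hb := (hp.dvd_mul.1 ((Nat.dvd_add_right hac.1).1 hp1)).resolve_left hpt
    have hd := (hp.dvd_mul.1 ((Nat.dvd_add_right hac.2).1 hp2)).resolve_left hpt
    exact h p hp hpn ⟨hac.1, hb, hac.2, hd⟩
  · have hpt : p ∣ t := Finset.dvd_prod_of_mem _
      (Finset.mem_filter.2 ⟨Nat.mem_primeFactors.2 ⟨hp, hpn, hn⟩, hac⟩)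
    exact hac ⟨(Nat.dvd_add_left (hpt.mul_right _)).1 hp1,
      (Nat.dvd_add_left (hpt.mul_right _)).1 hp2⟩

section

variable {n : ℕ} {φ : hurwitzRing →+* Matrix (Fin 2) (Fin 2) (ZMod n)} {q : hurwitzRing}

/-- The determinant of φ q is |q|² = n = 0, and primitivity prevents any prime factor of n from
dividing all four entries. Hence some combination w of the columns is unimodular, and both columns
are parallel to it. -/
theorem exists_generator (hn : Odd n) (hφ : Function.Surjective φ)
    (hker : ∀ x, φ x = 0 ↔ ∃ y, x = n * y) (hconj : ∀ x, φ (conj x) = (φ x).adjugate)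
    (hq : IsPrim q) (hqn : nrm q = n) :
    ∃ (w₀ w₁ r₀ r₁ t : ZMod n), r₀ * w₀ + r₁ * w₁ = 1 ∧ w₀ = φ q 0 0 + t * φ q 0 1 ∧
      w₁ = φ q 1 0 + t * φ q 1 1 ∧ ∀ j, φ q 0 j * w₁ - φ q 1 j * w₀ = 0 := by
  have hn0 : n ≠ 0 := fun h => by simp [h] at hn
  have : NeZero n := ⟨hn0⟩
  have hdet : φ q 0 0 * φ q 1 1 - φ q 0 1 * φ q 1 0 = 0 := by
    have h1 : φ (q * conj q) = 0 := by
      rw [mul_conj, hqn, map_natCast]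
      ext i j
      simp
    rw [map_mul, hconj, Matrix.mul_adjugate, Matrix.det_fin_two] at h1
    simpa using congrFun (congrFun h1 0) 0
  obtain ⟨t, ht⟩ := exists_unimodular_combination hn0 (φ q 0 0).val (φ q 0 1).val (φ q 1 0).val
    (φ q 1 1).val (by
      rintro p hp ⟨m, hm⟩ ⟨⟨a, ha⟩, ⟨b, hb⟩, ⟨c, hc⟩, ⟨d, hd⟩⟩
      obtain ⟨y, hy⟩ := hφ !![(a : ZMod n), (b : ZMod n); (c : ZMod n), (d : ZMod n)]
      have key : ∀ (z : ZMod n) (k : ℕ), z.val = p * k → z = p * k := fun z k h => by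
        rw [← ZMod.natCast_zmod_val z, h]; push_cast; rfl
      have hz : φ (q - p * y) = 0 := by
        rw [map_sub, map_mul, map_natCast, hy, ← nsmul_eq_mul]
        ext i j
        fin_cases i <;> fin_cases j <;> simp [key _ _ ha, key _ _ hb, key _ _ hc, key _ _ hd]
      obtain ⟨z, hz⟩ := (hker _).1 hz
      -- Here q = p y + n z with p ∣ n, so p would divide q.
      refine hp.one_lt.ne' (hq p (y + m * z) ?_)
      rw [sub_eq_iff_eq_add] at hz
      rw [hz, hm, mul_add]
      push_cast
      rw [mul_assoc, add_comm])
  have hlift : ∀ z : ZMod n, ((z.val : ℕ) : ZMod n) = z := ZMod.natCast_zmod_val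
  set g := Nat.gcd ((φ q 0 0).val + t * (φ q 0 1).val) ((φ q 1 0).val + t * (φ q 1 1).val) with hg
  have hb1 := Nat.gcd_eq_gcd_ab g n
  rw [ht] at hb1
  have hb2 := Nat.gcd_eq_gcd_ab ((φ q 0 0).val + t * (φ q 0 1).val)
    ((φ q 1 0).val + t * (φ q 1 1).val)
  rw [← hg] at hb2
  rw [hb2] at hb1
  have hb3 := congrArg (fun z : ℤ => (z : ZMod n)) hb1
  simp only [Nat.cast_one, Int.cast_one, Nat.cast_add, Nat.cast_mul, Int.cast_add, Int.cast_mul,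
    Int.cast_natCast, CharP.cast_eq_zero, zero_mul, add_zero, hlift] at hb3
  obtain ⟨A, B, C, hABC⟩ : ∃ A B C : ZMod n, 1 =
      ((φ q 0 0 + t * φ q 0 1) * A + (φ q 1 0 + t * φ q 1 1) * B) * C := ⟨_, _, _, hb3⟩
  refine ⟨φ q 0 0 + t * φ q 0 1, φ q 1 0 + t * φ q 1 1, A * C, B * C, t, ?_, rfl, rfl, ?_⟩
  · rw [hABC]; ring
  · intro j
    fin_cases j <;> simp
    · linear_combination (t : ZMod n) * hdet
    · linear_combination -hdet

variable {w₀ w₁ r₀ r₁ t : ZMod n}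

theorem eq_mul_of_cross_eq_zero (hr : r₀ * w₀ + r₁ * w₁ = 1) {x y : ZMod n}
    (h : x * w₁ - y * w₀ = 0) : x = w₀ * (r₀ * x + r₁ * y) ∧ y = w₁ * (r₀ * x + r₁ * y) := by
  constructor
  · linear_combination -x * hr + r₁ * h
  · linear_combination -y * hr - r₀ * h

/-- The columns of φ q span the line of w, and q𝕁 contains n𝕁; so membership in q𝕁 means that every
column is parallel to w. -/
theorem mem_rightIdeal_iff (hφ : Function.Surjective φ) (hker : ∀ x, φ x = 0 ↔ ∃ y, x = n * y)
    (hqn : nrm q = n) (hr : r₀ * w₀ + r₁ * w₁ = 1) (hw₀ : w₀ = φ q 0 0 + t * φ q 0 1)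
    (hw₁ : w₁ = φ q 1 0 + t * φ q 1 1) (hcol : ∀ j, φ q 0 j * w₁ - φ q 1 j * w₀ = 0)
    (x : hurwitzRing) :
    x ∈ rightIdeal q ↔ ∀ j, φ x 0 j * w₁ - φ x 1 j * w₀ = 0 := by
  constructor
  · intro hx j
    obtain ⟨y, rfl⟩ := mem_rightIdeal.1 hx
    rw [map_mul]
    simp only [Matrix.mul_apply, Fin.sum_univ_two]
    linear_combination φ y 0 j * hcol 0 + φ y 1 j * hcol 1
  · intro h
    -- Each column of φ y is a multiple of (1, t), which φ q maps to w.
    obtain ⟨y, hy⟩ := hφ (Matrix.of ![fun j => r₀ * φ x 0 j + r₁ * φ x 1 j,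
      fun j => t * (r₀ * φ x 0 j + r₁ * φ x 1 j)])
    have hz : φ (x - q * y) = 0 := by
      rw [map_sub, map_mul, hy]
      ext i j
      obtain ⟨h0, h1⟩ := eq_mul_of_cross_eq_zero hr (h j)
      fin_cases i
      · simp [Matrix.mul_apply, Fin.sum_univ_two]
        linear_combination h0 + hw₀ * (r₀ * φ x 0 j + r₁ * φ x 1 j)
      · simp [Matrix.mul_apply, Fin.sum_univ_two]
        linear_combination h1 + hw₁ * (r₀ * φ x 0 j + r₁ * φ x 1 j)
    obtain ⟨z, hz⟩ := (hker _).1 hz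
    rw [sub_eq_iff_eq_add] at hz
    rw [hz, ← hqn]
    exact add_mem (natCast_nrm_mul_mem_rightIdeal q z) (mem_rightIdeal.2 ⟨y, rfl⟩)

/-- The quadratic form `det (A w, w)` that vanishes iff `A` maps `w` into its own span. -/
def eigenForm (w₀ w₁ : ZMod n) (A : Matrix (Fin 2) (Fin 2) (ZMod n)) : ZMod n :=
  (A 0 0 * w₀ + A 0 1 * w₁) * w₁ - (A 1 0 * w₀ + A 1 1 * w₁) * w₀

theorem eigenForm_eq_zero_iff (hr : r₀ * w₀ + r₁ * w₁ = 1) (hw₀ : w₀ = φ q 0 0 + t * φ q 0 1)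
    (hw₁ : w₁ = φ q 1 0 + t * φ q 1 1) (hcol : ∀ j, φ q 0 j * w₁ - φ q 1 j * w₀ = 0)
    (v : hurwitzRing) :
    eigenForm w₀ w₁ (φ v) = 0 ↔ ∀ j, φ (v * q) 0 j * w₁ - φ (v * q) 1 j * w₀ = 0 := by
  simp only [map_mul, Matrix.mul_apply, Fin.sum_univ_two, eigenForm]
  constructor
  · intro h j
    obtain ⟨h0, h1⟩ := eq_mul_of_cross_eq_zero hr (hcol j)
    linear_combination (r₀ * φ q 0 j + r₁ * φ q 1 j) * h + (φ v 0 0 * w₁ - φ v 1 0 * w₀) * h0 +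
      (φ v 0 1 * w₁ - φ v 1 1 * w₀) * h1
  · intro h
    linear_combination h 0 + t * h 1 + (φ v 0 0 * w₁ - φ v 1 0 * w₀) * hw₀ +
      (φ v 0 1 * w₁ - φ v 1 1 * w₀) * hw₁

/-- A + adj A is the scalar tr A, on which the form vanishes. So passing to x - x̄ costs only a
factor 2. -/
theorem eigenForm_sub_adjugate (A : Matrix (Fin 2) (Fin 2) (ZMod n)) :
    eigenForm w₀ w₁ (A - A.adjugate) = 2 * eigenForm w₀ w₁ A := by
  simp [eigenForm, Matrix.adjugate_fin_two]
  ring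

end

/-- The elements `v` with `v q ∈ q𝕁` form the kernel of a homomorphism onto `ℤ/|q|²`. -/
theorem exists_idealizer_hom {q : hurwitzRing} (hq : IsPrim q) (hn : Odd (nrm q)) :
    ∃ f : hurwitzRing →+ ZMod (nrm q), Function.Surjective f ∧
      (∀ v, f v = 0 ↔ v * q ∈ rightIdeal q) ∧ ∀ x, f (x - conj x) = 2 * f x := by
  obtain ⟨φ, hφ, hker, hconj⟩ := exists_reduction hn
  obtain ⟨w₀, w₁, r₀, r₁, t, hr, hw₀, hw₁, hcol⟩ := exists_generator hn hφ hker hconj hq rfl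
  refine ⟨⟨⟨fun x => eigenForm w₀ w₁ (φ x), by simp [eigenForm]⟩, fun x y => by
    simp [eigenForm]; ring⟩, fun c => ?_, fun v => ?_, fun x => ?_⟩
  -- The rank-one matrix that sends w to c (r₁, -r₀), whose cross product with w is c.
  · obtain ⟨x, hx⟩ := hφ !![c * r₁ * r₀, c * r₁ * r₁; -c * r₀ * r₀, -c * r₀ * r₁]
    refine ⟨x, ?_⟩
    simp [hx, eigenForm]
    linear_combination c * (r₀ * w₀ + r₁ * w₁ + 1) * hr
  · exact (eigenForm_eq_zero_iff hr hw₀ hw₁ hcol v).trans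
      (mem_rightIdeal_iff hφ hker rfl hr hw₀ hw₁ hcol _).symm
  · simp [hconj, eigenForm_sub_adjugate]

/-- A primitive right ideal of odd norm is determined by its idealizer. -/
theorem rightIdeal_eq_of_idealizer {p q : hurwitzRing} (hp : IsPrim p) (hq : IsPrim q)
    (hn : Odd (nrm q)) (hpq : nrm p = nrm q)
    (h : ∀ x : hurwitzRing, (2 * (x - conj x)) * p ∈ rightIdeal p ↔
      (2 * (x - conj x)) * q ∈ rightIdeal q) : rightIdeal p = rightIdeal q := by
  obtain ⟨φ, hφ, hker, hconj⟩ := exists_reduction hn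
  obtain ⟨w₀, w₁, r₀, r₁, t, hr, hw₀, hw₁, hcol⟩ := exists_generator hn hφ hker hconj hq rfl
  obtain ⟨w₀', w₁', r₀', r₁', t', hr', hw₀', hw₁', hcol'⟩ :=
    exists_generator hn hφ hker hconj hp hpq
  have h2 : IsUnit (2 : ZMod (nrm q)) := by
    have := (ZMod.isUnit_iff_coprime 2 (nrm q)).2 (Nat.coprime_two_left.2 hn)
    simpa using this
  have key : ∀ A, eigenForm w₀ w₁ A = 0 ↔ eigenForm w₀' w₁' A = 0 := by
    intro A
    obtain ⟨x, rfl⟩ := hφ A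
    -- The test elements 2(x - x̄) are those available in both lattices. They lose only a factor 4,
    -- invertible modulo an odd number.
    have h4 : ∀ u₀ u₁ : ZMod (nrm q), eigenForm u₀ u₁ (φ (2 * (x - conj x))) = 0 ↔
        eigenForm u₀ u₁ (φ x) = 0 := by
      intro u₀ u₁
      have : eigenForm u₀ u₁ (φ (2 * (x - conj x))) = 2 * (2 * eigenForm u₀ u₁ (φ x)) := by
        rw [← eigenForm_sub_adjugate, ← hconj, ← map_sub, two_mul, map_add, two_mul]
        simp [eigenForm]; ring
      rw [this, h2.mul_right_eq_zero, h2.mul_right_eq_zero]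
    rw [← h4, ← h4, eigenForm_eq_zero_iff hr hw₀ hw₁ hcol,
      ← mem_rightIdeal_iff hφ hker rfl hr hw₀ hw₁ hcol, ← h,
      eigenForm_eq_zero_iff hr' hw₀' hw₁' hcol',
      ← mem_rightIdeal_iff hφ hker hpq hr' hw₀' hw₁' hcol']
  -- Both w rᵗ and w (w₁, -w₀) have w as an eigenvector, so w' is one as well. With D the cross
  -- product of w and w', this gives (r · w') D = 0 and D² = 0; unimodularity of w and w' then
  -- yields D = 0.
  have hD : w₀' * w₁ - w₁' * w₀ = 0 := by
    have k1 := (key !![w₀ * r₀, w₀ * r₁; w₁ * r₀, w₁ * r₁]).1 (by simp [eigenForm]; ring)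
    have k2 := (key !![w₀ * w₁, -w₀ * w₀; w₁ * w₁, -w₁ * w₀]).1 (by simp [eigenForm]; ring)
    simp only [eigenForm, Matrix.of_apply, Matrix.cons_val_zero, Matrix.cons_val_one,
      Matrix.cons_val_fin_one, Matrix.cons_val'] at k1 k2
    linear_combination -(w₀' * w₁ - w₁' * w₀) * hr' - (r₀' * w₀ + r₁' * w₁) * k1 -
      (r₀' * r₁ - r₁' * r₀) * k2 -
      (w₀' * w₁ - w₁' * w₀) * (r₀' * w₀' + r₁' * w₁') * hr
  ext x
  rw [mem_rightIdeal_iff hφ hker rfl hr hw₀ hw₁ hcol,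
    mem_rightIdeal_iff hφ hker hpq hr' hw₀' hw₁' hcol']
  refine forall_congr' fun j => ⟨fun hx => ?_, fun hx => ?_⟩
  · obtain ⟨h0, h1⟩ := eq_mul_of_cross_eq_zero hr' hx
    linear_combination w₁ * h0 - w₀ * h1 + (r₀' * φ x 0 j + r₁' * φ x 1 j) * hD
  · obtain ⟨h0, h1⟩ := eq_mul_of_cross_eq_zero hr hx
    linear_combination w₁' * h0 - w₀' * h1 - (r₀ * φ x 0 j + r₁ * φ x 1 j) * hD

end Hurwitz
end

noncomputable section

attribute [local simp] quat_re quat_imI quat_imJ quat_imK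

/-! ### Coincidence site lattices of the rotations given by Hurwitz quaternions -/

theorem toQuat_injective : Function.Injective toQuat := fun v w h => by
  rw [← imVec_toQuat v, h, imVec_toQuat]

theorem toQuat_add (v w : Space 3) : toQuat (v + w) = toQuat v + toQuat w := by
  ext <;> simp [toQuat]

theorem toQuat_neg (v : Space 3) : toQuat (-v) = -toQuat v := by
  ext <;> simp [toQuat]

theorem toQuat_sub (v w : Space 3) : toQuat (v - w) = toQuat v - toQuat w := by
  ext <;> simp [toQuat]

theorem toQuat_zero : toQuat 0 = 0 := by
  ext <;> simp [toQuat]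

theorem toQuat_smul (c : ℝ) (v : Space 3) : toQuat (c • v) = c • toQuat v := by
  ext <;> simp [toQuat]

theorem toQuat_quatRotation (q : ℍ[ℝ]) (hq : q ≠ 0) (v : Space 3) :
    toQuat (quatRotation q hq v) = q * toQuat v * q⁻¹ :=
  toQuat_imVec _ (re_conj q v)

theorem toQuat_quatRotation_symm (q : ℍ[ℝ]) (hq : q ≠ 0) (v : Space 3) :
    toQuat ((quatRotation q hq).symm v) = q⁻¹ * toQuat v * q := by
  have h := toQuat_quatRotation q hq ((quatRotation q hq).symm v)
  rw [LinearIsometryEquiv.apply_symm_apply] at h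
  rw [h, mul_assoc, mul_assoc, inv_mul_cancel₀ hq, mul_one, ← mul_assoc, inv_mul_cancel₀ hq,
    one_mul]

theorem quatRotation_mul (p q : ℍ[ℝ]) (hp : p ≠ 0) (hq : q ≠ 0) (v : Space 3) :
    quatRotation (p * q) (mul_ne_zero hp hq) v = quatRotation p hp (quatRotation q hq v) := by
  apply toQuat_injective
  rw [toQuat_quatRotation, toQuat_quatRotation, toQuat_quatRotation, mul_inv_rev]
  simp only [mul_assoc]

theorem quatRotation_smul (c : ℝ) (hc : c ≠ 0) (q : ℍ[ℝ]) (hq : q ≠ 0) :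
    quatRotation (c • q) (smul_ne_zero hc hq) = quatRotation q hq := by
  ext1 v
  apply toQuat_injective
  rw [toQuat_quatRotation, toQuat_quatRotation, smul_mul_assoc, smul_mul_assoc]
  have : (c • q)⁻¹ = c⁻¹ • q⁻¹ := by
    refine inv_eq_of_mul_eq_one_right ?_
    rw [smul_mul_smul_comm, mul_inv_cancel₀ hc, mul_inv_cancel₀ hq, one_smul]
  rw [this, mul_smul_comm, smul_smul, mul_inv_cancel₀ hc, one_smul]

theorem mem_imageLattice {R : Orth 3} {Λ : AddSubgroup (Space 3)} {v : Space 3} :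
    v ∈ imageLattice R Λ ↔ R.symm v ∈ Λ := by
  simp only [imageLattice, AddSubgroup.mem_map]
  constructor
  · rintro ⟨w, hw, rfl⟩
    change R.symm (R w) ∈ Λ
    rwa [LinearIsometryEquiv.symm_apply_apply]
  · intro h
    exact ⟨_, h, R.apply_symm_apply v⟩

theorem apply_mem_imageLattice {R : Orth 3} {Λ : AddSubgroup (Space 3)} {v : Space 3} :
    R v ∈ imageLattice R Λ ↔ v ∈ Λ := by
  rw [mem_imageLattice, LinearIsometryEquiv.symm_apply_apply]

/-- The lattices of Hurwitz integral vectors considered here: they contain `2ℤ³`, and whether an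
integral vector belongs to the lattice depends only on its length. -/
structure IsQuatLattice (Λ : AddSubgroup (Space 3)) : Prop where
  mem_hurwitz : ∀ {v}, v ∈ Λ → toQuat v ∈ hurwitzRing
  two_smul_mem : ∀ {v}, toQuat v ∈ hurwitzRing → (2 : ℝ) • v ∈ Λ
  of_norm_eq : ∀ {v w}, v ∈ Λ → toQuat w ∈ hurwitzRing → ‖w‖ = ‖v‖ → w ∈ Λ

theorem toQuat_mem_hurwitzRing {v : Space 3} :
    toQuat v ∈ hurwitzRing ↔ ∃ a b c : ℤ, v = !₂[(a : ℝ), (b : ℝ), (c : ℝ)] := by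
  constructor
  · rintro (⟨a, b, c, d, h⟩ | ⟨a, b, c, d, h⟩)
    · have h1 := congrArg (fun p : ℍ[ℝ] => p.imI) h
      have h2 := congrArg (fun p : ℍ[ℝ] => p.imJ) h
      have h3 := congrArg (fun p : ℍ[ℝ] => p.imK) h
      simp [toQuat] at h1 h2 h3
      exact ⟨b, c, d, by ext i; fin_cases i <;> simp [h1, h2, h3]⟩
    · exfalso
      have h0 := congrArg (fun p : ℍ[ℝ] => p.re) h
      simp [toQuat] at h0
      have h1 : (0 : ℤ) = 1 + 2 * a := by
        have : (0 : ℝ) = 1 + 2 * a := by linarith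
        exact_mod_cast this
      omega
  · rintro ⟨a, b, c, rfl⟩
    exact Or.inl ⟨0, a, b, c, by ext <;> simp [toQuat]⟩

theorem mem_cubicLattice {v : Space 3} : v ∈ cubicLattice ↔ toQuat v ∈ hurwitzRing :=
  toQuat_mem_hurwitzRing.symm

theorem mem_fccLattice {v : Space 3} :
    v ∈ fccLattice ↔ toQuat v ∈ hurwitzRing ∧ ∃ k : ℤ, ‖v‖ ^ 2 = 2 * k := by
  rw [toQuat_mem_hurwitzRing]
  have hn : ∀ a b c : ℤ, ‖(!₂[(a : ℝ), (b : ℝ), (c : ℝ)] : Space 3)‖ ^ 2 =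
      ((a ^ 2 + b ^ 2 + c ^ 2 : ℤ) : ℝ) := fun a b c => by
    simp [EuclideanSpace.norm_sq_eq, Fin.sum_univ_three]
  have he : ∀ a b c : ℤ, Even (a + b + c) ↔ Even (a ^ 2 + b ^ 2 + c ^ 2) := fun a b c => by
    simp [parity_simps]
  refine (mem_fccSet v).trans ⟨?_, ?_⟩
  · rintro ⟨a, b, c, h, rfl⟩
    refine ⟨⟨a, b, c, rfl⟩, ?_⟩
    obtain ⟨k, hk⟩ := (he a b c).1 h
    exact ⟨k, by rw [hn, hk]; push_cast; ring⟩
  · rintro ⟨⟨a, b, c, rfl⟩, k, hk⟩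
    rw [hn] at hk
    exact ⟨a, b, c, (he a b c).2 ⟨k, by rw [← two_mul]; exact_mod_cast hk⟩, rfl⟩

theorem isQuatLattice_cubicLattice : IsQuatLattice cubicLattice where
  mem_hurwitz h := mem_cubicLattice.1 h
  two_smul_mem h := by
    rw [mem_cubicLattice, toQuat_smul, two_smul]
    exact add_mem h h
  of_norm_eq _ h _ := mem_cubicLattice.2 h

theorem isQuatLattice_fccLattice : IsQuatLattice fccLattice where
  mem_hurwitz h := (mem_fccLattice.1 h).1
  two_smul_mem {v} h := by
    rw [mem_fccLattice, toQuat_smul, two_smul, norm_smul]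
    refine ⟨add_mem h h, ?_⟩
    obtain ⟨a, b, c, rfl⟩ := toQuat_mem_hurwitzRing.1 h
    refine ⟨2 * (a ^ 2 + b ^ 2 + c ^ 2), ?_⟩
    rw [mul_pow]
    simp [EuclideanSpace.norm_sq_eq, Fin.sum_univ_three]
    ring
  of_norm_eq h hw hn := by
    rw [mem_fccLattice, hn]
    exact ⟨hw, (mem_fccLattice.1 h).2⟩

theorem two_smul_cubic_mem {Λ : AddSubgroup (Space 3)} (hΛ : IsQuatLattice Λ) {v : Space 3}
    (hv : v ∈ cubicLattice) : (2 : ℝ) • v ∈ Λ :=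
  hΛ.two_smul_mem (mem_cubicLattice.1 hv)

namespace Hurwitz

theorem coe_ne_zero {q : hurwitzRing} (hq : q ≠ 0) : (q : ℍ[ℝ]) ≠ 0 :=
  fun h => hq (Subtype.ext h)

/-- The rotation `x ↦ q x q⁻¹` given by a Hurwitz quaternion. -/
def rot (q : hurwitzRing) (hq : q ≠ 0) : Orth 3 := quatRotation q (coe_ne_zero hq)

variable {Λ : AddSubgroup (Space 3)}

theorem coe_inv_eq (q : hurwitzRing) :
    (q : ℍ[ℝ])⁻¹ = ((nrm q : ℝ)⁻¹) • star (q : ℍ[ℝ]) := by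
  rw [Quaternion.inv_def, normSq_coe]

theorem toQuat_rot (q : hurwitzRing) (hq : q ≠ 0) (v : Space 3) :
    toQuat (rot q hq v) = q * toQuat v * (q : ℍ[ℝ])⁻¹ := toQuat_quatRotation _ _ _

theorem toQuat_nrm_smul_rot (q : hurwitzRing) (hq : q ≠ 0) (v : Space 3) :
    toQuat ((nrm q : ℝ) • rot q hq v) = q * toQuat v * star (q : ℍ[ℝ]) := by
  rw [toQuat_smul, toQuat_rot, coe_inv_eq, mul_smul_comm, smul_smul, mul_inv_cancel₀, one_smul]
  exact_mod_cast fun h => hq (nrm_eq_zero.1 h)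

/-- |q|² R v = q v q̄ is integral and as long as |q|² v, so it lies in the lattice along with it. -/
theorem nrm_smul_rot_mem (hΛ : IsQuatLattice Λ) (q : hurwitzRing) (hq : q ≠ 0) {v : Space 3}
    (hv : v ∈ Λ) (h2 : (nrm q : ℝ) • v ∈ Λ) : (nrm q : ℝ) • rot q hq v ∈ Λ := by
  refine hΛ.of_norm_eq h2 ?_ ?_
  · rw [toQuat_nrm_smul_rot]
    exact mul_mem (mul_mem q.2 (hΛ.mem_hurwitz hv)) (conj q).2
  · rw [norm_smul, norm_smul, LinearIsometryEquiv.norm_map]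

theorem natCast_smul_mem {v : Space 3} (hv : v ∈ Λ) (n : ℕ) : (n : ℝ) • v ∈ Λ := by
  rw [Nat.cast_smul_eq_nsmul]
  exact Λ.nsmul_mem hv n

/-- v is in the image iff q⁻¹ v q is in Λ. That vector is as long as v, so only its integrality
matters, which is the ideal condition and no longer depends on Λ. -/
theorem mem_imageLattice_rot (hΛ : IsQuatLattice Λ) {q : hurwitzRing} (hq : q ≠ 0) {v : Space 3}
    (hv : v ∈ Λ) : v ∈ imageLattice (rot q hq) Λ ↔
      ⟨toQuat v, hΛ.mem_hurwitz hv⟩ * q ∈ rightIdeal q := by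
  have hq' := coe_ne_zero hq
  rw [mem_imageLattice, mem_rightIdeal]
  have hs : toQuat ((rot q hq).symm v) = (q : ℍ[ℝ])⁻¹ * toQuat v * q :=
    toQuat_quatRotation_symm _ _ _
  constructor
  · intro h
    refine ⟨⟨_, hΛ.mem_hurwitz h⟩, Subtype.ext ?_⟩
    simp only [Subring.coe_mul, hs, ← mul_assoc]
    rw [mul_inv_cancel₀ hq', one_mul]
  · rintro ⟨y, hy⟩
    have hy' : toQuat v * q = q * (y : ℍ[ℝ]) := congrArg Subtype.val hy
    refine hΛ.of_norm_eq hv ?_ (LinearIsometryEquiv.norm_map _ _)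
    rw [hs, mul_assoc, hy', ← mul_assoc, inv_mul_cancel₀ hq', one_mul]
    exact y.2

/-- The vector `2 (x - x̄)` of `4ℤ³`. -/
theorem exists_vec (hΛ : IsQuatLattice Λ) (x : hurwitzRing) :
    ∃ v ∈ Λ, toQuat v = (2 * (x - conj x) : hurwitzRing) := by
  have h0 : ((x - conj x : hurwitzRing) : ℍ[ℝ]).re = 0 := by simp
  have h1 := toQuat_imVec _ h0
  refine ⟨(2 : ℝ) • imVec ((x - conj x : hurwitzRing) : ℍ[ℝ]), hΛ.two_smul_mem ?_, ?_⟩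
  · rw [h1]; exact (x - conj x).2
  · rw [toQuat_smul, h1, two_smul, two_mul]; rfl

/-- The CSL is the kernel of the idealizer homomorphism f restricted to Λ. The restriction is still
onto, because f takes the value 4 f(x) at 2(x - x̄) and the norm is odd. -/
theorem latticeIndex_rot (hΛ : IsQuatLattice Λ) {q : hurwitzRing} (hq : IsPrim q)
    (hn : Odd (nrm q)) : latticeIndex Λ (rot q hq.ne_zero) = nrm q := by
  obtain ⟨f, hf, hker, htr⟩ := exists_idealizer_hom hq hn
  let F : Λ →+ ZMod (nrm q) := f.comp
    ⟨⟨fun v => ⟨toQuat v, hΛ.mem_hurwitz v.2⟩, Subtype.ext toQuat_zero⟩,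
      fun v w => Subtype.ext (toQuat_add v w)⟩
  have hF : ∀ v : Λ, F v = f ⟨toQuat v, hΛ.mem_hurwitz v.2⟩ := fun _ => rfl
  have hFker : (csl Λ (rot q hq.ne_zero)).addSubgroupOf Λ = F.ker := by
    ext v
    rw [AddSubgroup.mem_addSubgroupOf, AddMonoidHom.mem_ker, hF, hker,
      ← mem_imageLattice_rot hΛ hq.ne_zero v.2, csl, AddSubgroup.mem_inf, and_iff_right v.2]
  have hsurj : Function.Surjective F := by
    intro c
    have h2 : IsUnit (2 : ZMod (nrm q)) := by
      have := (ZMod.isUnit_iff_coprime 2 (nrm q)).2 (Nat.coprime_two_left.2 hn)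
      simpa using this
    obtain ⟨d, rfl⟩ := h2.dvd (a := c)
    obtain ⟨e, rfl⟩ := h2.dvd (a := d)
    obtain ⟨x, rfl⟩ := hf e
    obtain ⟨v, hv, hvx⟩ := exists_vec hΛ x
    refine ⟨⟨v, hv⟩, ?_⟩
    rw [hF]
    have : (⟨toQuat v, hΛ.mem_hurwitz hv⟩ : hurwitzRing) = 2 * (x - conj x) := Subtype.ext hvx
    rw [this, two_mul, map_add, htr]
    ring
  rw [latticeIndex, AddSubgroup.relIndex, hFker, AddSubgroup.index_ker,
    AddMonoidHom.range_eq_top.2 hsurj, AddSubgroup.card_top, Nat.card_zmod]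

theorem rightIdeal_eq_of_csl_eq (hΛ : IsQuatLattice Λ) {p q : hurwitzRing} (hp : IsPrim p)
    (hq : IsPrim q) (hpn : Odd (nrm p)) (hqn : Odd (nrm q))
    (h : csl Λ (rot p hp.ne_zero) = csl Λ (rot q hq.ne_zero)) : rightIdeal p = rightIdeal q := by
  have hn : nrm p = nrm q := by
    rw [← latticeIndex_rot hΛ hp hpn, ← latticeIndex_rot hΛ hq hqn, latticeIndex, h, latticeIndex]
  refine rightIdeal_eq_of_idealizer hp hq hqn hn fun x => ?_
  obtain ⟨v, hv, hvx⟩ := exists_vec hΛ x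
  have hvx' : (⟨toQuat v, hΛ.mem_hurwitz hv⟩ : hurwitzRing) = 2 * (x - conj x) := Subtype.ext hvx
  rw [← hvx', ← mem_imageLattice_rot hΛ hp.ne_zero hv, ← mem_imageLattice_rot hΛ hq.ne_zero hv]
  have := SetLike.ext_iff.1 h v
  simpa only [csl, AddSubgroup.mem_inf, hv, true_and] using this

/-- Rotations by quaternions that normalize the Hurwitz ring preserve the lattice. -/
theorem imageLattice_rot_of_normalizes (hΛ : IsQuatLattice Λ) {q : hurwitzRing} (hq : q ≠ 0)
    (h1 : ∀ x : hurwitzRing, ∃ y, q * x = y * q) (h2 : ∀ x : hurwitzRing, ∃ y, x * q = q * y) :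
    imageLattice (rot q hq) Λ = Λ := by
  ext v
  constructor
  · intro hv
    rw [mem_imageLattice] at hv
    obtain ⟨y, hy⟩ := h1 ⟨_, hΛ.mem_hurwitz hv⟩
    refine hΛ.of_norm_eq hv ?_ (LinearIsometryEquiv.norm_map _ _).symm
    have hy' : (q : ℍ[ℝ]) * toQuat ((rot q hq).symm v) = y * q := congrArg Subtype.val hy
    have h3 := toQuat_rot q hq ((rot q hq).symm v)
    rw [LinearIsometryEquiv.apply_symm_apply, hy', mul_assoc, mul_inv_cancel₀ (coe_ne_zero hq),
      mul_one] at h3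
    rw [h3]
    exact y.2
  · intro hv
    rw [mem_imageLattice_rot hΛ hq hv, mem_rightIdeal]
    exact h2 _

theorem imageLattice_rot_unit (hΛ : IsQuatLattice Λ) {u : hurwitzRing} (hu : nrm u = 1)
    (hu0 : u ≠ 0) : imageLattice (rot u hu0) Λ = Λ := by
  refine imageLattice_rot_of_normalizes hΛ hu0 (fun x => ⟨u * x * conj u, ?_⟩)
    fun x => ⟨conj u * x * u, ?_⟩
  · rw [mul_assoc, conj_mul_self, hu, Nat.cast_one, mul_one]
  · rw [← mul_assoc, ← mul_assoc, mul_conj, hu, Nat.cast_one, one_mul]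

/-- Although not a unit, 1 + i generates a two-sided ideal and so normalizes `𝕁`. -/
theorem imageLattice_rot_onePlusI (hΛ : IsQuatLattice Λ) :
    imageLattice (rot onePlusI onePlusI_ne_zero) Λ = Λ := by
  refine imageLattice_rot_of_normalizes hΛ _ (fun x => ?_) fun x => ?_
  · exact exists_mul_onePlusI (by rw [nrm_mul, nrm_onePlusI]; exact even_two_mul _)
  · exact exists_onePlusI_mul (by rw [nrm_mul, nrm_onePlusI, mul_comm]; exact even_two_mul _)

theorem rot_mul (p q : hurwitzRing) (hp : p ≠ 0) (hq : q ≠ 0) (v : Space 3) :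
    rot (p * q) (mul_ne_zero hp hq) v = rot p hp (rot q hq v) :=
  quatRotation_mul _ _ _ _ v

theorem imageLattice_rot_mul {p q : hurwitzRing} (hp : p ≠ 0) (hq : q ≠ 0) :
    imageLattice (rot (p * q) (mul_ne_zero hp hq)) Λ =
      imageLattice (rot p hp) (imageLattice (rot q hq) Λ) := by
  ext v
  rw [mem_imageLattice, mem_imageLattice, mem_imageLattice]
  have : (rot (p * q) (mul_ne_zero hp hq)).symm v = (rot q hq).symm ((rot p hp).symm v) := by
    rw [LinearIsometryEquiv.symm_apply_eq, rot_mul p q hp hq, LinearIsometryEquiv.apply_symm_apply,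
      LinearIsometryEquiv.apply_symm_apply]
  rw [this]

end Hurwitz

theorem imageLattice_neg_trans {R : Orth 3} {Λ : AddSubgroup (Space 3)} :
    imageLattice (R.trans (LinearIsometryEquiv.neg ℝ)) Λ = imageLattice R Λ := by
  ext v
  rw [mem_imageLattice, mem_imageLattice]
  have : (R.trans (LinearIsometryEquiv.neg ℝ)).symm v = -R.symm v := by
    rw [LinearIsometryEquiv.symm_apply_eq]
    simp
  rw [this, neg_mem_iff]

end

noncomputable section

attribute [local simp] quat_re quat_imI quat_imJ quat_imK

/-! ### Coincidence sets of the diamond packing -/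

theorem toQuat_diamondShift : toQuat diamondShift = quat 0 (1 / 2) (1 / 2) (1 / 2) := by
  ext <;> simp [toQuat, diamondShift]

/-- The class of x modulo `Γ` has order 4, since 2x = (1,1,1) has odd coordinate sum. All separation
of cosets below rests on this. -/
theorem intCast_smul_diamondShift_mem (k : ℤ) :
    (k : ℝ) • diamondShift ∈ fccLattice ↔ (4 : ℤ) ∣ k := by
  refine (mem_fccSet _).trans ⟨?_, ?_⟩
  · rintro ⟨a, b, c, h, hv⟩
    have h0 := congrFun (congrArg WithLp.ofLp hv) 0
    have h1 := congrFun (congrArg WithLp.ofLp hv) 1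
    have h2 := congrFun (congrArg WithLp.ofLp hv) 2
    simp [diamondShift] at h0 h1 h2
    have e0 : k = 2 * a := by
      have : (k : ℝ) = 2 * a := by linarith
      exact_mod_cast this
    have e1 : k = 2 * b := by
      have : (k : ℝ) = 2 * b := by linarith
      exact_mod_cast this
    have e2 : k = 2 * c := by
      have : (k : ℝ) = 2 * c := by linarith
      exact_mod_cast this
    obtain ⟨m, hm⟩ := h
    omega
  · rintro ⟨m, rfl⟩
    refine ⟨2 * m, 2 * m, 2 * m, by simp [parity_simps], ?_⟩
    ext i
    fin_cases i <;> simp [diamondShift] <;> ring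

theorem mem_diamond {v : Space 3} :
    v ∈ diamond ↔ v ∈ fccLattice ∨ v - diamondShift ∈ fccLattice := by
  rw [diamond_eq, Set.mem_union, Set.mem_vadd_set_iff_neg_vadd_mem, vadd_eq_add, neg_add_eq_sub]
  rfl

theorem mem_image_diamond {R : Orth 3} {v : Space 3} :
    v ∈ R '' diamond ↔ v ∈ imageLattice R fccLattice ∨
      v - R diamondShift ∈ imageLattice R fccLattice := by
  rw [mem_imageLattice, mem_imageLattice, map_sub, LinearIsometryEquiv.symm_apply_apply,
    ← mem_diamond]
  constructor
  · rintro ⟨w, hw, rfl⟩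
    rwa [LinearIsometryEquiv.symm_apply_apply]
  · intro h
    exact ⟨_, h, R.apply_symm_apply v⟩

namespace Hurwitz

/-- `q x q̄ - |q|² x` is an f.c.c. lattice vector for `x = ½(1,1,1)`. -/
theorem nrm_smul_rot_diamondShift_sub_mem (q : hurwitzRing) (hq : q ≠ 0) :
    (nrm q : ℝ) • rot q hq diamondShift - (nrm q : ℝ) • diamondShift ∈ fccLattice := by
  obtain ⟨t, b, c, d, rfl⟩ := exists_ofCoords q
  set q := ofCoords t b c d with hqd
  -- P is the commutator q x - x q, and P q̄ = |q|²(Rx - x). The components of P sum to zero, so its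
  -- norm is even.
  let P := ofCoords 0 (c - d) (d - b) (b - c)
  have hP : (q : ℍ[ℝ]) * toQuat diamondShift - toQuat diamondShift * q = P := by
    rw [toQuat_diamondShift]
    ext <;> simp [P, hqd, coe_ofCoords] <;> ring
  have hPe : Even (nrm P) := by
    rw [← Int.even_coe_nat, nrm_ofCoords]
    simp [parity_simps]
    tauto
  have heq : toQuat ((nrm q : ℝ) • rot q hq diamondShift - (nrm q : ℝ) • diamondShift) =
      (P * conj q : hurwitzRing) := by
    rw [toQuat_sub, toQuat_nrm_smul_rot, toQuat_smul, Subring.coe_mul, ← hP, sub_mul, coe_conj,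
      mul_assoc (toQuat diamondShift), Quaternion.self_mul_star, normSq_coe]
    congr 1
    rw [Algebra.smul_def]
    exact Quaternion.coe_commutes _ _
  rw [mem_fccLattice, ← normSq_toQuat, heq, normSq_coe, nrm_mul]
  refine ⟨(P * conj q).2, ?_⟩
  obtain ⟨k, hk⟩ := hPe
  exact ⟨k * nrm (conj q), by rw [hk]; push_cast; ring⟩

end Hurwitz

section

open Hurwitz

variable {q : hurwitzRing} (hq : q ≠ 0)

theorem nrm_smul_mem_of_mem_imageLattice {v : Space 3}
    (hv : v ∈ imageLattice (rot q hq) fccLattice) : (nrm q : ℝ) • v ∈ fccLattice := by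
  rw [mem_imageLattice] at hv
  have := nrm_smul_rot_mem isQuatLattice_fccLattice q hq hv (natCast_smul_mem hv _)
  rwa [LinearIsometryEquiv.apply_symm_apply] at this

theorem natCast_smul_diamondShift_mem (k : ℕ) :
    (k : ℝ) • diamondShift ∈ fccLattice ↔ 4 ∣ k := by
  have := intCast_smul_diamondShift_mem k
  rw [Int.cast_natCast] at this
  rw [this]
  exact_mod_cast Iff.rfl

/-- Multiplication by the odd norm n carries `RΓ` into `Γ`, so a common point would force n x ∈ `Γ`,
against the order 4 of x. The next lemma uses in addition n Rx ≡ n x. -/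
theorem not_mem_imageLattice_of_sub_mem (hn : Odd (nrm q)) {v : Space 3}
    (hv : v - diamondShift ∈ fccLattice) : v ∉ imageLattice (rot q hq) fccLattice := by
  intro h
  have h1 := nrm_smul_mem_of_mem_imageLattice hq h
  have h2 := natCast_smul_mem hv (nrm q)
  have h3 := fccLattice.sub_mem h1 h2
  rw [smul_sub, sub_sub_cancel, natCast_smul_diamondShift_mem] at h3
  have := hn.not_two_dvd_nat
  omega

theorem sub_not_mem_imageLattice_of_mem (hn : Odd (nrm q)) {v : Space 3}
    (hv : v ∈ fccLattice) :
    v - rot q hq diamondShift ∉ imageLattice (rot q hq) fccLattice := by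
  intro h
  have h1 := nrm_smul_mem_of_mem_imageLattice hq h
  have h2 := natCast_smul_mem hv (nrm q)
  have h3 := fccLattice.sub_mem (fccLattice.sub_mem h2 h1)
    (nrm_smul_rot_diamondShift_sub_mem q hq)
  rw [smul_sub, sub_sub_cancel, sub_sub_cancel, natCast_smul_diamondShift_mem] at h3
  have := hn.not_two_dvd_nat
  omega

/-- With the opposite shift the same argument gives 2n x ∈ `Γ`, still excluded since x has order 4
and not 2. -/
theorem add_not_mem_imageLattice_of_sub_mem (hn : Odd (nrm q)) {v : Space 3}
    (hv : v - diamondShift ∈ fccLattice) :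
    v + rot q hq diamondShift ∉ imageLattice (rot q hq) fccLattice := by
  intro h
  have h1 := nrm_smul_mem_of_mem_imageLattice hq h
  have h2 := natCast_smul_mem hv (nrm q)
  have h3 := fccLattice.sub_mem (fccLattice.sub_mem h1 h2)
    (nrm_smul_rot_diamondShift_sub_mem q hq)
  have h4 : ((2 * nrm q : ℕ) : ℝ) • diamondShift ∈ fccLattice := by
    convert h3 using 1
    push_cast
    module
  rw [natCast_smul_diamondShift_mem] at h4
  have := hn.not_two_dvd_nat
  omega

/-- Since n² ≡ 1 mod 4, the point n² Rx is congruent to n² x ≡ x modulo `Γ` and to Rx modulo `RΓ`.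
-/
theorem exists_common_shift (hn : Odd (nrm q)) :
    ∃ y, y - diamondShift ∈ fccLattice ∧
      y - rot q hq diamondShift ∈ imageLattice (rot q hq) fccLattice := by
  have h4 : (4 : ℤ) ∣ (nrm q : ℤ) ^ 2 - 1 := by
    obtain ⟨k, hk⟩ := hn
    exact ⟨k ^ 2 + k, by rw [hk]; push_cast; ring⟩
  have h5 := (intCast_smul_diamondShift_mem _).2 h4
  push_cast at h5
  refine ⟨((nrm q : ℝ) ^ 2) • rot q hq diamondShift, ?_, ?_⟩
  · have h1 := natCast_smul_mem (nrm_smul_rot_diamondShift_sub_mem q hq) (nrm q)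
    convert fccLattice.add_mem h1 h5 using 1
    module
  · have h1 := (apply_mem_imageLattice (R := rot q hq)).2 h5
    rw [map_smul] at h1
    convert h1 using 1
    module

variable {R : Orth 3}

theorem sub_mem_imageLattice_iff {x y v : Space 3} {Λ : AddSubgroup (Space 3)} (h : x - y ∈ Λ) :
    v - x ∈ Λ ↔ v - y ∈ Λ := by
  have : v - y = (v - x) + (x - y) := by abel
  rw [this, AddSubgroup.add_mem_cancel_right _ h]

theorem mem_coincidenceSet_diamond (hR : imageLattice R fccLattice = imageLattice (rot q hq) fccLattice)
    {s : Space 3} (hs : R diamondShift - s ∈ imageLattice (rot q hq) fccLattice) {v : Space 3} :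
    v ∈ coincidenceSet diamond R ↔ (v ∈ fccLattice ∨ v - diamondShift ∈ fccLattice) ∧
      (v ∈ imageLattice (rot q hq) fccLattice ∨ v - s ∈ imageLattice (rot q hq) fccLattice) := by
  rw [coincidenceSet, Set.mem_inter_iff, mem_diamond, mem_image_diamond, hR,
    sub_mem_imageLattice_iff hs]

/-- Of the four coset intersections the two mixed ones are empty, and the two others are cosets of
the CSL, the second with representative y. -/
theorem coincidenceSet_diamond_double (hn : Odd (nrm q))
    (hR : imageLattice R fccLattice = imageLattice (rot q hq) fccLattice)
    (hs : R diamondShift - rot q hq diamondShift ∈ imageLattice (rot q hq) fccLattice)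
    {y : Space 3} (hy1 : y - diamondShift ∈ fccLattice)
    (hy2 : y - rot q hq diamondShift ∈ imageLattice (rot q hq) fccLattice) :
    coincidenceSet diamond R = (csl fccLattice R : Set (Space 3)) ∪
      (y +ᵥ (csl fccLattice R : Set (Space 3))) := by
  ext v
  rw [mem_coincidenceSet_diamond hq hR hs, Set.mem_union, Set.mem_vadd_set_iff_neg_vadd_mem,
    vadd_eq_add, neg_add_eq_sub, SetLike.mem_coe, SetLike.mem_coe, csl, hR, AddSubgroup.mem_inf,
    AddSubgroup.mem_inf, ← sub_mem_imageLattice_iff hy1, ← sub_mem_imageLattice_iff hy2]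
  constructor
  · rintro ⟨h1 | h1, h2 | h2⟩
    · exact Or.inl ⟨h1, h2⟩
    · rw [sub_mem_imageLattice_iff hy2] at h2
      exact absurd h2 (sub_not_mem_imageLattice_of_mem hq hn h1)
    · rw [sub_mem_imageLattice_iff hy1] at h1
      exact absurd h2 (not_mem_imageLattice_of_sub_mem hq hn h1)
    · exact Or.inr ⟨h1, h2⟩
  · rintro (⟨h1, h2⟩ | ⟨h1, h2⟩)
    · exact ⟨Or.inl h1, Or.inl h2⟩
    · exact ⟨Or.inr h1, Or.inr h2⟩

/-- Here the shift is carried to -`R_q` x, and all intersections except that of the two lattices are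
empty. -/
theorem coincidenceSet_diamond_single (hn : Odd (nrm q))
    (hR : imageLattice R fccLattice = imageLattice (rot q hq) fccLattice)
    (hs : R diamondShift + rot q hq diamondShift ∈ imageLattice (rot q hq) fccLattice) :
    coincidenceSet diamond R = (csl fccLattice R : Set (Space 3)) := by
  rw [← sub_neg_eq_add] at hs
  ext v
  rw [mem_coincidenceSet_diamond hq hR hs, sub_neg_eq_add, SetLike.mem_coe, csl, hR,
    AddSubgroup.mem_inf]
  constructor
  · rintro ⟨h1 | h1, h2 | h2⟩
    · exact ⟨h1, h2⟩
    · exfalso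
      have h3 := neg_mem h2
      have h4 := neg_mem h1
      rw [neg_add'] at h3
      exact sub_not_mem_imageLattice_of_mem hq hn h4 h3
    · exact absurd h2 (not_mem_imageLattice_of_sub_mem hq hn h1)
    · exact absurd h2 (add_not_mem_imageLattice_of_sub_mem hq hn h1)
  · rintro ⟨h1, h2⟩
    exact ⟨Or.inl h1, Or.inl h2⟩

theorem mem_shiftVectors {ℓ : Space 3} : ℓ ∈ shiftVectors R ↔ ℓ ∈ fccLattice ∧
    diamondShift + ℓ - R diamondShift ∈ imageLattice R fccLattice := by
  rw [shiftVectors, Set.mem_inter_iff, Set.mem_vadd_set_iff_neg_vadd_mem, vadd_eq_add, and_comm,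
    SetLike.mem_coe, SetLike.mem_coe]
  have : -(R diamondShift - diamondShift) + ℓ = diamondShift + ℓ - R diamondShift := by abel
  rw [this]

end

end

noncomputable section

/-! ### Densities of unions of translates of lattices -/

section Density

theorem HasPointDensity.unique {d : ℕ} {A : Set (Space d)} {δ δ' : ℝ} (h : HasPointDensity A δ)
    (h' : HasPointDensity A δ') : δ = δ' :=
  tendsto_nhds_unique h.2 h'.2

theorem HasCoincidenceIndex.unique {d : ℕ} {L : Set (Space d)} {R : Orth d} {σ τ : ℝ}
    (h : HasCoincidenceIndex L R σ) (h' : HasCoincidenceIndex L R τ) : σ = τ := by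
  obtain ⟨δ, δ', -, -, h1, h2, rfl⟩ := h
  obtain ⟨ε, ε', -, -, h3, h4, rfl⟩ := h'
  rw [h1.unique h3, h2.unique h4]

theorem HasPointDensity.union {d : ℕ} {A B : Set (Space d)} {δ δ' : ℝ} (hA : HasPointDensity A δ)
    (hB : HasPointDensity B δ') (h : Disjoint A B) : HasPointDensity (A ∪ B) (δ + δ') := by
  refine ⟨fun r => ?_, ?_⟩
  · rw [Set.union_inter_distrib_right]
    exact (hA.1 r).union (hB.1 r)
  · refine (hA.2.add hB.2).congr fun r => ?_
    rw [Set.union_inter_distrib_right, Set.ncard_union_eq _ (hA.1 r) (hB.1 r)]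
    · push_cast
      ring
    · exact h.mono Set.inter_subset_left Set.inter_subset_left

theorem volume_closedBall_toReal {r : ℝ} (hr : 0 ≤ r) :
    (volume (Metric.closedBall (0 : Space 3) r)).toReal =
      r ^ 3 * (volume (Metric.closedBall (0 : Space 3) 1)).toReal := by
  rw [Measure.addHaar_closedBall' _ _ hr, ENNReal.toReal_mul, ENNReal.toReal_ofReal (by positivity)]
  simp

theorem volume_closedBall_one_pos : 0 < (volume (Metric.closedBall (0 : Space 3) 1)).toReal :=
  ENNReal.toReal_pos (Metric.measure_closedBall_pos _ _ one_pos).ne'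
    (measure_closedBall_lt_top).ne

/-- The translated count lies between the counts for radii r ± ‖y‖, and the volumes of these balls
have ratio tending to 1. -/
theorem HasPointDensity.vadd {A : Set (Space 3)} {δ : ℝ} (hA : HasPointDensity A δ)
    (y : Space 3) : HasPointDensity (y +ᵥ A) δ := by
  have hsub : ∀ r, (y +ᵥ A) ∩ Metric.closedBall 0 r ⊆
      y +ᵥ (A ∩ Metric.closedBall 0 (r + ‖y‖)) := by
    rintro r _ ⟨⟨a, ha, rfl⟩, h⟩
    refine ⟨a, ⟨ha, ?_⟩, rfl⟩
    rw [mem_closedBall_zero_iff] at h ⊢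
    have := norm_sub_le (y +ᵥ a) y
    rw [vadd_eq_add, add_sub_cancel_left] at this
    simp only [vadd_eq_add] at h
    linarith
  have hsup : ∀ r, y +ᵥ (A ∩ Metric.closedBall 0 (r - ‖y‖)) ⊆
      (y +ᵥ A) ∩ Metric.closedBall 0 r := by
    rintro r _ ⟨a, ⟨ha, h⟩, rfl⟩
    refine ⟨⟨a, ha, rfl⟩, ?_⟩
    rw [mem_closedBall_zero_iff] at h ⊢
    have := norm_add_le y a
    simp only [vadd_eq_add]
    linarith
  have hfin : ∀ r, ((y +ᵥ A) ∩ Metric.closedBall 0 r).Finite := fun r =>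
    ((hA.1 _).vadd_set).subset (hsub r)
  have hratio : ∀ c : ℝ, Tendsto (fun r : ℝ => ((A ∩ Metric.closedBall 0 (r + c)).ncard : ℝ) /
      (volume (Metric.closedBall (0 : Space 3) r)).toReal) atTop (𝓝 δ) := by
    intro c
    have h1 := hA.2.comp (tendsto_atTop_add_const_right atTop c tendsto_id)
    have h2 : Tendsto (fun r : ℝ => (1 + c / r) ^ 3) atTop (𝓝 ((1 + 0) ^ 3)) :=
      ((tendsto_const_nhds.div_atTop tendsto_id).const_add 1).pow 3
    have h3 := h1.mul h2
    rw [add_zero, one_pow, mul_one] at h3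
    refine h3.congr' ?_
    filter_upwards [eventually_gt_atTop 0, eventually_gt_atTop (-c)] with r hr hrc
    have hV := volume_closedBall_one_pos
    have hrc' : 0 < r + c := by linarith
    simp only [Function.comp_apply, id_eq]
    rw [volume_closedBall_toReal hr.le, volume_closedBall_toReal hrc'.le]
    field_simp
  refine ⟨hfin, tendsto_of_tendsto_of_tendsto_of_le_of_le (hratio (-‖y‖)) (hratio ‖y‖)
    (fun r => ?_) fun r => ?_⟩
  · refine div_le_div_of_nonneg_right ?_ ENNReal.toReal_nonneg
    have := Set.ncard_le_ncard (hsup r) (hfin r)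
    rw [Set.ncard_vadd_set, sub_eq_add_neg] at this
    exact Nat.cast_le.2 this
  · refine div_le_div_of_nonneg_right ?_ ENNReal.toReal_nonneg
    have := Set.ncard_le_ncard (hsub r) ((hA.1 _).vadd_set)
    rw [Set.ncard_vadd_set] at this
    exact Nat.cast_le.2 this

theorem hasPointDensity_of_isZLattice (L : Submodule ℤ (Space 3)) [DiscreteTopology L]
    [IsZLattice ℝ L] (hL : ∀ r : ℝ, ((L : Set (Space 3)) ∩ Metric.closedBall 0 r).Finite) :
    HasPointDensity (L : Set (Space 3)) (ZLattice.covolume L)⁻¹ := by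
  refine ⟨hL, ?_⟩
  have hset : ∀ r : ℝ, 0 ≤ r → {x ∈ (Set.univ : Set (Space 3)) | ‖x‖ ^ 3 ≤ r ^ 3} =
      Metric.closedBall 0 r := fun r hr => by
    ext x
    rw [mem_closedBall_zero_iff]
    simp [pow_le_pow_iff_left₀ (norm_nonneg x) hr]
  have h1 := hset 1 zero_le_one
  rw [one_pow] at h1
  -- The lattice point count concerns sublevel sets of a function homogeneous of degree 3. For ‖x‖³
  -- these are balls, and r is replaced by r³ below.
  have key := ZLattice.covolume.tendsto_card_le_div' L (X := Set.univ) (fun _ _ _ _ => trivial)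
    (F := fun x : Space 3 => ‖x‖ ^ 3) (fun x r hr => by
      rw [norm_smul, mul_pow, Real.norm_of_nonneg hr, finrank_euclideanSpace_fin])
    (by rw [h1]; exact Metric.isBounded_closedBall)
    (by rw [h1]; exact Metric.isClosed_closedBall.measurableSet)
    (by
      change volume (frontier {x ∈ (Set.univ : Set (Space 3)) | ‖x‖ ^ 3 ≤ 1}) = 0
      rw [h1, frontier_closedBall _ one_ne_zero]; exact Measure.addHaar_sphere _ _ _)
  rw [h1] at key
  have key2 := (key.comp (tendsto_pow_atTop (n := 3) (by norm_num))).div_const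
    (volume (Metric.closedBall (0 : Space 3) 1)).toReal
  have hV := volume_closedBall_one_pos
  rw [show volume.real (Metric.closedBall (0 : Space 3) 1) / ZLattice.covolume L volume /
    (volume (Metric.closedBall (0 : Space 3) 1)).toReal = (ZLattice.covolume L volume)⁻¹ by
      rw [measureReal_def]; field_simp] at key2
  refine key2.congr' ?_
  filter_upwards [eventually_ge_atTop 0] with r hr
  simp only [Function.comp_apply]
  rw [hset r hr, Set.inter_comm, volume_closedBall_toReal hr, div_div, Nat.card_coe_set_eq]

end Density

/-! ### Densities of sublattices of the f.c.c. lattice and indices in the packing. -/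

/-- The standard basis of `ℝ³`. -/
def stdBasis : Module.Basis (Fin 3) ℝ (Space 3) := (EuclideanSpace.basisFun (Fin 3) ℝ).toBasis

theorem cubicLattice_le_span :
    cubicLattice ≤ (Submodule.span ℤ (Set.range stdBasis)).toAddSubgroup := by
  rintro _ ⟨a, b, c, rfl⟩
  rw [Submodule.mem_toAddSubgroup, Module.Basis.mem_span_iff_repr_mem]
  intro i
  fin_cases i
  · exact ⟨a, by simp [stdBasis]⟩
  · exact ⟨b, by simp [stdBasis]⟩
  · exact ⟨c, by simp [stdBasis]⟩

theorem fccLattice_le_cubicLattice : fccLattice ≤ cubicLattice := fun _ h =>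
  mem_cubicLattice.2 (mem_fccLattice.1 h).1

theorem factorial_relIndex_smul_mem {Λ Γ : AddSubgroup (Space 3)} (h : Λ.relIndex Γ ≠ 0)
    {v : Space 3} (hv : v ∈ Γ) : ((Λ.relIndex Γ).factorial : ℝ) • v ∈ Λ := by
  rw [Nat.cast_smul_eq_nsmul]
  exact (AddSubgroup.nsmul_mem_of_relIndex_ne_zero_of_dvd h hv
    fun m hm hm' => Nat.dvd_factorial hm hm').1

section

variable {Λ : AddSubgroup (Space 3)}

theorem finite_inter_closedBall (hΛ : Λ ≤ fccLattice) (r : ℝ) :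
    ((Λ : Set (Space 3)) ∩ Metric.closedBall 0 r).Finite := by
  rw [Set.inter_comm]
  refine (ZSpan.setFinite_inter stdBasis (Metric.isBounded_closedBall (x := 0) (r := r))).subset
    (Set.inter_subset_inter_right _ ?_)
  exact fun v hv => cubicLattice_le_span (fccLattice_le_cubicLattice (hΛ hv))

theorem discreteTopology_of_le_fccLattice (hΛ : Λ ≤ fccLattice) :
    DiscreteTopology Λ.toIntSubmodule := by
  have : DiscreteTopology (Submodule.span ℤ (Set.range stdBasis) : Set (Space 3)) :=
    inferInstanceAs (DiscreteTopology (Submodule.span ℤ (Set.range stdBasis)))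
  exact DiscreteTopology.of_subset this
    (fun v hv => cubicLattice_le_span (fccLattice_le_cubicLattice (hΛ hv)))

theorem span_eq_top_of_relIndex_ne_zero (h : Λ.relIndex fccLattice ≠ 0) :
    Submodule.span ℝ (Λ : Set (Space 3)) = ⊤ := by
  rw [eq_top_iff, ← stdBasis.span_eq, Submodule.span_le]
  rintro _ ⟨i, rfl⟩
  have hi : stdBasis i ∈ cubicLattice := by
    fin_cases i
    · exact ⟨1, 0, 0, by ext j; fin_cases j <;> simp [stdBasis]⟩
    · exact ⟨0, 1, 0, by ext j; fin_cases j <;> simp [stdBasis]⟩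
    · exact ⟨0, 0, 1, by ext j; fin_cases j <;> simp [stdBasis]⟩
  have h1 := factorial_relIndex_smul_mem h (two_smul_cubic_mem isQuatLattice_fccLattice hi)
  have h2 := Submodule.smul_mem (Submodule.span ℝ (Λ : Set (Space 3)))
    (((Λ.relIndex fccLattice).factorial : ℝ) * 2)⁻¹ (Submodule.subset_span h1)
  rwa [smul_smul, smul_smul, mul_assoc, inv_mul_cancel₀, one_smul] at h2
  have := Nat.factorial_ne_zero (Λ.relIndex fccLattice)
  positivity

end

/-- The density of the f.c.c. lattice. -/
def fccDensity : ℝ := (ZLattice.covolume fccLattice.toIntSubmodule)⁻¹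

theorem fccDensity_pos : 0 < fccDensity := by
  have := discreteTopology_of_le_fccLattice le_rfl
  have : IsZLattice ℝ fccLattice.toIntSubmodule :=
    ⟨span_eq_top_of_relIndex_ne_zero (by simp)⟩
  exact inv_pos.2 (ZLattice.covolume_pos _ _)

/-- The density is the reciprocal covolume, and the covolume is multiplied by the index. -/
theorem hasPointDensity_of_relIndex {Λ : AddSubgroup (Space 3)} (hΛ : Λ ≤ fccLattice)
    (h : Λ.relIndex fccLattice ≠ 0) :
    HasPointDensity (Λ : Set (Space 3)) (fccDensity / Λ.relIndex fccLattice) := by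
  have := discreteTopology_of_le_fccLattice le_rfl
  have : IsZLattice ℝ fccLattice.toIntSubmodule :=
    ⟨span_eq_top_of_relIndex_ne_zero (by simp)⟩
  have := discreteTopology_of_le_fccLattice hΛ
  have : IsZLattice ℝ Λ.toIntSubmodule := ⟨span_eq_top_of_relIndex_ne_zero h⟩
  have h1 := hasPointDensity_of_isZLattice Λ.toIntSubmodule (finite_inter_closedBall hΛ)
  have h2 := ZLattice.covolume_div_covolume_eq_relIndex' Λ.toIntSubmodule
    fccLattice.toIntSubmodule hΛ
  rw [AddSubgroup.toIntSubmodule_toAddSubgroup, AddSubgroup.toIntSubmodule_toAddSubgroup] at h2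
  rw [← h2, fccDensity]
  have h3 := ZLattice.covolume_pos fccLattice.toIntSubmodule volume
  have h4 := ZLattice.covolume_pos Λ.toIntSubmodule volume
  rwa [div_div_eq_mul_div, inv_mul_cancel₀ h3.ne', one_div]

theorem diamondShift_not_mem : diamondShift ∉ fccLattice := by
  have := intCast_smul_diamondShift_mem 1
  rw [Int.cast_one, one_smul] at this
  rw [this]
  norm_num

theorem disjoint_vadd {A B : AddSubgroup (Space 3)} (hA : A ≤ fccLattice) (hB : B ≤ fccLattice)
    {y : Space 3} (hy : y - diamondShift ∈ fccLattice) :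
    Disjoint (A : Set (Space 3)) (y +ᵥ (B : Set (Space 3))) := by
  rw [Set.disjoint_left]
  rintro _ hv ⟨b, hb, rfl⟩
  have h1 : y ∈ fccLattice := by
    have := fccLattice.sub_mem (hA hv) (hB hb)
    simpa using this
  have h2 := fccLattice.sub_mem h1 hy
  rw [sub_sub_cancel] at h2
  exact diamondShift_not_mem h2

theorem hasPointDensity_diamond : HasPointDensity diamond (2 * fccDensity) := by
  have h := hasPointDensity_of_relIndex le_rfl (by simp : fccLattice.relIndex fccLattice ≠ 0)
  rw [AddSubgroup.relIndex_self, Nat.cast_one, div_one] at h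
  rw [diamond_eq, two_mul]
  exact h.union (h.vadd _) (disjoint_vadd le_rfl le_rfl (by simp))

theorem hasCoincidenceIndex_single {R : Orth 3} (h0 : latticeIndex fccLattice R ≠ 0)
    (h : coincidenceSet diamond R = (csl fccLattice R : Set (Space 3))) :
    HasCoincidenceIndex diamond R (2 * (latticeIndex fccLattice R : ℝ)) := by
  have hpos := fccDensity_pos
  have h0' : (0 : ℝ) < latticeIndex fccLattice R := by exact_mod_cast Nat.pos_of_ne_zero h0
  refine ⟨2 * fccDensity, fccDensity / latticeIndex fccLattice R, by positivity, by positivity,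
    hasPointDensity_diamond, ?_, by field_simp⟩
  rw [h]
  exact hasPointDensity_of_relIndex inf_le_left h0

theorem hasCoincidenceIndex_double {R : Orth 3} (h0 : latticeIndex fccLattice R ≠ 0)
    {y : Space 3} (hy : y - diamondShift ∈ fccLattice)
    (h : coincidenceSet diamond R = (csl fccLattice R : Set (Space 3)) ∪
      (y +ᵥ (csl fccLattice R : Set (Space 3)))) :
    HasCoincidenceIndex diamond R (latticeIndex fccLattice R : ℝ) := by
  have hpos := fccDensity_pos
  have h0' : (0 : ℝ) < latticeIndex fccLattice R := by exact_mod_cast Nat.pos_of_ne_zero h0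
  refine ⟨2 * fccDensity, fccDensity / latticeIndex fccLattice R +
    fccDensity / latticeIndex fccLattice R, by positivity, by positivity,
    hasPointDensity_diamond, ?_, by field_simp; ring⟩
  have h1 := hasPointDensity_of_relIndex inf_le_left h0
  rw [h]
  exact h1.union (h1.vadd y) (disjoint_vadd inf_le_left inf_le_left hy)

end

noncomputable section

attribute [local simp] quat_re quat_imI quat_imJ quat_imK

/-! ### Rational orthogonal transformations are given by primitive quaternions -/

theorem toQuat_mul_self (v : Space 3) : toQuat v * toQuat v = ((-‖v‖ ^ 2 : ℝ) : ℍ[ℝ]) := by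
  have hs : star (toQuat v) = -toQuat v := by ext <;> simp [toQuat]
  rw [← normSq_toQuat, Quaternion.coe_neg, ← Quaternion.self_mul_star, hs, mul_neg, neg_neg]

theorem toQuat_stdBasis (i : Fin 3) :
    toQuat (stdBasis i) = ![quat 0 1 0 0, quat 0 0 1 0, quat 0 0 0 1] i := by
  fin_cases i <;> ext <;> simp [toQuat, stdBasis]

theorem eq_sum_stdBasis (v : Space 3) :
    v = v 0 • stdBasis 0 + v 1 • stdBasis 1 + v 2 • stdBasis 2 := by
  ext i; fin_cases i <;> simp [stdBasis]

theorem stdBasis_mem_cubicLattice (i : Fin 3) : stdBasis i ∈ cubicLattice := by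
  rw [mem_cubicLattice, toQuat_stdBasis]
  fin_cases i
  · exact Or.inl ⟨0, 1, 0, 0, by simp⟩
  · exact Or.inl ⟨0, 0, 1, 0, by simp⟩
  · exact Or.inl ⟨0, 0, 0, 1, by simp⟩

theorem norm_stdBasis (i : Fin 3) : ‖stdBasis i‖ = 1 := by simp [stdBasis]

theorem norm_stdBasis_add_sq {i j : Fin 3} (h : i ≠ j) : ‖stdBasis i + stdBasis j‖ ^ 2 = 2 := by
  rw [norm_add_sq_real, norm_stdBasis, norm_stdBasis]
  have : inner ℝ (stdBasis i) (stdBasis j) = 0 := by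
    simpa [stdBasis, EuclideanSpace.inner_single_left] using h
  rw [this]; norm_num

/-- The images of the basis vectors under an orthogonal transformation anticommute. -/
theorem toQuat_apply_mul_anticomm (R : Orth 3) {i j : Fin 3} (h : i ≠ j) :
    toQuat (R (stdBasis i)) * toQuat (R (stdBasis j)) =
      -(toQuat (R (stdBasis j)) * toQuat (R (stdBasis i))) := by
  -- Polarization of v² = -‖v‖² at the sum of two orthonormal vectors.
  have h1 := toQuat_mul_self (R (stdBasis i + stdBasis j))
  rw [LinearIsometryEquiv.norm_map, norm_stdBasis_add_sq h, map_add, toQuat_add, add_mul, mul_add,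
    mul_add, toQuat_mul_self, toQuat_mul_self, LinearIsometryEquiv.norm_map,
    LinearIsometryEquiv.norm_map, norm_stdBasis, norm_stdBasis] at h1
  have h2 : ((-2 : ℝ) : ℍ[ℝ]) = ((-1 ^ 2 : ℝ) : ℍ[ℝ]) + ((-1 ^ 2 : ℝ) : ℍ[ℝ]) := by
    rw [← Quaternion.coe_add]; norm_num
  rw [h2] at h1
  rw [eq_neg_iff_add_eq_zero]
  have h3 := sub_eq_zero.2 h1
  rw [← h3]
  abel

theorem toQuat_apply_mul_self (R : Orth 3) (i : Fin 3) :
    toQuat (R (stdBasis i)) * toQuat (R (stdBasis i)) = -1 := by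
  rw [toQuat_mul_self, LinearIsometryEquiv.norm_map, norm_stdBasis]
  norm_num

/-- With a, b, c the images of i, j, k, the product ab commutes with c and both square to -1, so (ab
- c)(ab + c) = 0 in a division ring. The sign is the orientation of R. -/
theorem toQuat_apply_mul_eq_or (R : Orth 3) :
    toQuat (R (stdBasis 0)) * toQuat (R (stdBasis 1)) = toQuat (R (stdBasis 2)) ∨
      toQuat (R (stdBasis 0)) * toQuat (R (stdBasis 1)) = -toQuat (R (stdBasis 2)) := by
  have h01 := toQuat_apply_mul_anticomm R (show (1 : Fin 3) ≠ 0 by decide)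
  have h02 := toQuat_apply_mul_anticomm R (show (2 : Fin 3) ≠ 0 by decide)
  have h12 := toQuat_apply_mul_anticomm R (show (2 : Fin 3) ≠ 1 by decide)
  have h0 := toQuat_apply_mul_self R 0
  have h1 := toQuat_apply_mul_self R 1
  have h2 := toQuat_apply_mul_self R 2
  generalize toQuat (R (stdBasis 0)) = a at *
  generalize toQuat (R (stdBasis 1)) = b at *
  generalize toQuat (R (stdBasis 2)) = c at *
  have h3 : (a * b) * (a * b) = -1 := by
    rw [mul_assoc, ← mul_assoc b, h01, neg_mul, mul_assoc a b b, h1, mul_neg, mul_neg,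
      mul_neg, mul_one, neg_neg, h0]
  have h4 : c * (a * b) = (a * b) * c := by
    rw [← mul_assoc, h02, neg_mul, mul_assoc, h12, mul_neg, neg_neg, mul_assoc]
  have h5 : (a * b - c) * (a * b + c) = 0 := by
    rw [mul_add, sub_mul, sub_mul, h3, h4, h2]
    abel
  rcases mul_eq_zero.1 h5 with h | h
  · exact Or.inl (sub_eq_zero.1 h)
  · exact Or.inr (eq_neg_of_add_eq_zero_left h)

/-- For anticommuting square roots `a, b, ab` of `-1`, the quaternion
`p - a p i - b p j - (ab) p k` intertwines `i, j, k` with `a, b, ab`. -/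
theorem intertwine {a b p i j : ℍ[ℝ]} (ha : a * a = -1) (hb : b * b = -1) (hab : b * a = -(a * b))
    (hi : i * i = -1) (hj : j * j = -1) (hij : j * i = -(i * j)) :
    a * (p - a * p * i - b * p * j - a * b * p * (i * j)) =
      (p - a * p * i - b * p * j - a * b * p * (i * j)) * i ∧
    b * (p - a * p * i - b * p * j - a * b * p * (i * j)) =
      (p - a * p * i - b * p * j - a * b * p * (i * j)) * j := by
  have a1 : ∀ x, a * (a * x) = -x := fun x => by rw [← mul_assoc, ha, neg_one_mul]
  have b1 : ∀ x, b * (b * x) = -x := fun x => by rw [← mul_assoc, hb, neg_one_mul]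
  have ab1 : ∀ x, b * (a * x) = -(a * (b * x)) := fun x => by
    rw [← mul_assoc, hab, neg_mul, mul_assoc]
  have i1 : ∀ x, i * (i * x) = -x := fun x => by rw [← mul_assoc, hi, neg_one_mul]
  constructor
  · simp only [mul_sub, sub_mul, mul_assoc, a1, i1, hi, hij, mul_neg, neg_neg, mul_one]
    abel
  · simp only [mul_sub, sub_mul, mul_assoc, b1, ab1, hj, mul_neg, neg_neg, mul_one]
    abel

/-- If F(p) denotes the expression, then F(1) - F(i)i - F(j)j - F(k)k = 4, so not all four values
vanish. -/
theorem exists_intertwine_ne_zero (a b : ℍ[ℝ]) : ∃ p ∈ ({1, quat 0 1 0 0, quat 0 0 1 0,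
    quat 0 0 0 1} : Set ℍ[ℝ]), p - a * p * quat 0 1 0 0 - b * p * quat 0 0 1 0 -
      a * b * p * (quat 0 1 0 0 * quat 0 0 1 0) ≠ 0 := by
  by_contra! h
  have h1 := h 1 (by simp)
  have h2 := congrArg (· * quat 0 1 0 0) (h (quat 0 1 0 0) (by simp))
  have h3 := congrArg (· * quat 0 0 1 0) (h (quat 0 0 1 0) (by simp))
  have h4 := congrArg (· * quat 0 0 0 1) (h (quat 0 0 0 1) (by simp))
  generalize a * b = c at *
  have e1 := congrArg (fun q : ℍ[ℝ] => q.re) h1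
  have e2 := congrArg (fun q : ℍ[ℝ] => q.re) h2
  have e3 := congrArg (fun q : ℍ[ℝ] => q.re) h3
  have e4 := congrArg (fun q : ℍ[ℝ] => q.re) h4
  simp at e1 e2 e3 e4
  linarith

/-- `R` maps `ℚ³` into itself. -/
def IsRational (R : Orth 3) : Prop :=
  ∃ N : ℕ, N ≠ 0 ∧ ∀ v ∈ cubicLattice, (N : ℝ) • R v ∈ cubicLattice

theorem IsRational.neg {R : Orth 3} (h : IsRational R) :
    IsRational (R.trans (LinearIsometryEquiv.neg ℝ)) := by
  obtain ⟨N, hN, h⟩ := h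
  refine ⟨N, hN, fun v hv => ?_⟩
  have := neg_mem (h v hv)
  simpa using this

theorem exists_isPrimitive_smul {q : ℍ[ℝ]} (hq : q ≠ 0) (h : q ∈ hurwitzRing) :
    ∃ (p : ℍ[ℤ]) (_ : IsPrimitive p) (c : ℝ), c ≠ 0 ∧ c • lipschitzToReal p = q := by
  obtain ⟨f, c, hc, hf⟩ : ∃ (f : Fin 4 → ℤ) (c : ℝ), c ≠ 0 ∧
      c • quat (f 0) (f 1) (f 2) (f 3) = q := by
    rcases h with ⟨x, y, z, w, rfl⟩ | ⟨x, y, z, w, rfl⟩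
    · exact ⟨![x, y, z, w], 1, one_ne_zero, by simp⟩
    · refine ⟨![1 + 2 * x, 1 + 2 * y, 1 + 2 * z, 1 + 2 * w], 1 / 2, by norm_num, ?_⟩
      ext <;> simp <;> ring
  obtain ⟨g, hg, hg1⟩ := Finset.extract_gcd f (s := Finset.univ) Finset.univ_nonempty
  set d := Finset.univ.gcd f
  refine ⟨⟨g 0, g 1, g 2, g 3⟩, ?_, c * d, ?_, ?_⟩
  · intro a h0 h1 h2 h3
    refine isUnit_of_dvd_one ?_
    rw [← hg1]
    refine Finset.dvd_gcd fun i _ => ?_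
    fin_cases i
    · exact h0
    · exact h1
    · exact h2
    · exact h3
  · refine mul_ne_zero hc fun h0 => hq ?_
    have hd : d = 0 := by exact_mod_cast h0
    rw [← hf, hg 0 (by simp), hg 1 (by simp), hg 2 (by simp), hg 3 (by simp), hd]
    ext <;> simp
  · rw [← hf, hg 0 (by simp), hg 1 (by simp), hg 2 (by simp), hg 3 (by simp)]
    ext <;> simp [lipschitzToReal] <;> ring

theorem eq_quatRotation {R : Orth 3} {q : ℍ[ℝ]} (hq : q ≠ 0)
    (h : ∀ i, toQuat (R (stdBasis i)) * q = q * toQuat (stdBasis i)) : R = quatRotation q hq := by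
  ext1 v
  apply toQuat_injective
  rw [toQuat_quatRotation, eq_mul_inv_iff_mul_eq₀ hq]
  conv_lhs => rw [eq_sum_stdBasis v]
  conv_rhs => rw [eq_sum_stdBasis v]
  simp only [map_add, map_smul, toQuat_add, toQuat_smul, add_mul, mul_add, smul_mul_assoc,
    mul_smul_comm, h]

/-- A nonzero intertwiner of (i, j, k) with its image represents R by conjugation. Rationality of R
makes a multiple of it integral, and scaling to a primitive quaternion leaves the rotation
unchanged. -/
theorem exists_eq_rotR_of_mul_eq {R : Orth 3} (hR : IsRational R)
    (h : toQuat (R (stdBasis 0)) * toQuat (R (stdBasis 1)) = toQuat (R (stdBasis 2))) :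
    ∃ (q : ℍ[ℤ]) (hq : IsPrimitive q), R = rotR q hq := by
  obtain ⟨p, hp, hne⟩ := exists_intertwine_ne_zero (toQuat (R (stdBasis 0)))
    (toQuat (R (stdBasis 1)))
  have hi : (quat 0 1 0 0) * (quat 0 1 0 0) = -1 := by ext <;> simp
  have hj : (quat 0 0 1 0) * (quat 0 0 1 0) = -1 := by ext <;> simp
  have hij : (quat 0 0 1 0) * (quat 0 1 0 0) = -(quat 0 1 0 0 * quat 0 0 1 0) := by
    ext <;> simp
  have hk : quat 0 1 0 0 * quat 0 0 1 0 = quat 0 0 0 1 := by ext <;> simp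
  have h12 := intertwine (p := p) (toQuat_apply_mul_self R 0) (toQuat_apply_mul_self R 1)
    (toQuat_apply_mul_anticomm R (show (1 : Fin 3) ≠ 0 by decide)) hi hj hij
  obtain ⟨N, hN, hNR⟩ := hR
  set q := p - toQuat (R (stdBasis 0)) * p * quat 0 1 0 0 - toQuat (R (stdBasis 1)) * p *
    quat 0 0 1 0 - toQuat (R (stdBasis 0)) * toQuat (R (stdBasis 1)) * p *
      (quat 0 1 0 0 * quat 0 0 1 0) with hqdef
  -- N clears the denominators of all three basis images; the product of the first two is the third,
  -- so one factor N suffices.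
  have hNq : (N : ℝ) • q ∈ hurwitzRing := by
    have hm : ∀ a b c d : ℤ, quat a b c d ∈ hurwitzRing := fun a b c d => Or.inl ⟨a, b, c, d, rfl⟩
    have hi' : quat 0 1 0 0 ∈ hurwitzRing := by simpa using hm 0 1 0 0
    have hj' : quat 0 0 1 0 ∈ hurwitzRing := by simpa using hm 0 0 1 0
    have hk' : quat 0 0 0 1 ∈ hurwitzRing := by simpa using hm 0 0 0 1
    have hp' : p ∈ hurwitzRing := by
      rcases hp with rfl | rfl | rfl | rfl
      · exact one_mem _
      · exact hi'
      · exact hj'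
      · exact hk'
    have hr : ∀ i, (N : ℝ) • toQuat (R (stdBasis i)) ∈ hurwitzRing := fun i => by
      rw [← toQuat_smul]
      exact mem_cubicLattice.1 (hNR _ (stdBasis_mem_cubicLattice i))
    rw [hqdef, h, smul_sub, smul_sub, smul_sub]
    simp only [← smul_mul_assoc]
    refine sub_mem (sub_mem (sub_mem ?_ (mul_mem (mul_mem (hr 0) hp') hi'))
      (mul_mem (mul_mem (hr 1) hp') hj')) (mul_mem (mul_mem (hr 2) hp') (mul_mem hi' hj'))
    rw [Nat.cast_smul_eq_nsmul]
    exact nsmul_mem hp' N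
  have hNq0 : (N : ℝ) • q ≠ 0 := smul_ne_zero (by exact_mod_cast hN) hne
  obtain ⟨p', hp', c, hc, hpc⟩ := exists_isPrimitive_smul hNq0 hNq
  refine ⟨p', hp', ?_⟩
  have hR : R = quatRotation q hne := by
    refine eq_quatRotation hne fun i => ?_
    rw [toQuat_stdBasis]
    fin_cases i
    · exact h12.1
    · exact h12.2
    · change toQuat (R (stdBasis 2)) * q = q * quat 0 0 0 1
      rw [← h, mul_assoc, h12.2, ← mul_assoc, h12.1, mul_assoc, hk]
  rw [hR, rotR, ← quatRotation_smul c hc (lipschitzToReal p'),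
    ← quatRotation_smul N (by exact_mod_cast hN) q]
  congr 1
  exact hpc.symm

theorem IsRational.exists_eq {R : Orth 3} (hR : IsRational R) :
    ∃ (q : ℍ[ℤ]) (hq : IsPrimitive q), R = rotR q hq ∨ R = rotT q hq := by
  rcases toQuat_apply_mul_eq_or R with h | h
  · obtain ⟨q, hq, h⟩ := exists_eq_rotR_of_mul_eq hR h
    exact ⟨q, hq, Or.inl h⟩
  · obtain ⟨q, hq, h⟩ := exists_eq_rotR_of_mul_eq hR.neg (by
      simp only [LinearIsometryEquiv.coe_trans, Function.comp_apply, LinearIsometryEquiv.coe_neg,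
        toQuat_neg, neg_mul_neg, h])
    refine ⟨q, hq, Or.inr ?_⟩
    rw [rotT, ← h]
    ext1 v
    simp

/-- A polynomial identity: the map v ↦ q v q̄ on ℝ³ has determinant |q|⁶. -/
theorem isRotation_quatRotation (q : ℍ[ℝ]) (hq : q ≠ 0) : IsRotation (quatRotation q hq) := by
  have hentry : ∀ i j, (quatRotation q hq (stdBasis j)) i =
      (Quaternion.normSq q)⁻¹ * (imVec (q * toQuat (stdBasis j) * star q)) i := fun i j => by
    have : quatRotation q hq (stdBasis j) =
        (Quaternion.normSq q)⁻¹ • imVec (q * toQuat (stdBasis j) * star q) := by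
      change imVec (q * toQuat (stdBasis j) * q⁻¹) = _
      rw [Quaternion.inv_def, mul_smul_comm]
      ext i; fin_cases i <;> simp [imVec]
    rw [this]; rfl
  have hN : Quaternion.normSq q ≠ 0 := by simpa using hq
  rw [IsRotation, ← LinearMap.det_toMatrix stdBasis, Matrix.det_fin_three]
  have hM : ∀ i j, LinearMap.toMatrix stdBasis stdBasis
      ((quatRotation q hq).toLinearEquiv : Space 3 →ₗ[ℝ] Space 3) i j =
      (Quaternion.normSq q)⁻¹ * (imVec (q * toQuat (stdBasis j) * star q)) i := fun i j => by
    rw [LinearMap.toMatrix_apply, ← hentry]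
    simp [stdBasis]
  simp only [hM, toQuat_stdBasis]
  field_simp
  simp [imVec]
  rw [Quaternion.normSq_def']
  ring

theorem isRotation_rotR (q : ℍ[ℤ]) (hq : IsPrimitive q) : IsRotation (rotR q hq) :=
  isRotation_quatRotation _ _

theorem not_isRotation_rotT (q : ℍ[ℤ]) (hq : IsPrimitive q) : ¬ IsRotation (rotT q hq) := by
  have h := isRotation_rotR q hq
  rw [IsRotation] at h ⊢
  have : ((rotT q hq).toLinearEquiv : Space 3 →ₗ[ℝ] Space 3) =
      (-1 : ℝ) • ((rotR q hq).toLinearEquiv : Space 3 →ₗ[ℝ] Space 3) := by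
    ext v i
    simp [rotT]
  rw [this, LinearMap.det_smul, h, finrank_euclideanSpace_fin]
  norm_num

end

noncomputable section

attribute [local simp] quat_re quat_imI quat_imJ quat_imK

/-! ### Coincidence isometries in terms of primitive Hurwitz quaternions of odd norm -/

open Hurwitz

/-- `R` maps the cubic lattices to the same lattices as the rotation by the Hurwitz quaternion `q`,
and the shift `x` to `ε q x q⁻¹` modulo the image of the f.c.c. lattice. -/
structure RepresentedBy (ε : ℝ) (R : Orth 3) (q : hurwitzRing) (hq : q ≠ 0) : Prop where
  imageLattice_eq : ∀ {Λ}, IsQuatLattice Λ → imageLattice R Λ = imageLattice (rot q hq) Λ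
  sub_mem : R diamondShift - ε • rot q hq diamondShift ∈ imageLattice (rot q hq) fccLattice

section

variable {R : Orth 3} {q : hurwitzRing} {hq : q ≠ 0} {ε : ℝ}

/-- Negation preserves every lattice but flips the shift; this is the whole difference between `R_q`
and `T_q`. -/
theorem RepresentedBy.neg (h : RepresentedBy ε R q hq) :
    RepresentedBy (-ε) (R.trans (LinearIsometryEquiv.neg ℝ)) q hq where
  imageLattice_eq hΛ := by rw [imageLattice_neg_trans, h.imageLattice_eq hΛ]
  sub_mem := by
    have := neg_mem h.sub_mem
    convert this using 1
    simp only [LinearIsometryEquiv.coe_trans, Function.comp_apply, LinearIsometryEquiv.coe_neg]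
    module

theorem RepresentedBy.rot (q : hurwitzRing) (hq : q ≠ 0) : RepresentedBy 1 (rot q hq) q hq where
  imageLattice_eq _ := rfl
  sub_mem := by
    rw [one_smul, sub_self]
    exact zero_mem _

theorem RepresentedBy.latticeIndex_eq (hq : IsPrim q) (hn : Odd (nrm q))
    (h : RepresentedBy ε R q hq.ne_zero) {Λ : AddSubgroup (Space 3)} (hΛ : IsQuatLattice Λ) :
    latticeIndex Λ R = nrm q := by
  rw [← latticeIndex_rot hΛ hq hn, latticeIndex, latticeIndex, csl, csl, h.imageLattice_eq hΛ]

theorem RepresentedBy.csl_eq (h : RepresentedBy ε R q hq) {Λ : AddSubgroup (Space 3)}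
    (hΛ : IsQuatLattice Λ) : csl Λ R = csl Λ (Hurwitz.rot q hq) := by
  rw [csl, csl, h.imageLattice_eq hΛ]

theorem RepresentedBy.coincidenceSet_eq (h : RepresentedBy 1 R q hq) :
    coincidenceSet diamond R = coincidenceSet diamond (Hurwitz.rot q hq) := by
  have h1 := h.sub_mem
  have h2 := (RepresentedBy.rot q hq).sub_mem
  rw [one_smul] at h1 h2
  ext v
  rw [mem_coincidenceSet_diamond hq (h.imageLattice_eq isQuatLattice_fccLattice) h1,
    mem_coincidenceSet_diamond hq rfl h2]

theorem RepresentedBy.hasSingleCSML (hq : IsPrim q) (hn : Odd (nrm q))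
    (h : RepresentedBy (-1) R q hq.ne_zero) : HasSingleCSML R (2 * nrm q) := by
  have h1 := h.latticeIndex_eq hq hn isQuatLattice_fccLattice
  have h2 := h.sub_mem
  rw [neg_one_smul, sub_neg_eq_add] at h2
  have h3 := coincidenceSet_diamond_single hq.ne_zero hn
    (h.imageLattice_eq isQuatLattice_fccLattice) h2
  exact ⟨h3, hasCoincidenceIndex_single (h1 ▸ hn.pos.ne') h3, by rw [h1]⟩

theorem RepresentedBy.hasDoubleCSML (hq : IsPrim q) (hn : Odd (nrm q))
    (h : RepresentedBy 1 R q hq.ne_zero) : HasDoubleCSML R (nrm q) := by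
  have h1 := h.latticeIndex_eq hq hn isQuatLattice_fccLattice
  have h2 := h.sub_mem
  have hR := h.imageLattice_eq isQuatLattice_fccLattice
  rw [one_smul] at h2
  have hmem : ∀ ℓ, ℓ ∈ shiftVectors R ↔ diamondShift + ℓ - diamondShift ∈ fccLattice ∧
      diamondShift + ℓ - Hurwitz.rot q hq.ne_zero diamondShift ∈
        imageLattice (Hurwitz.rot q hq.ne_zero) fccLattice := fun ℓ => by
    rw [mem_shiftVectors, add_sub_cancel_left, hR, sub_mem_imageLattice_iff h2]
  have hD : ∀ ℓ ∈ shiftVectors R, coincidenceSet diamond R =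
      (csl fccLattice R : Set (Space 3)) ∪
        ((diamondShift + ℓ) +ᵥ (csl fccLattice R : Set (Space 3))) := fun ℓ hℓ =>
    coincidenceSet_diamond_double hq.ne_zero hn hR h2 ((hmem ℓ).1 hℓ).1 ((hmem ℓ).1 hℓ).2
  obtain ⟨y, hy1, hy2⟩ := exists_common_shift hq.ne_zero hn
  have hne : y - diamondShift ∈ shiftVectors R := by
    rw [hmem, add_sub_cancel]
    exact ⟨hy1, hy2⟩
  refine ⟨⟨_, hne⟩, hD, hasCoincidenceIndex_double (h1 ▸ hn.pos.ne')
    (y := diamondShift + (y - diamondShift)) (by rwa [add_sub_cancel]) (hD _ hne), by rw [h1]⟩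

end

/-- A Lipschitz quaternion that is primitive is not divisible by an odd number in the Hurwitz
ring. -/
theorem IsPrimitive.eq_one_of_eq_natCast_mul {q : ℍ[ℤ]} (hq : IsPrimitive q) {c : ℕ} (hc : Odd c)
    {r : hurwitzRing} (h : lipschitzToReal q = (c * r : hurwitzRing)) : c = 1 := by
  have hcop : IsCoprime (c : ℤ) 2 := by
    rw [Int.isCoprime_iff_gcd_eq_one]
    exact Nat.coprime_two_right.2 hc
  -- Doubling clears the half-integers, and c, being odd, still divides the components of q
  -- afterwards.
  have hex : ∃ x y z w : ℤ, (2 : ℝ) • (r : ℍ[ℝ]) = quat x y z w := by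
    rcases r.2 with ⟨x, y, z, w, hr⟩ | ⟨x, y, z, w, hr⟩
    · exact ⟨2 * x, 2 * y, 2 * z, 2 * w, by rw [hr]; ext <;> simp⟩
    · exact ⟨1 + 2 * x, 1 + 2 * y, 1 + 2 * z, 1 + 2 * w, by
        rw [hr]; ext <;> simp <;> ring⟩
  obtain ⟨x, y, z, w, hr⟩ := hex
  have h2 : (2 : ℝ) • lipschitzToReal q = (c : ℝ) • quat x y z w := by
    rw [h, ← hr, smul_comm]
    congr 1
    rw [Subring.coe_mul, Nat.cast_smul_eq_nsmul, nsmul_eq_mul]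
    rfl
  have e0 := congrArg (fun p : ℍ[ℝ] => p.re) h2
  have e1 := congrArg (fun p : ℍ[ℝ] => p.imI) h2
  have e2 := congrArg (fun p : ℍ[ℝ] => p.imJ) h2
  have e3 := congrArg (fun p : ℍ[ℝ] => p.imK) h2
  simp [lipschitzToReal] at e0 e1 e2 e3
  have hu := hq c (hcop.dvd_of_dvd_mul_left ⟨x, by exact_mod_cast e0⟩)
    (hcop.dvd_of_dvd_mul_left ⟨y, by exact_mod_cast e1⟩)
    (hcop.dvd_of_dvd_mul_left ⟨z, by exact_mod_cast e2⟩)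
    (hcop.dvd_of_dvd_mul_left ⟨w, by exact_mod_cast e3⟩)
  simpa [Int.isUnit_iff] using hu

/-- A quaternion primitive over ℤ can be divisible by 2 in `𝕁`, as 1 + i + j + k is. Integer
divisors of a left factor of odd norm are odd, and those still divide the components of q. -/
theorem isPrim_of_lipschitzToReal_eq {q : ℍ[ℤ]} (hq : IsPrimitive q) {p s : hurwitzRing}
    (hp : Odd (nrm p))
    (h : lipschitzToReal q = (p * s : hurwitzRing)) : IsPrim p := by
  rintro c r rfl
  have hc : Odd c := by
    rw [nrm_mul, nrm_natCast, Nat.odd_mul] at hp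
    exact (Nat.odd_pow_iff two_ne_zero).1 hp.1
  rw [mul_assoc] at h
  exact hq.eq_one_of_eq_natCast_mul hc h

theorem lipschitzToReal_mem (q : ℍ[ℤ]) : lipschitzToReal q ∈ hurwitzRing :=
  Or.inl ⟨_, _, _, _, rfl⟩

theorem normSq_eq_sum_sq (q : ℍ[ℤ]) :
    Quaternion.normSq q = q.re ^ 2 + q.imI ^ 2 + q.imJ ^ 2 + q.imK ^ 2 := by
  rw [Quaternion.normSq_def]
  simp
  ring

theorem nrm_lipschitz {q : ℍ[ℤ]} {p : hurwitzRing} (h : lipschitzToReal q = p) :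
    (nrm p : ℤ) = Quaternion.normSq q := by
  have h1 : ((nrm p : ℤ) : ℝ) = (Quaternion.normSq q : ℤ) := by
    rw [Int.cast_natCast, ← normSq_coe, ← h, Quaternion.normSq_def', normSq_eq_sum_sq]
    simp [lipschitzToReal]
  exact_mod_cast h1

theorem representedBy_rotR_of_odd {q : ℍ[ℤ]} (hq : IsPrimitive q)
    (h : Odd (Quaternion.normSq q)) : ∃ (p : hurwitzRing) (hp : IsPrim p), Odd (nrm p) ∧
      (nrm p : ℤ) = Quaternion.normSq q ∧ RepresentedBy 1 (rotR q hq) p hp.ne_zero := by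
  let p : hurwitzRing := ⟨_, lipschitzToReal_mem q⟩
  have hn : (nrm p : ℤ) = Quaternion.normSq q := nrm_lipschitz rfl
  have hodd : Odd (nrm p) := by
    rw [← Int.odd_coe_nat, hn]
    exact h
  have hp : IsPrim p := isPrim_of_lipschitzToReal_eq hq (s := 1) hodd (by simp [p])
  exact ⟨p, hp, hodd, hn, RepresentedBy.rot p hp.ne_zero⟩

/-- The rotation is the quarter turn about the first axis and sends x to ½(1,-1,1), so it exchanges
the classes of x and -x modulo `Γ`. This is the source of the sign in the case |q|² ≡ 2 mod 4. -/
theorem rot_onePlusI_diamondShift_add_mem :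
    rot onePlusI onePlusI_ne_zero diamondShift + diamondShift ∈ fccLattice := by
  have : rot onePlusI onePlusI_ne_zero diamondShift + diamondShift = !₂[(1 : ℝ), 0, 1] := by
    apply toQuat_injective
    rw [toQuat_add, toQuat_rot, toQuat_diamondShift, coe_inv_eq, nrm_onePlusI, coe_onePlusI]
    ext <;> simp [toQuat] <;> norm_num
  rw [this]
  exact (mem_fccSet _).2 ⟨1, 0, 1, by decide, by simp⟩

/-- The even norm allows a factor 1 + i to be split off on the right, where its rotation acts first:
it preserves the lattices and negates the shift. -/
theorem representedBy_rotR_of_two_mod_four {q : ℍ[ℤ]} (hq : IsPrimitive q)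
    (h : Quaternion.normSq q ≡ 2 [ZMOD 4]) : ∃ (p : hurwitzRing) (hp : IsPrim p), Odd (nrm p) ∧
      2 * (nrm p : ℤ) = Quaternion.normSq q ∧
        RepresentedBy (-1) (rotR q hq) p hp.ne_zero := by
  let t : hurwitzRing := ⟨_, lipschitzToReal_mem q⟩
  have hn : (nrm t : ℤ) = Quaternion.normSq q := nrm_lipschitz rfl
  rw [Int.ModEq] at h
  obtain ⟨p, hp⟩ := exists_mul_onePlusI (q := t) (by rw [← Int.even_coe_nat, hn, Int.even_iff]; omega)
  have hn2 : nrm t = nrm p * 2 := by rw [hp, nrm_mul, nrm_onePlusI]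
  have hodd : Odd (nrm p) := by rw [Nat.odd_iff]; omega
  have hpp : IsPrim p := isPrim_of_lipschitzToReal_eq hq (s := onePlusI) hodd
    (congrArg Subtype.val hp)
  have hR : rotR q hq = rot (p * onePlusI) (mul_ne_zero hpp.ne_zero onePlusI_ne_zero) := by
    rw [rotR, rot]
    congr 1
    exact congrArg Subtype.val hp
  refine ⟨p, hpp, hodd, by omega, fun {Λ} hΛ => ?_, ?_⟩
  · rw [hR, imageLattice_rot_mul hpp.ne_zero onePlusI_ne_zero, imageLattice_rot_onePlusI hΛ]
  · rw [hR, rot_mul _ _ hpp.ne_zero onePlusI_ne_zero, neg_one_smul, sub_neg_eq_add, ← map_add,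
      apply_mem_imageLattice]
    exact rot_onePlusI_diamondShift_add_mem

/-- Squares are 0 or 1 modulo 4, so all four components have the same parity, and primitivity
excludes the even case. -/
theorem IsPrimitive.odd_of_four_dvd {q : ℍ[ℤ]} (hq : IsPrimitive q)
    (h : Quaternion.normSq q ≡ 0 [ZMOD 4]) :
    Odd q.re ∧ Odd q.imI ∧ Odd q.imJ ∧ Odd q.imK := by
  have h2 : ¬ (2 ∣ q.re ∧ 2 ∣ q.imI ∧ 2 ∣ q.imJ ∧ 2 ∣ q.imK) := fun ⟨h0, h1, h2, h3⟩ => by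
    have := hq 2 h0 h1 h2 h3
    rw [Int.isUnit_iff] at this
    omega
  rw [normSq_eq_sum_sq, Int.ModEq] at h
  have hsq : ∀ a : ℤ, (a % 2 = 0 ∧ a ^ 2 % 4 = 0) ∨ (a % 2 = 1 ∧ a ^ 2 % 4 = 1) := fun a => by
    rcases Int.even_or_odd' a with ⟨k, rfl | rfl⟩
    · exact Or.inl ⟨by omega, by ring_nf; omega⟩
    · exact Or.inr ⟨by omega, by ring_nf; omega⟩
  simp only [Int.odd_iff]
  have h0 := hsq q.re
  have h1 := hsq q.imI
  have h2 := hsq q.imJ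
  have h3 := hsq q.imK
  omega

/-- q is twice a Hurwitz quaternion p with half-integral components. Odd squares are 1 modulo 8, so
|q|² ≡ 4 mod 8 and |p|² is odd; the scalar 2 does not affect the rotation. -/
theorem representedBy_rotR_of_zero_mod_four {q : ℍ[ℤ]} (hq : IsPrimitive q)
    (h : Quaternion.normSq q ≡ 0 [ZMOD 4]) : ∃ (p : hurwitzRing) (hp : IsPrim p), Odd (nrm p) ∧
      4 * (nrm p : ℤ) = Quaternion.normSq q ∧ RepresentedBy 1 (rotR q hq) p hp.ne_zero := by
  obtain ⟨⟨a, ha⟩, ⟨b, hb⟩, ⟨c, hc⟩, ⟨d, hd⟩⟩ := hq.odd_of_four_dvd h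
  let p : hurwitzRing := ⟨quat (1 / 2 + a) (1 / 2 + b) (1 / 2 + c) (1 / 2 + d),
    Or.inr ⟨a, b, c, d, rfl⟩⟩
  have hqp : lipschitzToReal q = (p * (2 : ℕ) : hurwitzRing) := by
    rw [Nat.cast_ofNat, mul_two, Subring.coe_add]
    ext <;> simp [lipschitzToReal, p, ha, hb, hc, hd] <;> ring
  have hn : 4 * (nrm p : ℤ) = Quaternion.normSq q := by
    rw [← nrm_lipschitz hqp, nrm_mul, nrm_natCast]
    push_cast
    ring
  have hodd : Odd (nrm p) := by
    rw [normSq_eq_sum_sq, ha, hb, hc, hd] at hn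
    rw [← Int.odd_coe_nat]
    have he : ∀ a : ℤ, ∃ k, a * (a + 1) = 2 * k := fun a => (Int.even_mul_succ_self a).two_dvd
    obtain ⟨a', ha'⟩ := he a
    obtain ⟨b', hb'⟩ := he b
    obtain ⟨c', hc'⟩ := he c
    obtain ⟨d', hd'⟩ := he d
    exact ⟨a' + b' + c' + d', by linarith⟩
  have hp : IsPrim p := isPrim_of_lipschitzToReal_eq hq hodd hqp
  have hR : rotR q hq = rot p hp.ne_zero := by
    rw [rotR, rot, ← quatRotation_smul 2 two_ne_zero (p : ℍ[ℝ])]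
    congr 1
    rw [hqp, Nat.cast_ofNat, mul_two, two_smul]
    rfl
  exact ⟨p, hp, hodd, hn, hR ▸ RepresentedBy.rot p hp.ne_zero⟩

theorem exists_representedBy_rotR {q : ℍ[ℤ]} (hq : IsPrimitive q) :
    ∃ (p : hurwitzRing) (hp : IsPrim p), Odd (nrm p) ∧
      (RepresentedBy 1 (rotR q hq) p hp.ne_zero ∨ RepresentedBy (-1) (rotR q hq) p hp.ne_zero) := by
  have h : Odd (Quaternion.normSq q) ∨ Quaternion.normSq q ≡ 2 [ZMOD 4] ∨
      Quaternion.normSq q ≡ 0 [ZMOD 4] := by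
    rw [Int.odd_iff, Int.ModEq, Int.ModEq]
    omega
  rcases h with h | h | h
  · obtain ⟨p, hp, hn, -, hr⟩ := representedBy_rotR_of_odd hq h
    exact ⟨p, hp, hn, Or.inl hr⟩
  · obtain ⟨p, hp, hn, -, hr⟩ := representedBy_rotR_of_two_mod_four hq h
    exact ⟨p, hp, hn, Or.inr hr⟩
  · obtain ⟨p, hp, hn, -, hr⟩ := representedBy_rotR_of_zero_mod_four hq h
    exact ⟨p, hp, hn, Or.inl hr⟩

theorem exists_representedBy_rotT {q : ℍ[ℤ]} (hq : IsPrimitive q) :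
    ∃ (p : hurwitzRing) (hp : IsPrim p), Odd (nrm p) ∧
      (RepresentedBy 1 (rotT q hq) p hp.ne_zero ∨ RepresentedBy (-1) (rotT q hq) p hp.ne_zero) := by
  obtain ⟨p, hp, hn, h | h⟩ := exists_representedBy_rotR hq
  · exact ⟨p, hp, hn, Or.inr h.neg⟩
  · exact ⟨p, hp, hn, Or.inl (neg_neg (1 : ℝ) ▸ h.neg)⟩

end

noncomputable section

/-! ### The groups of coincidence isometries -/

open Hurwitz

theorem imageLattice_one (Λ : AddSubgroup (Space 3)) : imageLattice (1 : Orth 3) Λ = Λ := by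
  ext v
  rw [mem_imageLattice]
  rfl

theorem imageLattice_mul (R S : Orth 3) (Λ : AddSubgroup (Space 3)) :
    imageLattice (R * S) Λ = imageLattice R (imageLattice S Λ) := by
  ext v
  rw [mem_imageLattice, mem_imageLattice, mem_imageLattice]
  rfl

theorem relIndex_imageLattice (R : Orth 3) (A B : AddSubgroup (Space 3)) :
    (imageLattice R A).relIndex (imageLattice R B) = A.relIndex B :=
  AddSubgroup.relIndex_map_map_of_injective _ _ R.injective

theorem AddSubgroup.Commensurable.imageLattice {A B : AddSubgroup (Space 3)}
    (h : AddSubgroup.Commensurable A B) (R : Orth 3) :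
    AddSubgroup.Commensurable (imageLattice R A) (imageLattice R B) := by
  rw [AddSubgroup.Commensurable, relIndex_imageLattice, relIndex_imageLattice]
  exact h

/-- `OC(Γ)` as a subgroup of `O(3)`. -/
def latticeOCSubgroup (Λ : AddSubgroup (Space 3)) : Subgroup (Orth 3) where
  carrier := latticeOC Λ
  one_mem' := by
    change AddSubgroup.Commensurable _ _
    rw [imageLattice_one]
  mul_mem' {R S} hR hS := by
    change AddSubgroup.Commensurable _ _
    rw [imageLattice_mul]
    exact AddSubgroup.Commensurable.trans hR (AddSubgroup.Commensurable.imageLattice hS R)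
  inv_mem' {R} hR := by
    change AddSubgroup.Commensurable _ _
    have h := AddSubgroup.Commensurable.imageLattice hR R⁻¹
    rw [← imageLattice_mul, inv_mul_cancel, imageLattice_one] at h
    exact h.symm

theorem inv_mem_latticeOC {Λ : AddSubgroup (Space 3)} {R : Orth 3} (h : R ∈ latticeOC Λ) :
    R⁻¹ ∈ latticeOC Λ :=
  (latticeOCSubgroup Λ).inv_mem h

section

variable {Λ : AddSubgroup (Space 3)} {R : Orth 3}

theorem latticeIndex_eq : latticeIndex Λ R = (imageLattice R Λ).relIndex Λ :=
  AddSubgroup.inf_relIndex_left _ _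

theorem latticeIndex_ne_zero (h : R ∈ latticeOC Λ) : latticeIndex Λ R ≠ 0 := by
  rw [latticeIndex_eq]
  exact h.2

theorem isRational_of_mem_latticeOC (hΛ : IsQuatLattice Λ) (h : R ∈ latticeOC Λ) :
    IsRational R := by
  -- The factor 2 brings ℤ³ into Λ, and the factorial of the index brings the image of Λ back into
  -- Λ.
  refine ⟨(Λ.relIndex (imageLattice R Λ)).factorial * 2,
    mul_ne_zero (Nat.factorial_ne_zero _) two_ne_zero, fun v hv => ?_⟩
  have h1 := (apply_mem_imageLattice (R := R)).2 (two_smul_cubic_mem hΛ hv)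
  have h2 := factorial_relIndex_smul_mem h.1 h1
  rw [map_smul, smul_smul] at h2
  push_cast
  exact mem_cubicLattice.2 (hΛ.mem_hurwitz h2)

theorem Hurwitz.IsPrim.conj {q : hurwitzRing} (hq : IsPrim q) : IsPrim (conj q) := by
  intro c r h
  refine hq c (Hurwitz.conj r) ?_
  have h1 := congrArg Hurwitz.conj h
  rw [conj_mul, (Subtype.ext (star_star _) : Hurwitz.conj (Hurwitz.conj q) = q)] at h1
  have h2 : Hurwitz.conj (c : hurwitzRing) = c := Subtype.ext (by simp)
  rw [h1, h2, Nat.cast_comm]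

/-- One index is |q|². The other follows by applying the rotation to the result for q̄, since q q̄
is a scalar and its rotation is trivial. -/
theorem rot_mem_latticeOC (hΛ : IsQuatLattice Λ) {q : hurwitzRing} (hq : IsPrim q)
    (hn : Odd (nrm q)) : rot q hq.ne_zero ∈ latticeOC Λ := by
  have key : ∀ {p : hurwitzRing} (hp : IsPrim p), Odd (nrm p) →
      (imageLattice (rot p hp.ne_zero) Λ).relIndex Λ ≠ 0 := fun {p} hp hpn => by
    rw [← latticeIndex_eq, latticeIndex_rot hΛ hp hpn]
    exact hpn.pos.ne'
  refine ⟨?_, key hq hn⟩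
  have hc := key hq.conj (by rwa [nrm_conj])
  rw [← relIndex_imageLattice (rot q hq.ne_zero),
    ← imageLattice_rot_mul hq.ne_zero hq.conj.ne_zero,
    imageLattice_rot_of_normalizes hΛ] at hc
  · exact hc
  · intro x
    rw [mul_conj]
    exact ⟨x, (Nat.cast_comm _ _)⟩
  · intro x
    rw [mul_conj]
    exact ⟨x, (Nat.cast_comm _ _).symm⟩

theorem RepresentedBy.mem_latticeOC {ε : ℝ} {q : hurwitzRing} (hq : IsPrim q) (hn : Odd (nrm q))
    (h : RepresentedBy ε R q hq.ne_zero) (hΛ : IsQuatLattice Λ) : R ∈ latticeOC Λ := by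
  have := rot_mem_latticeOC hΛ hq hn
  rw [latticeOC, Set.mem_ofPred_eq] at this ⊢
  rwa [h.imageLattice_eq hΛ]

theorem rotR_mem_latticeOC (hΛ : IsQuatLattice Λ) {q : ℍ[ℤ]} (hq : IsPrimitive q) :
    rotR q hq ∈ latticeOC Λ := by
  obtain ⟨p, hp, hn, h | h⟩ := exists_representedBy_rotR hq
  · exact h.mem_latticeOC hp hn hΛ
  · exact h.mem_latticeOC hp hn hΛ

theorem rotT_mem_latticeOC (hΛ : IsQuatLattice Λ) {q : ℍ[ℤ]} (hq : IsPrimitive q) :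
    rotT q hq ∈ latticeOC Λ := by
  obtain ⟨p, hp, hn, h | h⟩ := exists_representedBy_rotT hq
  · exact h.mem_latticeOC hp hn hΛ
  · exact h.mem_latticeOC hp hn hΛ

theorem mem_latticeOC_iff_isRational (hΛ : IsQuatLattice Λ) : R ∈ latticeOC Λ ↔ IsRational R := by
  refine ⟨isRational_of_mem_latticeOC hΛ, fun h => ?_⟩
  obtain ⟨q, hq, rfl | rfl⟩ := h.exists_eq
  · exact rotR_mem_latticeOC hΛ hq
  · exact rotT_mem_latticeOC hΛ hq

theorem exists_representedBy_of_mem_latticeOC (hΛ : IsQuatLattice Λ) (h : R ∈ latticeOC Λ) :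
    ∃ (p : hurwitzRing) (hp : IsPrim p), Odd (nrm p) ∧
      (RepresentedBy 1 R p hp.ne_zero ∨ RepresentedBy (-1) R p hp.ne_zero) := by
  obtain ⟨q, hq, rfl | rfl⟩ := (isRational_of_mem_latticeOC hΛ h).exists_eq
  · exact exists_representedBy_rotR hq
  · exact exists_representedBy_rotT hq

theorem latticeSOC_eq (hΛ : IsQuatLattice Λ) :
    latticeSOC Λ = {R | ∃ (q : ℍ[ℤ]) (hq : IsPrimitive q), R = rotR q hq} := by
  ext R
  constructor
  · rintro ⟨h, hd⟩
    obtain ⟨q, hq, rfl | rfl⟩ := (isRational_of_mem_latticeOC hΛ h).exists_eq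
    · exact ⟨q, hq, rfl⟩
    · exact absurd hd (not_isRotation_rotT q hq)
  · rintro ⟨q, hq, rfl⟩
    exact ⟨rotR_mem_latticeOC hΛ hq, isRotation_rotR q hq⟩

theorem latticeOC_diff_latticeSOC_eq (hΛ : IsQuatLattice Λ) :
    latticeOC Λ \ latticeSOC Λ = {T | ∃ (q : ℍ[ℤ]) (hq : IsPrimitive q), T = rotT q hq} := by
  ext R
  constructor
  · rintro ⟨h, hd⟩
    obtain ⟨q, hq, rfl | rfl⟩ := (isRational_of_mem_latticeOC hΛ h).exists_eq
    · exact absurd ⟨h, isRotation_rotR q hq⟩ hd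
    · exact ⟨q, hq, rfl⟩
  · rintro ⟨q, hq, rfl⟩
    exact ⟨rotT_mem_latticeOC hΛ hq, fun h => not_isRotation_rotT q hq h.2⟩

end

theorem four_smul_sub_mem {v w : Space 3} (hv : v ∈ diamond) (hw : w ∈ diamond) :
    (4 : ℝ) • (v - w) ∈ fccLattice := by
  have hx : (4 : ℝ) • diamondShift ∈ fccLattice := by
    simpa using (intCast_smul_diamondShift_mem 4).2 dvd_rfl
  have key : ∀ {v}, v ∈ diamond → (4 : ℝ) • v ∈ fccLattice := fun {v} hv => by
    rcases mem_diamond.1 hv with h | h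
    · simpa using natCast_smul_mem h 4
    · have := fccLattice.add_mem (natCast_smul_mem h 4) hx
      rw [Nat.cast_ofNat, smul_sub, sub_add_cancel] at this
      exact this
  rw [smul_sub]
  exact sub_mem (key hv) (key hw)

/-- Differences of points in a coset contained in L(R) are R-images of differences of packing
points, whose multiples by 4 lie in `Γ`. So R⁻¹ is rational, and rational isometries form `OC(Γ)`.
Conversely the CSL itself lies in L(R). -/
theorem multilatticeOC_eq : multilatticeOC fccLattice diamondShifts = latticeOC fccLattice := by
  ext R
  constructor
  · rintro ⟨k, ℓ, -, Γ', hle, hidx, hsub⟩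
    suffices h : IsRational R⁻¹ by
      have := inv_mem_latticeOC ((mem_latticeOC_iff_isRational isQuatLattice_fccLattice).2 h)
      rwa [inv_inv] at this
    refine ⟨4 * (Γ'.relIndex fccLattice).factorial * 2, by
      have := Nat.factorial_ne_zero (Γ'.relIndex fccLattice)
      positivity, fun v hv => ?_⟩
    have h1 := factorial_relIndex_smul_mem hidx (two_smul_cubic_mem isQuatLattice_fccLattice hv)
    have h2 := (hsub ⟨_, h1, rfl⟩).2
    have h3 := (hsub ⟨_, Γ'.zero_mem, rfl⟩).2
    obtain ⟨a, ha, ha'⟩ := h2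
    obtain ⟨b, hb, hb'⟩ := h3
    have h4 := four_smul_sub_mem ha hb
    have h5 : R (a - b) = ((Γ'.relIndex fccLattice).factorial : ℝ) • (2 : ℝ) • v := by
      rw [map_sub, ha', hb']
      simp
    have h6 : a - b = R⁻¹ (((Γ'.relIndex fccLattice).factorial : ℝ) • (2 : ℝ) • v) := by
      rw [← h5]
      exact (R.symm_apply_apply _).symm
    rw [h6, map_smul, map_smul, smul_smul, smul_smul] at h4
    push_cast
    exact fccLattice_le_cubicLattice (by rwa [mul_assoc] at h4 ⊢)
  · intro h
    refine ⟨0, 0, zero_mem _, csl fccLattice R, inf_le_left, latticeIndex_ne_zero h, ?_⟩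
    rintro _ ⟨v, ⟨hv1, hv2⟩, rfl⟩
    simp only [diamondShifts, Matrix.cons_val_zero, add_zero, zero_vadd]
    exact ⟨mem_diamond.2 (Or.inl hv1), mem_image_diamond.2 (Or.inl hv2)⟩

end

noncomputable section

/-! ### Counting coincidence site lattices and multilattices -/

open Hurwitz

/-- The ranges of two functions with the same kernel are equivalent. -/
def rangeEquivOfEqIff {α β γ : Type*} (f : α → β) (g : α → γ)
    (h : ∀ x y, f x = f y ↔ g x = g y) : Set.range f ≃ Set.range g :=
  (Setoid.quotientKerEquivRange f).symm.trans
    ((Quotient.congr (Equiv.refl α) h).trans (Setoid.quotientKerEquivRange g))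

/-- The primitive Hurwitz quaternions of norm `n`. -/
abbrev PrimOfNorm (n : ℕ) := {q : hurwitzRing // IsPrim q ∧ nrm q = n}

theorem range_rightIdeal_eq (n : ℕ) :
    Set.range (fun q : PrimOfNorm n => rightIdeal q.1) = primIdeals n := by
  ext I
  constructor
  · rintro ⟨⟨q, h1, h2⟩, rfl⟩
    exact ⟨q, h1, h2, rfl⟩
  · rintro ⟨q, h1, h2, rfl⟩
    exact ⟨⟨q, h1, h2⟩, rfl⟩

/-- The shift `x` is moved by the rotations given by units by lattice vectors only. -/
theorem representedBy_mul_unit {q u : hurwitzRing} (hq : q ≠ 0) (hu : nrm u = 1) (hu0 : u ≠ 0) :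
    RepresentedBy 1 (rot (q * u) (mul_ne_zero hq hu0)) q hq where
  imageLattice_eq hΛ := by rw [imageLattice_rot_mul hq hu0, imageLattice_rot_unit hΛ hu hu0]
  sub_mem := by
    have h := nrm_smul_rot_diamondShift_sub_mem u hu0
    rw [hu, Nat.cast_one, one_smul, one_smul] at h
    rwa [rot_mul _ _ hq hu0, one_smul, ← map_sub, apply_mem_imageLattice]

theorem representedBy_of_rightIdeal_eq {p q : hurwitzRing} (hp : p ≠ 0) (hq : q ≠ 0)
    (h : rightIdeal p = rightIdeal q) : RepresentedBy 1 (rot p hp) q hq := by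
  obtain ⟨u, hu, rfl⟩ := exists_of_rightIdeal_eq hq h
  exact representedBy_mul_unit hq hu (right_ne_zero_of_mul hp)

theorem csl_rot_eq_iff {Λ : AddSubgroup (Space 3)} (hΛ : IsQuatLattice Λ) {p q : hurwitzRing}
    (hp : IsPrim p) (hq : IsPrim q) (hpn : Odd (nrm p)) (hqn : Odd (nrm q)) :
    csl Λ (rot p hp.ne_zero) = csl Λ (rot q hq.ne_zero) ↔ rightIdeal p = rightIdeal q :=
  ⟨rightIdeal_eq_of_csl_eq hΛ hp hq hpn hqn,
    fun h => (representedBy_of_rightIdeal_eq hp.ne_zero hq.ne_zero h).csl_eq hΛ⟩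

/-- The second coset lies in x + `Γ`, so the CSL, and with it the right ideal, can be recovered from
the CSML. -/
theorem coincidenceSet_diamond_rot_inter {q : hurwitzRing} (hq : q ≠ 0) (hn : Odd (nrm q)) :
    coincidenceSet diamond (rot q hq) ∩ fccLattice =
      (csl fccLattice (rot q hq) : Set (Space 3)) := by
  obtain ⟨y, hy1, hy2⟩ := exists_common_shift hq hn
  rw [coincidenceSet_diamond_double hq hn rfl (by rw [sub_self]; exact zero_mem _) hy1 hy2,
    Set.union_inter_distrib_right,
    (disjoint_vadd le_rfl (B := csl fccLattice (rot q hq)) inf_le_left hy1).symm.inter_eq,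
    Set.union_empty, Set.inter_eq_left.2]
  exact fun v hv => hv.1

theorem coincidenceSet_diamond_rot_eq_iff {p q : hurwitzRing} (hp : IsPrim p) (hq : IsPrim q)
    (hpn : Odd (nrm p)) (hqn : Odd (nrm q)) :
    coincidenceSet diamond (rot p hp.ne_zero) = coincidenceSet diamond (rot q hq.ne_zero) ↔
      rightIdeal p = rightIdeal q := by
  constructor
  · intro h
    rw [← csl_rot_eq_iff isQuatLattice_fccLattice hp hq hpn hqn, ← SetLike.coe_set_eq,
      ← coincidenceSet_diamond_rot_inter hp.ne_zero hpn,
      ← coincidenceSet_diamond_rot_inter hq.ne_zero hqn, h]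
  · exact fun h => (representedBy_of_rightIdeal_eq hp.ne_zero hq.ne_zero h).coincidenceSet_eq

theorem hasCoincidenceIndex_of_representedBy {R : Orth 3} {q : hurwitzRing} (hq : IsPrim q)
    (hn : Odd (nrm q)) :
    (RepresentedBy 1 R q hq.ne_zero → HasCoincidenceIndex diamond R (nrm q) ∧
      coincidenceSet diamond R = coincidenceSet diamond (rot q hq.ne_zero)) ∧
    (RepresentedBy (-1) R q hq.ne_zero → HasCoincidenceIndex diamond R (2 * nrm q) ∧
      coincidenceSet diamond R = (csl fccLattice (rot q hq.ne_zero) : Set (Space 3))) := by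
  constructor
  · intro h
    obtain ⟨-, -, h1, h2⟩ := h.hasDoubleCSML hq hn
    exact ⟨h2 ▸ h1, h.coincidenceSet_eq⟩
  · intro h
    obtain ⟨h0, h1, h2⟩ := h.hasSingleCSML hq hn
    exact ⟨h2 ▸ h1, by rw [h0, h.csl_eq isQuatLattice_fccLattice]⟩

/-- The sign of the representation decides the type: index |q|², hence odd, for +, and 2|q|², twice
an odd number, for -. The two types never share an index. -/
theorem mem_csmlsOfIndex {A : Set (Space 3)} {m : ℕ} :
    A ∈ csmlsOfIndex fccLattice diamondShifts m ↔ ∃ (q : hurwitzRing) (hq : IsPrim q),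
      Odd (nrm q) ∧ ((nrm q = m ∧ A = coincidenceSet diamond (rot q hq.ne_zero)) ∨
        (2 * nrm q = m ∧ A = (csl fccLattice (rot q hq.ne_zero) : Set (Space 3)))) := by
  rw [csmlsOfIndex, Set.mem_ofPred_eq, multilatticeOC_eq]
  change (∃ R ∈ latticeOC fccLattice, A = coincidenceSet diamond R ∧
    HasCoincidenceIndex diamond R m) ↔ _
  constructor
  · rintro ⟨R, hR, rfl, hm⟩
    obtain ⟨q, hq, hn, h | h⟩ := exists_representedBy_of_mem_latticeOC isQuatLattice_fccLattice hR
    · obtain ⟨h1, h2⟩ := (hasCoincidenceIndex_of_representedBy hq hn).1 h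
      exact ⟨q, hq, hn, Or.inl ⟨by exact_mod_cast h1.unique hm, h2⟩⟩
    · obtain ⟨h1, h2⟩ := (hasCoincidenceIndex_of_representedBy hq hn).2 h
      exact ⟨q, hq, hn, Or.inr ⟨by exact_mod_cast h1.unique hm, h2⟩⟩
  · rintro ⟨q, hq, hn, ⟨rfl, rfl⟩ | ⟨rfl, rfl⟩⟩
    · have h := RepresentedBy.rot q hq.ne_zero
      obtain ⟨h1, h2⟩ := (hasCoincidenceIndex_of_representedBy hq hn).1 h
      exact ⟨_, h.mem_latticeOC hq hn isQuatLattice_fccLattice, h2.symm, h1⟩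
    · have h := (RepresentedBy.rot q hq.ne_zero).neg
      obtain ⟨h1, h2⟩ := (hasCoincidenceIndex_of_representedBy hq hn).2 h
      exact ⟨_, h.mem_latticeOC hq hn isQuatLattice_fccLattice, h2.symm, by exact_mod_cast h1⟩

theorem csmlsOfIndex_of_odd {n : ℕ} (hn : Odd n) : csmlsOfIndex fccLattice diamondShifts n =
    Set.range fun q : PrimOfNorm n => coincidenceSet diamond (rot q.1 q.2.1.ne_zero) := by
  ext A
  rw [mem_csmlsOfIndex]
  constructor
  · rintro ⟨q, hq, h, ⟨rfl, rfl⟩ | ⟨rfl, rfl⟩⟩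
    · exact ⟨⟨q, hq, rfl⟩, rfl⟩
    · exact absurd hn (by simp)
  · rintro ⟨⟨q, hq, rfl⟩, rfl⟩
    exact ⟨q, hq, hn, Or.inl ⟨rfl, rfl⟩⟩

theorem csmlsOfIndex_two_mul {n : ℕ} (hn : Odd n) :
    csmlsOfIndex fccLattice diamondShifts (2 * n) =
      Set.range fun q : PrimOfNorm n =>
        (csl fccLattice (rot q.1 q.2.1.ne_zero) : Set (Space 3)) := by
  ext A
  rw [mem_csmlsOfIndex]
  constructor
  · rintro ⟨q, hq, h, ⟨h1, rfl⟩ | ⟨h1, rfl⟩⟩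
    · exact absurd h (by simp [h1])
    · exact ⟨⟨q, hq, by omega⟩, rfl⟩
  · rintro ⟨⟨q, hq, rfl⟩, rfl⟩
    exact ⟨q, hq, hn, Or.inr ⟨rfl, rfl⟩⟩

theorem csmlsOfIndex_eq_empty {m : ℕ} (hm : 4 ∣ m) :
    csmlsOfIndex fccLattice diamondShifts m = ∅ := by
  ext A
  rw [mem_csmlsOfIndex, Set.mem_empty_iff_false, iff_false]
  rintro ⟨q, hq, ⟨k, hk⟩, ⟨rfl, rfl⟩ | ⟨rfl, rfl⟩⟩ <;> omega

theorem csls_eq {Λ : AddSubgroup (Space 3)} (hΛ : IsQuatLattice Λ) (m : ℕ) :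
    {A : AddSubgroup (Space 3) | ∃ R ∈ latticeOC Λ, A = csl Λ R ∧ latticeIndex Λ R = m} =
      {A | Odd m ∧ ∃ q : PrimOfNorm m, csl Λ (rot q.1 q.2.1.ne_zero) = A} := by
  ext A
  simp only [Set.mem_ofPred_eq]
  constructor
  · rintro ⟨R, hR, rfl, rfl⟩
    obtain ⟨q, hq, hn, h | h⟩ := exists_representedBy_of_mem_latticeOC hΛ hR <;>
    · have h1 := h.latticeIndex_eq hq hn hΛ
      exact ⟨h1.symm ▸ hn, ⟨q, hq, h1.symm⟩, (h.csl_eq hΛ).symm⟩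
  · rintro ⟨hm, ⟨q, hq, rfl⟩, rfl⟩
    exact ⟨_, rot_mem_latticeOC hΛ hq hm, rfl, latticeIndex_rot hΛ hq hm⟩

theorem finite_range_and_ncard_eq {n : ℕ} (hn : Odd n) {γ : Type*} (f : PrimOfNorm n → γ)
    (h : ∀ p q, f p = f q ↔ rightIdeal p.1 = rightIdeal q.1) :
    (Set.range f).Finite ∧ (Set.range f).ncard = (primIdeals n).ncard := by
  rw [← range_rightIdeal_eq]
  have e := rangeEquivOfEqIff f _ h
  refine ⟨?_, ?_⟩
  · have := finite_primIdeals_of_odd hn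
    rw [← range_rightIdeal_eq] at this
    have := this.to_subtype
    exact Set.finite_coe_iff.1 (Finite.of_equiv _ e.symm)
  · rw [← Nat.card_coe_set_eq, ← Nat.card_coe_set_eq]
    exact Nat.card_congr e

theorem finite_csmlsOfIndex_and_ncard_eq {n : ℕ} (hn : Odd n) :
    (csmlsOfIndex fccLattice diamondShifts n).Finite ∧
      diamondCount n = (primIdeals n).ncard := by
  rw [diamondCount, csmlsOfIndex_of_odd hn]
  exact finite_range_and_ncard_eq hn _ fun p q =>
    coincidenceSet_diamond_rot_eq_iff p.2.1 q.2.1 (p.2.2.symm ▸ hn) (q.2.2.symm ▸ hn)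

theorem finite_csmlsOfIndex_two_mul_and_ncard_eq {n : ℕ} (hn : Odd n) :
    (csmlsOfIndex fccLattice diamondShifts (2 * n)).Finite ∧
      diamondCount (2 * n) = (primIdeals n).ncard := by
  rw [diamondCount, csmlsOfIndex_two_mul hn]
  refine finite_range_and_ncard_eq hn _ fun p q => ?_
  rw [SetLike.coe_set_eq]
  exact csl_rot_eq_iff isQuatLattice_fccLattice p.2.1 q.2.1 (p.2.2.symm ▸ hn) (q.2.2.symm ▸ hn)

theorem exists_odd_of_not_four_dvd {m : ℕ} (hm : ¬ 4 ∣ m) :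
    Odd m ∨ ∃ n, Odd n ∧ m = 2 * n := by
  rcases Nat.even_or_odd' m with ⟨n, rfl | rfl⟩
  · exact Or.inr ⟨n, by rw [Nat.odd_iff]; omega, rfl⟩
  · exact Or.inl ⟨n, rfl⟩

theorem finite_csmlsOfIndex (m : ℕ) : (csmlsOfIndex fccLattice diamondShifts m).Finite := by
  by_cases hm : 4 ∣ m
  · rw [csmlsOfIndex_eq_empty hm]
    exact Set.finite_empty
  · rcases exists_odd_of_not_four_dvd hm with h | ⟨n, hn, rfl⟩
    · exact (finite_csmlsOfIndex_and_ncard_eq h).1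
    · exact (finite_csmlsOfIndex_two_mul_and_ncard_eq hn).1

theorem cslCount_of_odd {Λ : AddSubgroup (Space 3)} (hΛ : IsQuatLattice Λ) {n : ℕ} (hn : Odd n) :
    cslCount Λ n = (primIdeals n).ncard := by
  rw [cslCount, csls_eq hΛ]
  simp only [hn, true_and]
  exact (finite_range_and_ncard_eq hn
    (fun q : PrimOfNorm n => csl Λ (rot q.1 q.2.1.ne_zero)) fun p q =>
      csl_rot_eq_iff hΛ p.2.1 q.2.1 (p.2.2.symm ▸ hn) (q.2.2.symm ▸ hn)).2

theorem cslCount_of_even {Λ : AddSubgroup (Space 3)} (hΛ : IsQuatLattice Λ) {n : ℕ}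
    (hn : ¬ Odd n) : cslCount Λ n = 0 := by
  rw [cslCount, csls_eq hΛ]
  simp [hn]

/-- The index is always |q|² or 2|q|², hence an integer. -/
theorem csmlsOfIndexLE_eq (N : ℕ) : csmlsOfIndexLE fccLattice diamondShifts N =
    ⋃ m ∈ Finset.range (N + 1), csmlsOfIndex fccLattice diamondShifts m := by
  ext A
  simp only [Set.mem_iUnion, exists_prop, Finset.mem_range, Nat.lt_succ_iff]
  constructor
  · rintro ⟨R, hR, rfl, σ, hσ, hN⟩
    have h0 := hR
    rw [multilatticeOC_eq] at h0
    obtain ⟨q, hq, hn, h | h⟩ := exists_representedBy_of_mem_latticeOC isQuatLattice_fccLattice h0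
    · obtain ⟨h1, -⟩ := (hasCoincidenceIndex_of_representedBy hq hn).1 h
      rw [hσ.unique h1] at hN
      exact ⟨nrm q, by exact_mod_cast hN, R, hR, rfl, h1⟩
    · obtain ⟨h1, -⟩ := (hasCoincidenceIndex_of_representedBy hq hn).2 h
      rw [hσ.unique h1] at hN
      exact ⟨2 * nrm q, by exact_mod_cast hN, R, hR, rfl, by exact_mod_cast h1⟩
  · rintro ⟨m, hm, R, hR, rfl, h⟩
    exact ⟨R, hR, rfl, m, h, by exact_mod_cast hm⟩

theorem finite_csmlsOfIndexLE (N : ℕ) : (csmlsOfIndexLE fccLattice diamondShifts N).Finite := by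
  rw [csmlsOfIndexLE_eq]
  exact Set.Finite.biUnion (Finset.finite_toSet _) fun m _ => finite_csmlsOfIndex m

theorem disjoint_csmlsOfIndex {m n : ℕ} (h : m ≠ n) :
    Disjoint (csmlsOfIndex fccLattice diamondShifts m)
      (csmlsOfIndex fccLattice diamondShifts n) := by
  rw [Set.disjoint_left]
  rintro A ⟨R, -, rfl, hm⟩ ⟨S, -, hS, hn⟩
  refine h ?_
  have : HasCoincidenceIndex (multilattice fccLattice diamondShifts) S m := by
    rw [HasCoincidenceIndex, ← hS]
    exact hm
  exact_mod_cast this.unique hn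

theorem ncard_csmlsOfIndexLE (N : ℕ) : (csmlsOfIndexLE fccLattice diamondShifts N).ncard =
    ∑ m ∈ Finset.range (N + 1), diamondCount m := by
  rw [csmlsOfIndexLE_eq]
  have h := Set.Finite.ncard_biUnion (t := (Finset.range (N + 1) : Set ℕ))
    (Finset.finite_toSet _) (s := fun m => csmlsOfIndex fccLattice diamondShifts m)
    (fun m _ => finite_csmlsOfIndex m) (fun m _ n _ hmn => disjoint_csmlsOfIndex hmn)
  rw [finsum_mem_coe_finset] at h
  simp only [Finset.mem_coe] at h
  exact h

/-! ### The counting function as a Dirichlet convolution. -/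

section ArithmeticFunctions

open ArithmeticFunction

/-- The arithmetic function `n ↦ n` on odd numbers, zero on even ones. -/
def oddId : ArithmeticFunction ℕ := ⟨fun n => if Odd n then n else 0, by simp⟩

theorem oddId_apply (n : ℕ) : oddId n = if Odd n then n else 0 := rfl

theorem isMultiplicative_oddId : oddId.IsMultiplicative := by
  refine ⟨by simp [oddId_apply], fun {m n} _ => ?_⟩
  simp only [oddId_apply, Nat.odd_mul]
  by_cases hm : Odd m <;> by_cases hn : Odd n <;> simp [hm, hn]

theorem isMultiplicative_squarefreeIndicator : squarefreeIndicator.IsMultiplicative := by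
  refine ⟨by simp [squarefreeIndicator_apply], fun {m n} h => ?_⟩
  simp only [squarefreeIndicator_apply, Nat.squarefree_mul_iff]
  by_cases hm : Squarefree m <;> by_cases hn : Squarefree n <;> simp [hm, hn, h]

theorem isMultiplicative_squarefreeIndicator_mul_oddId :
    (squarefreeIndicator * oddId).IsMultiplicative :=
  isMultiplicative_squarefreeIndicator.mul isMultiplicative_oddId

theorem squarefreeIndicator_prime_pow {p : ℕ} (hp : p.Prime) (i : ℕ) :
    squarefreeIndicator (p ^ i) = if i ≤ 1 then 1 else 0 := by
  rw [squarefreeIndicator_apply]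
  refine if_congr ?_ rfl rfl
  rcases eq_or_ne i 0 with rfl | hi
  · simp
  · rw [Nat.squarefree_pow_iff hp.ne_one hi]
    constructor
    · exact fun h => h.2.le
    · exact fun h => ⟨hp.prime.squarefree, by omega⟩

theorem squarefreeIndicator_mul_prime_pow (g : ArithmeticFunction ℕ) {p : ℕ} (hp : p.Prime)
    (r : ℕ) : (squarefreeIndicator * g) (p ^ (r + 1)) = g (p ^ (r + 1)) + g (p ^ r) := by
  rw [mul_apply, Nat.sum_divisorsAntidiagonal (fun x y => squarefreeIndicator x * g y),
    Nat.sum_divisors_prime_pow hp, Finset.sum_range_succ', Finset.sum_range_succ']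
  simp only [squarefreeIndicator_prime_pow hp]
  rw [Finset.sum_eq_zero]
  · simp [pow_succ, hp.pos, add_comm]
  · simp

theorem squarefreeIndicator_mul_oddId_prime_pow {p r : ℕ} (hp : p.Prime) (hr : 1 ≤ r) :
    (squarefreeIndicator * oddId) (p ^ r) =
      if p ^ r = 2 then 1 else if p = 2 then 0 else (p + 1) * p ^ (r - 1) := by
  obtain ⟨r, rfl⟩ := Nat.exists_eq_add_of_le' hr
  rw [squarefreeIndicator_mul_prime_pow _ hp, oddId_apply, oddId_apply, Nat.add_sub_cancel]
  rcases hp.eq_two_or_odd' with rfl | hodd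
  · rcases r with _ | r
    · simp
    · have : (2 : ℕ) ^ (r + 1 + 1) ≠ 2 := by
        rw [pow_succ, pow_succ]
        have := Nat.two_pow_pos r
        omega
      have h2 : ∀ k, ¬ Odd (2 ^ (k + 1)) := fun k => by
        rw [Nat.odd_pow_iff k.succ_ne_zero]
        exact Nat.not_odd_iff_even.2 even_two
      rw [if_neg this, if_pos rfl, if_neg (h2 _), if_neg (h2 _)]
  · have h1 : p ≠ 2 := fun h => absurd (h ▸ hodd) (by decide)
    have h2 : p ^ (r + 1) ≠ 2 := fun h => by
      have := hodd.pow (n := r + 1)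
      rw [h] at this
      exact absurd this (by decide)
    rw [if_pos hodd.pow, if_pos hodd.pow, if_neg h2, if_neg h1]
    ring

theorem squarefreeIndicator_mul_oddId_of_odd {n : ℕ} (hn : Odd n) :
    (squarefreeIndicator * oddId) n = (squarefreeIndicator * ArithmeticFunction.id) n := by
  rw [mul_apply, mul_apply]
  refine Finset.sum_congr rfl fun x hx => ?_
  have h : Odd x.2 := Odd.of_dvd_nat hn (Dvd.intro_left _ (Nat.mem_divisorsAntidiagonal.1 hx).1)
  rw [oddId_apply, if_pos h, id_apply]

/-- On odd m this is the count of primitive ideals. A single factor 2 multiplies the convolution by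
1, matching the CSMLs of even index, and on multiples of 4 both sides vanish. -/
theorem diamondCount_eq (m : ℕ) : diamondCount m = (squarefreeIndicator * oddId) m := by
  by_cases hm : 4 ∣ m
  · rw [diamondCount, csmlsOfIndex_eq_empty hm, Set.ncard_empty]
    rcases eq_or_ne m 0 with rfl | hm0
    · simp
    obtain ⟨k, t, ht, rfl⟩ := Nat.exists_eq_two_pow_mul_odd hm0
    rw [isMultiplicative_squarefreeIndicator_mul_oddId.map_mul_of_coprime
      (Nat.Coprime.pow_left k (Nat.coprime_two_left.2 ht))]
    have hk : 2 ≤ k := by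
      by_contra! h
      obtain ⟨j, rfl⟩ := ht
      interval_cases k <;> omega
    rw [squarefreeIndicator_mul_oddId_prime_pow Nat.prime_two (by omega), if_neg, if_pos rfl,
      zero_mul]
    obtain ⟨j, rfl⟩ := Nat.exists_eq_add_of_le hk
    rw [pow_add]
    have := Nat.two_pow_pos j
    omega
  · rcases exists_odd_of_not_four_dvd hm with h | ⟨n, hn, rfl⟩
    · rw [(finite_csmlsOfIndex_and_ncard_eq h).2, primCount_eq h,
        squarefreeIndicator_mul_oddId_of_odd h]
    · rw [(finite_csmlsOfIndex_two_mul_and_ncard_eq hn).2, primCount_eq hn,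
        isMultiplicative_squarefreeIndicator_mul_oddId.map_mul_of_coprime
          (Nat.coprime_two_left.2 hn), squarefreeIndicator_mul_oddId_of_odd hn]
      have := squarefreeIndicator_mul_oddId_prime_pow Nat.prime_two le_rfl
      rw [pow_one, if_pos rfl] at this
      rw [this, one_mul]

theorem cslCount_cubicLattice (m : ℕ) :
    cslCount cubicLattice m = if Odd m then diamondCount m else 0 := by
  split_ifs with h
  · rw [cslCount_of_odd isQuatLattice_cubicLattice h, (finite_csmlsOfIndex_and_ncard_eq h).2]
  · exact cslCount_of_even isQuatLattice_cubicLattice h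

theorem diamondCount_mul {m n : ℕ} (h : m.Coprime n) :
    diamondCount (m * n) = diamondCount m * diamondCount n := by
  simp only [diamondCount_eq]
  exact isMultiplicative_squarefreeIndicator_mul_oddId.map_mul_of_coprime h

theorem diamondCount_prime_pow {p r : ℕ} (hp : p.Prime) (hr : 1 ≤ r) :
    diamondCount (p ^ r) =
      if p ^ r = 2 then 1 else if p = 2 then 0 else (p + 1) * p ^ (r - 1) := by
  rw [diamondCount_eq, squarefreeIndicator_mul_oddId_prime_pow hp hr]

theorem diamondCount_one : diamondCount 1 = 1 := by
  rw [diamondCount_eq, isMultiplicative_squarefreeIndicator_mul_oddId.map_one]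

theorem diamondCount_list : (List.range 17).map (fun k => diamondCount (k + 1)) =
    [1, 1, 4, 0, 6, 4, 8, 0, 12, 6, 12, 0, 14, 8, 24, 0, 18] := by
  have hp : ∀ p, p.Prime → p ≠ 2 → diamondCount p = p + 1 := fun p h h2 => by
    have := diamondCount_prime_pow h le_rfl
    rwa [pow_one, if_neg h2, if_neg h2, Nat.sub_self, pow_zero, mul_one] at this
  have h2 : ∀ r, 1 ≤ r → diamondCount (2 ^ r) = if 2 ^ r = 2 then 1 else 0 := fun r hr => by
    rw [diamondCount_prime_pow Nat.prime_two hr]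
    simp
  have h2' : diamondCount 2 = 1 := by simpa using h2 1 le_rfl
  have h3 := hp 3 (by norm_num) (by norm_num)
  have h4 : diamondCount 4 = 0 := by simpa using h2 2 (by norm_num)
  have h5 := hp 5 (by norm_num) (by norm_num)
  have h7 := hp 7 (by norm_num) (by norm_num)
  have h8 : diamondCount 8 = 0 := by simpa using h2 3 (by norm_num)
  have h9 : diamondCount 9 = 12 := by
    simpa using diamondCount_prime_pow (r := 2) Nat.prime_three (by norm_num)
  have h16 : diamondCount 16 = 0 := by simpa using h2 4 (by norm_num)
  have h11 := hp 11 (by norm_num) (by norm_num)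
  have h13 := hp 13 (by norm_num) (by norm_num)
  have h17 := hp 17 (by norm_num) (by norm_num)
  have h6 := diamondCount_mul (m := 2) (n := 3) (by norm_num)
  have h10 := diamondCount_mul (m := 2) (n := 5) (by norm_num)
  have h12 := diamondCount_mul (m := 4) (n := 3) (by norm_num)
  have h14 := diamondCount_mul (m := 2) (n := 7) (by norm_num)
  have h15 := diamondCount_mul (m := 3) (n := 5) (by norm_num)
  norm_num [h2', h3, h4, h5, h7] at h6 h10 h12 h14 h15
  simp [List.range_succ, diamondCount_one, h2', h3, h4, h5, h6, h7, h8, h9, h10, h11, h12, h13,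
    h14, h15, h16, h17]

end ArithmeticFunctions

end

noncomputable section

/-! ### The Dirichlet series -/

section DirichletSeries

open ArithmeticFunction LSeries

/-- A series supported on squares becomes a series at 2s, because (k²)^s = k^(2s). It serves both
the squares and the ideal indices. -/
theorem lseriesHasSum_sq {F : ℕ → ℂ} (hF : ∀ m, ¬ IsSquare m → F m = 0) {s a : ℂ} :
    LSeriesHasSum (fun k => F (k ^ 2)) (2 * s) a ↔ LSeriesHasSum F s a := by
  have hinj : Function.Injective fun k : ℕ => k ^ 2 := Nat.pow_left_injective two_ne_zero
  have hterm : term (fun k => F (k ^ 2)) (2 * s) = term F s ∘ fun k : ℕ => k ^ 2 := by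
    ext k
    rcases eq_or_ne k 0 with rfl | hk
    · simp
    · rw [Function.comp_apply, term_of_ne_zero hk, term_of_ne_zero (pow_ne_zero 2 hk),
        show (2 : ℂ) * s = ((2 : ℕ) : ℂ) * s by norm_num, Complex.cpow_nat_mul, sq k, Nat.cast_mul,
        Complex.natCast_mul_natCast_cpow, sq ((k : ℂ) ^ s)]
  rw [LSeriesHasSum, hterm, hinj.hasSum_iff, LSeriesHasSum]
  intro m hm
  rw [term_def, hF m, zero_div, ite_self]
  rintro ⟨k, rfl⟩
  exact hm ⟨k, sq k⟩

theorem LSeriesHasSum.dilate {F : ℕ → ℂ} {s a : ℂ} (h : LSeriesHasSum F s a) :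
    LSeriesHasSum (fun n => if Even n then F (n / 2) else 0) s ((2 : ℂ) ^ (-s) * a) := by
  have hinj : Function.Injective fun k : ℕ => 2 * k := fun a b h => by simpa using h
  have hterm : (fun k => (2 : ℂ) ^ (-s) * term F s k) =
      term (fun n => if Even n then F (n / 2) else 0) s ∘ fun k : ℕ => 2 * k := by
    ext k
    rcases eq_or_ne k 0 with rfl | hk
    · simp
    · rw [Function.comp_apply, term_of_ne_zero hk, term_of_ne_zero (mul_ne_zero two_ne_zero hk),
        if_pos (even_two_mul k), Nat.mul_div_cancel_left k two_pos, Nat.cast_mul,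
        Complex.natCast_mul_natCast_cpow, Complex.cpow_neg, Nat.cast_ofNat, inv_mul_eq_div,
        div_div, mul_comm]
  rw [LSeriesHasSum, ← hinj.hasSum_iff, ← hterm]
  · exact HasSum.mul_left _ h
  · intro m hm
    have hodd : ¬ Even m := fun ⟨k, hk⟩ => hm ⟨k, by simp only; omega⟩
    rw [term_def, if_neg hodd, zero_div, ite_self]

theorem LSeriesHasSum.natCast_mul {f g : ArithmeticFunction ℕ} {s a b : ℂ}
    (hf : LSeriesHasSum (fun n => (f n : ℂ)) s a) (hg : LSeriesHasSum (fun n => (g n : ℂ)) s b) :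
    LSeriesHasSum (fun n => ((f * g) n : ℂ)) s (a * b) := by
  have h := LSeriesHasSum_mul (f := (f : ArithmeticFunction ℂ)) (g := (g : ArithmeticFunction ℂ))
    hf hg
  rwa [← natCoe_mul] at h

variable {s : ℂ}

theorem lseriesHasSum_squareIndicator (hs : 1 < (2 * s).re) :
    LSeriesHasSum (fun n => (squareIndicator n : ℂ)) s (riemannZeta (2 * s)) := by
  rw [← lseriesHasSum_sq fun m hm => by simp [squareIndicator_apply, hm]]
  refine (LSeriesHasSum_congr _ _ fun {n} hn => ?_).1 (LSeriesHasSum_one hs)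
  simp [squareIndicator_apply, hn, IsSquare.sq]

theorem exists_lseriesHasSum_squarefreeIndicator (hs : 1 < s.re) :
    ∃ a, LSeriesHasSum (fun n => (squarefreeIndicator n : ℂ)) s a ∧
      riemannZeta (2 * s) * a = riemannZeta s := by
  have h1 : LSeriesSummable (fun n => (squarefreeIndicator n : ℂ)) s :=
    LSeriesSummable_of_bounded_of_one_lt_re (m := 1) (fun n _ => by
      rw [squarefreeIndicator_apply]; split_ifs <;> simp) hs
  refine ⟨_, h1.LSeriesHasSum, ?_⟩
  have h2 := LSeriesHasSum.natCast_mul (lseriesHasSum_squareIndicator (s := s) (by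
    simp; linarith)) h1.LSeriesHasSum
  rw [squareIndicator_mul_squarefreeIndicator] at h2
  exact h2.unique (LSeriesHasSum_zeta hs)

theorem lseriesHasSum_natCast (hs : 2 < s.re) :
    LSeriesHasSum (fun n => (n : ℂ)) s (riemannZeta (s - 1)) := by
  have h : LSeriesHasSum 1 (s - 1) (riemannZeta (s - 1)) :=
    LSeriesHasSum_one (by rw [Complex.sub_re, Complex.one_re]; linarith)
  have hterm : term (fun n => (n : ℂ)) s = term 1 (s - 1) := by
    ext n
    rcases eq_or_ne n 0 with rfl | hn
    · simp
    · have hn' : (n : ℂ) ≠ 0 := by exact_mod_cast hn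
      rw [term_of_ne_zero hn, term_of_ne_zero hn, Complex.cpow_sub _ _ hn', Complex.cpow_one,
        Pi.one_apply, one_div_div]
  rwa [LSeriesHasSum, hterm]

/-- The even part of ∑ n · n^(-s) is removed; it equals 2^(1-s) ζ(s - 1). -/
theorem lseriesHasSum_oddId (hs : 2 < s.re) : LSeriesHasSum (fun n => (oddId n : ℂ)) s
    ((1 - (2 : ℂ) ^ (1 - s)) * riemannZeta (s - 1)) := by
  have h1 := lseriesHasSum_natCast hs
  have h2 := (h1.smul (2 : ℂ)).dilate
  have h3 := h1.sub h2
  have he : riemannZeta (s - 1) - (2 : ℂ) ^ (-s) * (2 * riemannZeta (s - 1)) =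
      (1 - (2 : ℂ) ^ (1 - s)) * riemannZeta (s - 1) := by
    rw [sub_eq_add_neg 1 s, Complex.cpow_add _ _ two_ne_zero, Complex.cpow_one]
    ring
  rw [← he]
  refine (LSeriesHasSum_congr _ _ fun {n} hn => ?_).1 h3
  rw [oddId_apply]
  rcases Nat.even_or_odd' n with ⟨k, rfl | rfl⟩ <;> simp

theorem lseriesHasSum_zeta_mul_oddId (hs : 2 < s.re) :
    LSeriesHasSum (fun n => ((zeta * oddId) n : ℂ)) s
      ((1 - (2 : ℂ) ^ (1 - s)) * riemannZeta s * riemannZeta (s - 1)) := by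
  have h := LSeriesHasSum.natCast_mul (LSeriesHasSum_zeta (s := s) (by linarith))
    (lseriesHasSum_oddId hs)
  rwa [mul_left_comm, ← mul_assoc] at h

/-- Only odd divisors contribute, and doubling adds none. This matches the recursion for right
ideals at the prime 2. -/
theorem zeta_mul_oddId_two_mul (n : ℕ) : (zeta * oddId) (2 * n) = (zeta * oddId) n := by
  rcases eq_or_ne n 0 with rfl | hn
  · simp
  rw [zeta_mul_apply, zeta_mul_apply]
  symm
  refine Finset.sum_subset (Nat.divisors_subset_of_dvd (mul_ne_zero two_ne_zero hn)
    (Dvd.intro_left 2 rfl)) fun d hd hd' => ?_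
  rw [Nat.mem_divisors] at hd hd'
  rw [oddId_apply, if_neg]
  intro hodd
  exact hd' ⟨(Nat.coprime_two_right.2 hodd).dvd_of_dvd_mul_left hd.1, hn⟩

theorem rightIdealCount_sq {n : ℕ} (hn : n ≠ 0) :
    rightIdealCount (n ^ 2) = (zeta * oddId) n := by
  obtain ⟨k, t, ht, rfl⟩ := Nat.exists_eq_two_pow_mul_odd hn
  clear hn
  induction k with
  | zero =>
    rw [pow_zero, one_mul, Hurwitz.rightIdealCount_sq_of_odd ht, zeta_mul_apply]
    refine Finset.sum_congr rfl fun d hd => ?_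
    rw [oddId_apply, if_pos (Odd.of_dvd_nat ht (Nat.dvd_of_mem_divisors hd))]
  | succ k ih =>
    rw [pow_succ' 2 k, mul_assoc, zeta_mul_oddId_two_mul, ← ih, Hurwitz.rightIdealCount_two_mul_sq]
    exact mul_ne_zero (by positivity) ht.pos.ne'

theorem lseriesHasSum_rightIdealCount (hs : 2 < s.re) :
    LSeriesHasSum (fun n => (rightIdealCount n : ℂ)) (s / 2)
      ((1 - (2 : ℂ) ^ (1 - s)) * riemannZeta s * riemannZeta (s - 1)) := by
  -- The coefficient at 0, counting ideals of infinite index, is set to zero; the L-series ignores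
  -- it.
  have h1 : LSeriesHasSum (fun n => if n = 0 then 0 else (rightIdealCount n : ℂ)) (s / 2)
      ((1 - (2 : ℂ) ^ (1 - s)) * riemannZeta s * riemannZeta (s - 1)) := by
    rw [← lseriesHasSum_sq, mul_div_cancel₀ _ two_ne_zero]
    · refine (LSeriesHasSum_congr _ _ fun {n} hn => ?_).1 (lseriesHasSum_zeta_mul_oddId hs)
      rw [if_neg (pow_ne_zero 2 hn), rightIdealCount_sq hn]
    · intro m hm
      split_ifs with h0
      · rfl
      · rw [Hurwitz.rightIdealCount_eq_zero h0 hm, Nat.cast_zero]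
  exact (LSeriesHasSum_congr _ _ fun {n} hn => if_neg hn).1 h1

theorem exists_lseriesHasSum_diamondCount (hs : 2 < s.re) :
    ∃ a, LSeriesHasSum (fun n => (diamondCount n : ℂ)) s a ∧ riemannZeta (2 * s) * a =
      (1 - (2 : ℂ) ^ (1 - s)) * riemannZeta s * riemannZeta (s - 1) := by
  obtain ⟨a, ha, haz⟩ := exists_lseriesHasSum_squarefreeIndicator (s := s) (by linarith)
  refine ⟨a * ((1 - (2 : ℂ) ^ (1 - s)) * riemannZeta (s - 1)), ?_, ?_⟩
  · simp only [diamondCount_eq]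
    exact LSeriesHasSum.natCast_mul ha (lseriesHasSum_oddId hs)
  · rw [← mul_assoc, haz]
    ring

theorem lseriesSummable_cslCount (hs : 2 < s.re) :
    LSeriesSummable (fun n => (cslCount cubicLattice n : ℂ)) s := by
  obtain ⟨a, ha, -⟩ := exists_lseriesHasSum_diamondCount hs
  refine Summable.of_norm_bounded ha.LSeriesSummable.norm fun n => norm_term_le s ?_
  rw [cslCount_cubicLattice]
  split_ifs <;> simp

theorem diamondCount_two_mul (k : ℕ) :
    diamondCount (2 * k) = cslCount cubicLattice k := by
  rw [cslCount_cubicLattice]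
  split_ifs with h
  · rw [(finite_csmlsOfIndex_two_mul_and_ncard_eq h).2, (finite_csmlsOfIndex_and_ncard_eq h).2]
  · rw [diamondCount, csmlsOfIndex_eq_empty, Set.ncard_empty]
    rw [Nat.not_odd_iff] at h
    omega

/-- The CSLs of ℤ³ have odd index, and their number at index k equals f(k) for odd k and f(2k) for
every k. -/
theorem lseries_diamondCount_eq (hs : 2 < s.re) :
    LSeries (fun n => (diamondCount n : ℂ)) s =
      (1 + (2 : ℂ) ^ (-s)) * LSeries (fun n => (cslCount cubicLattice n : ℂ)) s := by
  have h1 := (lseriesSummable_cslCount hs).LSeriesHasSum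
  have h2 := h1.add h1.dilate
  rw [add_mul, one_mul, ← h2.LSeries_eq]
  refine LSeries_congr (fun {n} hn => ?_) s
  rcases Nat.even_or_odd' n with ⟨k, rfl | rfl⟩
  · simp only [Pi.add_apply, even_two_mul, if_true, Nat.mul_div_cancel_left k two_pos]
    rw [diamondCount_two_mul, cslCount_cubicLattice (2 * k), if_neg (by simp), Nat.cast_zero,
      zero_add]
  · simp [cslCount_cubicLattice]

end DirichletSeries

end

noncomputable section

/-! ### The asymptotic number of coincidence site multilattices -/

section Asymptotics

open ArithmeticFunction

/-- The sum of the first k odd numbers is k², and (M + 1) / 2 odd numbers are at most M. -/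
theorem sum_oddId (M : ℕ) : ∑ e ∈ Finset.Ioc 0 M, oddId e = ((M + 1) / 2) ^ 2 := by
  induction M with
  | zero => simp
  | succ M ih =>
    rw [← Finset.insert_Ioc_right_eq_Ioc_add_one (Nat.zero_le M), Finset.sum_insert (by simp), ih,
      oddId_apply]
    rcases Nat.even_or_odd' M with ⟨k, rfl | rfl⟩
    · rw [if_pos ⟨k, rfl⟩, show (2 * k + 1) / 2 = k by omega,
        show (2 * k + 1 + 1) / 2 = k + 1 by omega]
      ring
    · rw [if_neg (by simp [parity_simps]), show (2 * k + 1 + 1) / 2 = k + 1 by omega,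
        show (2 * k + 1 + 1 + 1) / 2 = k + 1 by omega, zero_add]

/-- The convolution is summed over the squarefree factor d, the odd cofactor running up to N / d. -/
theorem ncard_csmlsOfIndexLE_eq (N : ℕ) : (csmlsOfIndexLE fccLattice diamondShifts N).ncard =
    ∑ d ∈ Finset.Ioc 0 N, squarefreeIndicator d * ((N / d + 1) / 2) ^ 2 := by
  rw [ncard_csmlsOfIndexLE, Finset.sum_range_succ', diamondCount_eq 0, ArithmeticFunction.map_zero,
    add_zero]
  have h : ∑ m ∈ Finset.Ioc 0 N, (squarefreeIndicator * oddId) m =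
      ∑ m ∈ Finset.range N, diamondCount (m + 1) := by
    rw [Finset.range_eq_Ico, Finset.sum_Ico_add' diamondCount 0 N 1]
    refine Finset.sum_congr ?_ fun m _ => (diamondCount_eq m).symm
    ext m
    simp only [Finset.mem_Ioc, Finset.mem_Ico]
    omega
  rw [← h, sum_Ioc_mul_eq_sum_sum]
  simp only [sum_oddId]

/-- The summand of the limit of `N⁻² ∑_{n ≤ N} f(n)`. -/
def densityTerm (N d : ℕ) : ℝ :=
  squarefreeIndicator d * (((N / d + 1) / 2 : ℕ) : ℝ) ^ 2 / (N : ℝ) ^ 2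

theorem tsum_densityTerm (N : ℕ) : ∑' d, densityTerm N d =
    ((csmlsOfIndexLE fccLattice diamondShifts N).ncard : ℝ) / (N : ℝ) ^ 2 := by
  rw [tsum_eq_sum (s := Finset.Ioc 0 N), ncard_csmlsOfIndexLE_eq, Nat.cast_sum, Finset.sum_div]
  · refine Finset.sum_congr rfl fun d _ => ?_
    rw [densityTerm]
    push_cast
    rfl
  · intro d hd
    rw [Finset.mem_Ioc] at hd
    rcases Nat.eq_zero_or_pos d with rfl | hd0
    · simp [densityTerm]
    · rw [densityTerm, Nat.div_eq_of_lt (not_le.1 fun h => hd ⟨hd0, h⟩)]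
      simp

theorem squarefreeIndicator_le_one (d : ℕ) : (squarefreeIndicator d : ℝ) ≤ 1 := by
  rw [squarefreeIndicator_apply]
  split_ifs <;> simp

theorem norm_densityTerm_le (N d : ℕ) : ‖densityTerm N d‖ ≤ 1 / (d : ℝ) ^ 2 := by
  rw [densityTerm, Real.norm_of_nonneg (by positivity)]
  rcases Nat.eq_zero_or_pos d with rfl | hd
  · simp
  rcases Nat.eq_zero_or_pos N with rfl | hN
  · simp
  have hd' : (0 : ℝ) < d := by exact_mod_cast hd
  have hN' : (0 : ℝ) < N := by exact_mod_cast hN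
  -- ⌊(j + 1)/2⌋ ≤ j holds for every natural j, including j = 0, so the bound also covers d > N.
  have h1 : (((N / d + 1) / 2 : ℕ) : ℝ) ≤ N / d := by
    refine le_trans ?_ (Nat.cast_div_le (m := N) (n := d))
    generalize N / d = j
    exact Nat.cast_le.2 (by omega)
  calc _ ≤ 1 * ((N : ℝ) / d) ^ 2 / (N : ℝ) ^ 2 := by
        gcongr
        exact squarefreeIndicator_le_one d
    _ = _ := by field_simp

/-- The two floors change the value N/(2d) by at most 1. -/
theorem tendsto_densityTerm (d : ℕ) : Tendsto (fun N => densityTerm N d) atTop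
    (𝓝 (squarefreeIndicator d / (d : ℝ) ^ 2 / 4)) := by
  rcases Nat.eq_zero_or_pos d with rfl | hd
  · simp [densityTerm]
  have hd' : (0 : ℝ) < d := by exact_mod_cast hd
  have h : Tendsto (fun N : ℕ => (((N / d + 1) / 2 : ℕ) : ℝ) / N) atTop (𝓝 (1 / (2 * d))) := by
    have hlim : ∀ c : ℝ, Tendsto (fun N : ℕ => 1 / (2 * (d : ℝ)) + c / N) atTop
        (𝓝 (1 / (2 * d))) := fun c => by
      have := (tendsto_const_div_atTop_nhds_zero_nat c).const_add (1 / (2 * (d : ℝ)))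
      rwa [add_zero] at this
    refine tendsto_of_tendsto_of_tendsto_of_le_of_le' (hlim (-1)) (hlim 1) ?_ ?_ <;>
      filter_upwards [eventually_gt_atTop 0] with N hN
    all_goals
      have hN' : (0 : ℝ) < N := by exact_mod_cast hN
      have e1 : N < d * (N / d + 1) := Nat.lt_mul_div_succ N hd
      have e2 : d * (N / d) ≤ N := Nat.mul_div_le N d
      have e3 : N / d ≤ 2 * ((N / d + 1) / 2) := by omega
      have e4 : 2 * ((N / d + 1) / 2) ≤ N / d + 1 := by omega
      generalize (N / d + 1) / 2 = k at *
      generalize N / d = j at *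
      have e1' : (N : ℝ) < d * (j + 1) := by exact_mod_cast e1
      have e2' : (d : ℝ) * j ≤ N := by exact_mod_cast e2
      have e3' : (j : ℝ) ≤ 2 * k := by exact_mod_cast e3
      have e4' : 2 * (k : ℝ) ≤ j + 1 := by exact_mod_cast e4
    · rw [div_add_div _ _ (by positivity) hN'.ne', div_le_div_iff₀ (by positivity) hN']
      have : (N : ℝ) - 2 * d ≤ 2 * d * k := by nlinarith
      nlinarith
    · rw [div_add_div _ _ (by positivity) hN'.ne', div_le_div_iff₀ hN' (by positivity)]
      have : 2 * d * (k : ℝ) ≤ N + 2 * d := by nlinarith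
      nlinarith
  have h2 := (h.pow 2).const_mul (squarefreeIndicator d : ℝ)
  convert h2 using 2
  · rw [densityTerm]
    ring
  · field_simp
    norm_num

/-- The value is ζ(2)/ζ(4) = (π²/6)(90/π⁴). -/
theorem tsum_squarefreeIndicator_div_sq :
    ∑' d : ℕ, (squarefreeIndicator d : ℝ) / (d : ℝ) ^ 2 = 15 / Real.pi ^ 2 := by
  obtain ⟨a, ha, haz⟩ := exists_lseriesHasSum_squarefreeIndicator (s := 2) (by norm_num)
  rw [show (2 : ℂ) * 2 = 4 by norm_num, riemannZeta_two, riemannZeta_four] at haz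
  have hpi : (Real.pi : ℂ) ≠ 0 := by exact_mod_cast Real.pi_ne_zero
  have ha' : a = ((15 / Real.pi ^ 2 : ℝ) : ℂ) := by
    have h4 : (Real.pi : ℂ) ^ 4 / 90 ≠ 0 := div_ne_zero (pow_ne_zero 4 hpi) (by norm_num)
    apply mul_left_cancel₀ h4
    rw [haz]
    push_cast
    field_simp
    norm_num
  have hterm : LSeries.term (fun n => (squarefreeIndicator n : ℂ)) 2 =
      fun d : ℕ => (((squarefreeIndicator d : ℝ) / (d : ℝ) ^ 2 : ℝ) : ℂ) := by
    ext d
    rcases eq_or_ne d 0 with rfl | hd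
    · simp
    · rw [LSeries.term_of_ne_zero hd]
      push_cast
      norm_cast
  rw [LSeriesHasSum, hterm, ha'] at ha
  exact (Complex.hasSum_ofReal.1 ha).tsum_eq

/-- Dominated convergence with majorant 1/d², uniform in N, permits passing to the limit term by
term. -/
theorem isEquivalent_ncard_csmlsOfIndexLE : Asymptotics.IsEquivalent atTop
    (fun N : ℕ => ((csmlsOfIndexLE fccLattice diamondShifts N).ncard : ℝ))
    (fun N : ℕ => 15 * (N : ℝ) ^ 2 / (4 * Real.pi ^ 2)) := by
  have hpi := Real.pi_pos
  have h1 := tendsto_tsum_of_dominated_convergence (𝓕 := atTop) (f := densityTerm)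
    (g := fun d => squarefreeIndicator d / (d : ℝ) ^ 2 / 4)
    (bound := fun d : ℕ => 1 / (d : ℝ) ^ 2) (Real.summable_one_div_nat_pow.2 one_lt_two)
    tendsto_densityTerm (Eventually.of_forall fun N d => norm_densityTerm_le N d)
  rw [tsum_div_const, tsum_squarefreeIndicator_div_sq] at h1
  simp only [tsum_densityTerm] at h1
  rw [Asymptotics.isEquivalent_iff_tendsto_one]
  · have h2 := h1.div_const (15 / Real.pi ^ 2 / 4)
    rw [div_self (by positivity)] at h2
    refine h2.congr' ?_
    filter_upwards [eventually_gt_atTop 0] with N hN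
    have hN' : (0 : ℝ) < N := by exact_mod_cast hN
    rw [Pi.div_apply]
    field_simp
  · filter_upwards [eventually_gt_atTop 0] with N hN
    have hN' : (0 : ℝ) < N := by exact_mod_cast hN
    positivity

end Asymptotics

end

/-! ### The CSMLs of R_q and T_q, and the theorem. -/

open Hurwitz in
theorem hasCSML_rotR (q : ℍ[ℤ]) (hq : IsPrimitive q) :
    (Quaternion.normSq q ≡ 2 [ZMOD 4] →
      HasSingleCSML (rotR q hq) (Quaternion.normSq q : ℤ)) ∧
    (Odd (Quaternion.normSq q) →
      HasDoubleCSML (rotR q hq) (Quaternion.normSq q : ℤ)) ∧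
    (Quaternion.normSq q ≡ 0 [ZMOD 4] →
      HasDoubleCSML (rotR q hq) ((Quaternion.normSq q : ℤ) / 4)) := by
  refine ⟨fun h => ?_, fun h => ?_, fun h => ?_⟩
  · obtain ⟨p, hp, hn, hpq, hr⟩ := representedBy_rotR_of_two_mod_four hq h
    rw [← hpq]
    exact_mod_cast hr.hasSingleCSML hp hn
  · obtain ⟨p, hp, hn, hpq, hr⟩ := representedBy_rotR_of_odd hq h
    rw [← hpq]
    exact_mod_cast hr.hasDoubleCSML hp hn
  · obtain ⟨p, hp, hn, hpq, hr⟩ := representedBy_rotR_of_zero_mod_four hq h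
    rw [← hpq]
    have := hr.hasDoubleCSML hp hn
    convert this using 1
    push_cast
    ring

open Hurwitz in
theorem hasCSML_rotT (q : ℍ[ℤ]) (hq : IsPrimitive q) :
    (Odd (Quaternion.normSq q) →
      HasSingleCSML (rotT q hq) (2 * (Quaternion.normSq q : ℤ))) ∧
    (Quaternion.normSq q ≡ 0 [ZMOD 4] →
      HasSingleCSML (rotT q hq) ((Quaternion.normSq q : ℤ) / 2)) ∧
    (Quaternion.normSq q ≡ 2 [ZMOD 4] →
      HasDoubleCSML (rotT q hq) ((Quaternion.normSq q : ℤ) / 2)) := by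
  refine ⟨fun h => ?_, fun h => ?_, fun h => ?_⟩
  · obtain ⟨p, hp, hn, hpq, hr⟩ := representedBy_rotR_of_odd hq h
    rw [← hpq]
    exact_mod_cast hr.neg.hasSingleCSML hp hn
  · obtain ⟨p, hp, hn, hpq, hr⟩ := representedBy_rotR_of_zero_mod_four hq h
    rw [← hpq]
    have : HasSingleCSML (rotT q hq) _ := hr.neg.hasSingleCSML hp hn
    convert this using 1
    push_cast
    ring
  · obtain ⟨p, hp, hn, hpq, hr⟩ := representedBy_rotR_of_two_mod_four hq h
    have h1 := hr.neg
    rw [neg_neg] at h1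
    rw [← hpq]
    have : HasDoubleCSML (rotT q hq) _ := h1.hasDoubleCSML hp hn
    convert this using 1
    push_cast
    ring

theorem theorem7p3 :
    -- the linear coincidence isometries of the diamond packing form the group `OC(Γ)`
    (∃ H : Subgroup (Orth 3), (H : Set (Orth 3)) = latticeOC fccLattice ∧
      multilatticeOC fccLattice diamondShifts = (H : Set (Orth 3))) ∧
    -- its elements are the `R_q` (rotations) and the `T_q` (rotoreflections), `q` primitive
    latticeSOC fccLattice = {R | ∃ (q : ℍ[ℤ]) (hq : IsPrimitive q), R = rotR q hq} ∧
    latticeOC fccLattice \ latticeSOC fccLattice =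
      {T | ∃ (q : ℍ[ℤ]) (hq : IsPrimitive q), T = rotT q hq} ∧
    -- CSMLs and indices of `R_q`
    (∀ (q : ℍ[ℤ]) (hq : IsPrimitive q),
      (Quaternion.normSq q ≡ 2 [ZMOD 4] →
        HasSingleCSML (rotR q hq) (Quaternion.normSq q : ℤ)) ∧
      (Odd (Quaternion.normSq q) →
        HasDoubleCSML (rotR q hq) (Quaternion.normSq q : ℤ)) ∧
      (Quaternion.normSq q ≡ 0 [ZMOD 4] →
        HasDoubleCSML (rotR q hq) ((Quaternion.normSq q : ℤ) / 4))) ∧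
    -- CSMLs and indices of `T_q`
    (∀ (q : ℍ[ℤ]) (hq : IsPrimitive q),
      (Odd (Quaternion.normSq q) →
        HasSingleCSML (rotT q hq) (2 * (Quaternion.normSq q : ℤ))) ∧
      (Quaternion.normSq q ≡ 0 [ZMOD 4] →
        HasSingleCSML (rotT q hq) ((Quaternion.normSq q : ℤ) / 2)) ∧
      (Quaternion.normSq q ≡ 2 [ZMOD 4] →
        HasDoubleCSML (rotT q hq) ((Quaternion.normSq q : ℤ) / 2))) ∧
    -- the number of CSMLs of given index
    (∀ N : ℕ, (csmlsOfIndexLE fccLattice diamondShifts N).Finite) ∧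
    diamondCount 1 = 1 ∧
    (∀ m n : ℕ, m.Coprime n → diamondCount (m * n) = diamondCount m * diamondCount n) ∧
    (∀ p r : ℕ, p.Prime → 1 ≤ r →
      diamondCount (p ^ r) =
        if p ^ r = 2 then 1 else if p = 2 then 0 else (p + 1) * p ^ (r - 1)) ∧
    -- the Dirichlet series
    (∀ s : ℂ, 2 < s.re →
      LSeriesSummable (fun m => (diamondCount m : ℂ)) s ∧
      LSeriesSummable (fun m => (cslCount cubicLattice m : ℂ)) s ∧
      LSeriesSummable (fun m => (rightIdealCount m : ℂ)) (s / 2) ∧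
      LSeries (fun m => (diamondCount m : ℂ)) s =
        (1 + (2 : ℂ) ^ (-s)) * LSeries (fun m => (cslCount cubicLattice m : ℂ)) s ∧
      LSeries (fun m => (diamondCount m : ℂ)) s = zetaJ (s / 2) / riemannZeta (2 * s) ∧
      zetaJ (s / 2) = (1 - (2 : ℂ) ^ (1 - s)) * riemannZeta s * riemannZeta (s - 1)) ∧
    (List.range 17).map (fun k => diamondCount (k + 1)) =
      [1, 1, 4, 0, 6, 4, 8, 0, 12, 6, 12, 0, 14, 8, 24, 0, 18] ∧
    -- the asymptotic number of CSMLs of index at most `N`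
    Asymptotics.IsEquivalent atTop
      (fun N : ℕ => ((csmlsOfIndexLE fccLattice diamondShifts N).ncard : ℝ))
      (fun N : ℕ => 15 * (N : ℝ) ^ 2 / (4 * Real.pi ^ 2)) := by
  refine ⟨⟨latticeOCSubgroup fccLattice, rfl, multilatticeOC_eq⟩,
    latticeSOC_eq isQuatLattice_fccLattice, latticeOC_diff_latticeSOC_eq isQuatLattice_fccLattice,
    hasCSML_rotR, hasCSML_rotT, finite_csmlsOfIndexLE, diamondCount_one,
    fun m n h => diamondCount_mul h, fun p r hp hr => diamondCount_prime_pow hp hr,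
    fun s hs => ?_, diamondCount_list, isEquivalent_ncard_csmlsOfIndexLE⟩
  obtain ⟨a, ha, haz⟩ := exists_lseriesHasSum_diamondCount hs
  have hJ := lseriesHasSum_rightIdealCount hs
  have hz : riemannZeta (2 * s) ≠ 0 := riemannZeta_ne_zero_of_one_lt_re (by
    simp only [Complex.mul_re, Complex.re_ofNat, Complex.im_ofNat, zero_mul, sub_zero]
    linarith)
  refine ⟨ha.LSeriesSummable, lseriesSummable_cslCount hs, hJ.LSeriesSummable,
    lseries_diamondCount_eq hs, ?_, hJ.LSeries_eq⟩
  rw [ha.LSeries_eq, zetaJ, hJ.LSeries_eq, ← haz, mul_div_cancel_left₀ _ hz]
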